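/- Algorithms are randomized word-RAM algorithms: on an instance with parameters $n$ and $k$ (below) they use memory words of $O(\log(n+k))$ bits, every word operation and every random access to memory costs one step, and a uniformly random integer below a given word can be drawn in one step. An algorithm solves a problem in time $T(n)$ if, on every instance of size $n$, it always halts within $T(n)$ steps and its output is correct with probability at least $2/3$. For a function $d:\mathbb{N}\to\mathbb{N}$, an instance of size $n$ of a problem in $d(n)$ dimensions consists of vectors in $\{0,1\}^k$ for some $k\le d(n)$ (equivalently, of vectors in $\{0,1\}^{d(n)}$ whose final zero coordinates need not be written down). Hitting Set (HS): given sets $A,B\subseteq\{0,1\}^k$ with $|A|=|B|=n$, decide whether some $a\in A$ satisfies $a\cdot b\ne 0$ for every $b\in B$. The Hitting Set Conjecture states that for every $d(n)=\omega(\log n)$ and every constant $\epsilon>0$, no randomized algorithm solves HS in $d(n)$ dimensions in time $O(n^{2-\epsilon})$. $(1+\eta)$-approximate asymmetric EMD matching: given sets $A,B\subseteq\{0,1\}^k$ with $|A|\le|B|=n$, output an injection $\pi:A\to B$ such that $$\sum_{a\in A}\|a-\pi(a)\|_2\le(1+\eta(n))\min_{\sigma}\sum_{a\in A}\|a-\sigma(a)\|_2,$$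 where $\sigma$ ranges over all injections $A\to B$. Theorem. Let $d:\mathbb{N}\to\mathbb{N}$ with $d(n)=\omega(\log n)$, and let $\eta:\mathbb{N}\to\mathbb{R}$ with $\eta(n)>0$ for all large $n$ and $\eta(n)=1/\omega(\log n)$. If for some constant $\epsilon>0$ there is an algorithm that solves $(1+\eta)$-approximate asymmetric EMD matching in $d(n)$ dimensions in time $O(n^{2-\epsilon})$, then the Hitting Set Conjecture is false. -/

import Mathlib

open Asymptotics Filter
open scoped ENNReal

noncomputable section

namespace WordRAM

/-!  A randomized word RAM, presented as a structured programming language with unit-cost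
operations.  A program is a finite piece of syntax.  The memory consists of scalar variables and
of arrays with random access.  All numbers that a program produces have to be smaller than a
bound `W` (the words have `log W` bits); a run that produces a larger number is faulty. -/

/-- Arithmetical, bitwise and comparison instructions on words. -/
inductive BinOp
  | add | sub | mul | div | mod | band | bor | bxor | shl | shr | eq | lt

/-- Value of an instruction; subtraction is truncated at `0`, comparisons return `0` or `1`. -/
def BinOp.eval : BinOp → ℕ → ℕ → ℕ
  | .add, x, y => x + y
  | .sub, x, y => x - y
  | .mul, x, y => x * y
  | .div, x, y => x / y
  | .mod, x, y => x % y
  | .band, x, y => x &&& y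
  | .bor, x, y => x ||| y
  | .bxor, x, y => x ^^^ y
  | .shl, x, y => x <<< y
  | .shr, x, y => x >>> y
  | .eq, x, y => if x = y then 1 else 0
  | .lt, x, y => if x < y then 1 else 0

/-- Expressions: constants, variables, array cells `a[i]`, and instructions. -/
inductive Expr
  | const (v : ℕ)
  | var (x : ℕ)
  | cell (a : ℕ) (i : Expr)
  | bin (o : BinOp) (e₁ e₂ : Expr)

/-- The number of unit-cost operations needed to evaluate an expression. -/
def Expr.size : Expr → ℕ
  | .const _ => 1
  | .var _ => 1
  | .cell _ i => i.size + 1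
  | .bin _ e₁ e₂ => e₁.size + e₂.size + 1

/-- Memory contents, and the number of steps made so far (programs cannot read the latter). -/
structure State where
  vars : ℕ → ℕ
  arrs : ℕ → ℕ → ℕ
  time : ℕ

/-- Let `t` steps pass. -/
def State.tick (s : State) (t : ℕ) : State := { s with time := s.time + t }

def State.setVar (s : State) (x v : ℕ) : State :=
  { s with vars := Function.update s.vars x v }

def State.setCell (s : State) (a i v : ℕ) : State :=
  { s with arrs := Function.update s.arrs a (Function.update (s.arrs a) i v) }

/-- A number fits into a word if it is smaller than `W`. -/
def checked (W v : ℕ) : Option ℕ := if v < W then some v else none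

/-- Value of an expression; `none` if some intermediate result does not fit into a word. -/
def Expr.eval (W : ℕ) (s : State) : Expr → Option ℕ
  | .const v => checked W v
  | .var x => some (s.vars x)
  | .cell a i => (i.eval W s).map (s.arrs a)
  | .bin o e₁ e₂ =>
      (e₁.eval W s).bind fun v₁ => (e₂.eval W s).bind fun v₂ => checked W (o.eval v₁ v₂)

/-- Programs.  `rand x e` stores in `x` a uniformly random element of `{0, …, m - 1}`, where `m` is
the value of `e`.  Conditions hold if they have a nonzero value. -/
inductive Prog
  | skip
  | assign (x : ℕ) (e : Expr)
  | store (a : ℕ) (i e : Expr)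
  | rand (x : ℕ) (e : Expr)
  | seq (p q : Prog)
  | ite (e : Expr) (p q : Prog)
  | while (e : Expr) (p : Prog)

/-- Random outcomes of a computation; the outcome `none` stands for a run that is faulty or has
not yet halted. -/
abbrev Outcome := PMF (Option State)

/-- Continue a computation from its final state. -/
def Outcome.andThen (p : Outcome) (f : State → Outcome) : Outcome :=
  p.bind fun o => o.elim (PMF.pure none) f

/-- At most `fuel - 1` iterations of a loop with condition `e`. -/
def loop (W : ℕ) (e : Expr) (body : State → Outcome) : ℕ → State → Outcome
  | 0, _ => PMF.pure none
  | fuel + 1, s =>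
    match e.eval W s with
    | none => PMF.pure none
    | some 0 => PMF.pure (some (s.tick (e.size + 1)))
    | some (_ + 1) => (body (s.tick (e.size + 1))).andThen (loop W e body fuel)

/-- The distribution of the final state of a program, where a run in which some loop makes `fuel`
iterations or more is counted as not halting. -/
def Prog.exec (W fuel : ℕ) : Prog → State → Outcome
  | .skip, s => PMF.pure (some s)
  | .assign x e, s =>
    PMF.pure ((e.eval W s).map fun v => (s.setVar x v).tick (e.size + 1))
  | .store a i e, s =>
    PMF.pure ((i.eval W s).bind fun j => (e.eval W s).map fun v =>
      (s.setCell a j v).tick (i.size + e.size + 1))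
  | .rand x e, s =>
    match e.eval W s with
    | none => PMF.pure none
    | some 0 => PMF.pure none
    | some (m + 1) =>
      (PMF.uniformOfFintype (Fin (m + 1))).map fun r =>
        some ((s.setVar x (r : ℕ)).tick (e.size + 1))
  | .seq p q, s => (p.exec W fuel s).andThen (q.exec W fuel)
  | .ite e p q, s =>
    match e.eval W s with
    | none => PMF.pure none
    | some 0 => q.exec W fuel (s.tick (e.size + 1))
    | some (_ + 1) => p.exec W fuel (s.tick (e.size + 1))
  | .while e p, s => loop W e (p.exec W fuel) fuel s

/-- Started in `s`, on a machine with numbers below `W`, the randomized program `P` always halts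
without a fault and within `T` steps, and its final state is `good` with probability at least
`2/3`. -/
def Prog.Computes (P : Prog) (W T : ℕ) (s : State) (good : State → Prop) : Prop :=
  ∃ fuel : ℕ,
    (∀ o ∈ (P.exec W fuel s).support, ∃ s' : State, o = some s' ∧ s'.time ≤ T) ∧
    2 / 3 ≤ (P.exec W fuel s).toOuterMeasure {o | ∃ s' : State, o = some s' ∧ good s'}

end WordRAM

open Classical in
/-- The array that holds the coordinates of `m` vectors of `{0,1}^k`, one vector after another. -/
def encodeVectors {m k : ℕ} (A : Fin m → Fin k → Bool) : ℕ → ℕ := fun p =>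
  if ∃ (i : Fin m) (j : Fin k), p = (i : ℕ) * k + (j : ℕ) ∧ A i j = true then 1 else 0

/-- The memory before a program is run on two lists of vectors in `{0,1}^k`: variable `0` holds
`|B|`, variable `1` holds `|A|`, variable `2` holds `k`, array `0` holds `A`, array `1` holds `B`,
and everything else is `0`. -/
def inputState {m n k : ℕ} (A : Fin m → Fin k → Bool) (B : Fin n → Fin k → Bool) :
    WordRAM.State where
  vars := fun x => if x = 0 then n else if x = 1 then m else if x = 2 then k else 0
  arrs := fun a => if a = 0 then encodeVectors A else if a = 1 then encodeVectors B else fun _ => 0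
  time := 0

/-- The running time `T` is `O(n ^ e)`. -/
def IsBigOPow (T : ℕ → ℕ) (e : ℝ) : Prop :=
  (fun n : ℕ => (T n : ℝ)) =O[atTop] fun n : ℕ => (n : ℝ) ^ e

/-- `f(n) = ω(log n)`. -/
def IsOmegaLog (f : ℕ → ℝ) : Prop :=
  (fun n : ℕ => Real.log n) =o[atTop] f

/-! ### Hitting Set -/

/-- The inner product of two vectors of `{0,1}^k`. -/
def dot {k : ℕ} (a b : Fin k → Bool) : ℕ := ∑ l, (a l).toNat * (b l).toNat

/-- Some `a ∈ A` has `a · b ≠ 0` for every `b ∈ B`. -/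
def HasHittingVector {n k : ℕ} (A B : Fin n → Fin k → Bool) : Prop :=
  ∃ i, ∀ j, dot (A i) (B j) ≠ 0

/-- The Hitting Set problem in `d(n)` dimensions (the instances of size `n` are the pairs of
`n`-element subsets of `{0,1}^k` with `k ≤ d n`, each listed without repetitions) is solved by some
randomized algorithm, with words of `O(log (n + k))` bits, in time `O(n ^ e)`.  The answer is
returned in variable `0` (nonzero for yes). -/
def HittingSetSolvable (d : ℕ → ℕ) (e : ℝ) : Prop :=
  ∃ (P : WordRAM.Prog) (c : ℕ) (T : ℕ → ℕ), IsBigOPow T e ∧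
    ∀ (n k : ℕ), k ≤ d n → ∀ (A B : Fin n → Fin k → Bool),
      Function.Injective A → Function.Injective B →
      P.Computes ((n + k + 2) ^ c) (T n) (inputState A B)
        fun s => s.vars 0 ≠ 0 ↔ HasHittingVector A B

/-- The Hitting Set Conjecture. -/
def HittingSetConjecture : Prop :=
  ∀ d : ℕ → ℕ, IsOmegaLog (fun n => (d n : ℝ)) →
    ∀ ε : ℝ, 0 < ε → ¬ HittingSetSolvable d (2 - ε)

/-! ### Asymmetric Earth Mover Distance -/

/-- The cost of matching `A` into `B` along an injection. -/
def matchingCost {m n k : ℕ} (A : Fin m → EuclideanSpace ℝ (Fin k))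
    (B : Fin n → EuclideanSpace ℝ (Fin k)) (π : Fin m ↪ Fin n) : ℝ :=
  ∑ i, dist (A i) (B (π i))

/-- The asymmetric Earth Mover Distance: the minimum cost of an injection (a minimum over a finite
set, which is nonempty for `m ≤ n`). -/
def asymEMD {m n k : ℕ} (A : Fin m → EuclideanSpace ℝ (Fin k))
    (B : Fin n → EuclideanSpace ℝ (Fin k)) : ℝ :=
  ⨅ π : Fin m ↪ Fin n, matchingCost A B π

/-- A vector of `{0,1}^k` as a point of Euclidean space. -/
def toPoint {k : ℕ} (a : Fin k → Bool) : EuclideanSpace ℝ (Fin k) :=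
  WithLp.toLp 2 fun j => if a j then 1 else 0

/-- `(1 + η)`-approximate asymmetric EMD matching in `d(n)` dimensions (the instances of size `n`
are the pairs of subsets `A, B` of `{0,1}^k` with `k ≤ d n` and `|A| ≤ |B| = n`, each listed without
repetitions) is solved by some randomized algorithm, with words of `O(log (n + k))` bits, in time
`O(n ^ e)`.  The matching is returned in array `2`. -/
def AsymEMDMatchingSolvable (d : ℕ → ℕ) (η : ℕ → ℝ) (e : ℝ) : Prop :=
  ∃ (P : WordRAM.Prog) (c : ℕ) (T : ℕ → ℕ), IsBigOPow T e ∧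
    ∀ (n k m : ℕ), k ≤ d n → m ≤ n →
      ∀ (A : Fin m → Fin k → Bool) (B : Fin n → Fin k → Bool),
      Function.Injective A → Function.Injective B →
      P.Computes ((n + k + 2) ^ c) (T n) (inputState A B)
        fun s => ∃ π : Fin m ↪ Fin n, (∀ i : Fin m, s.arrs 2 (i : ℕ) = (π i : ℕ)) ∧
          matchingCost (toPoint ∘ A) (toPoint ∘ B) π
            ≤ (1 + η n) * asymEMD (toPoint ∘ A) (toPoint ∘ B)

end

/-!
A matching algorithm `P` in dimension `d` is turned into an algorithm for the hitting set problem
in a dimension `d' = ω(log n)` that is at most `(log n) ^ 2`, at most `d / 5`, and at most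
`1 / (8 * η)`.

The idea.  Gadgets turn the inner product into a distance: a pair of vectors gets distance
`√(2 * k + 2 * (a · b))` (`dist_gadgets`).  If every `a` still under consideration can be matched to
an orthogonal `b`, then a `(1 + η)`-approximate matching has to match at least half of them to
orthogonal vectors, because `η` is small compared to `1 / k` (`two_mul_card_bad_le`).  These are
checked and removed, and the procedure is repeated with the rest.  A vector is removed only when an
orthogonal partner has been found for it, so an instance with a hitting vector is never answered
wrongly, and failures of `P` only cost a round: the expected number of remaining vectors shrinks by
the factor `2 / 3` per round (`bound_roundProg`).  Since `n ≤ 2 ^ k`, `2 * k + 5` rounds suffice.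

A matching is injective, while one `b` may be needed by many `a`.  Therefore the instance contains
`c ≈ n ^ (1 / q)` copies of each `b`, told apart by extra coordinates that do not affect the
distances.  This suffices once there are no heavy vectors left, that is, vectors whose partner
(the last orthogonal vector in the list) is also the partner of more than `c` others.  Those are
removed beforehand: the partner of a random vector is found by exhaustive search, and everything
orthogonal to it is removed; a fixed heavy vector survives this with probability at most `1 - c / n`
(`sum_countP_heavy_le`), so `(n / c + 1) * (k + 2)` repetitions suffice.  The two phases take time
about `n ^ 2 / c` and `T (n * c)`, both of which are truly subquadratic for large `q`.

The algorithm is an actual program of the word RAM.  It is verified in a small probabilistic program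
logic whose judgements `Outcome.Bound` combine a sure postcondition (including the running time)
with a bound on the mean of a potential; the rule `bound_for` multiplies the potential by `ρ` per
iteration.  The program `P` expects a memory that is
empty apart from its input, so each call runs in a fresh region of memory (`Prog.reloc`,
`mean_reloc_le`).
-/

namespace WordRAM

/-! ### Expectations and sure properties of random outcomes -/

/-- The expected value of `g` at the final state; a fault counts as `∞`, so that a finite mean
rules faults out. -/
noncomputable def Outcome.mean (p : Outcome) (g : State → ℝ≥0∞) : ℝ≥0∞ :=
  ∑' o, p o * o.elim ⊤ g

/-- No run is faulty, and the final state of every run satisfies `Q`. -/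
def Outcome.Sure (p : Outcome) (Q : State → Prop) : Prop :=
  ∀ o ∈ p.support, ∃ s, o = some s ∧ Q s

/-- The judgement of the probabilistic program logic: `Q` holds surely at the end, and the mean of
`g` is at most `x`. -/
def Outcome.Bound (p : Outcome) (Q : State → Prop) (g : State → ℝ≥0∞) (x : ℝ≥0∞) : Prop :=
  p.Sure Q ∧ p.mean g ≤ x

theorem mean_pure (s : State) (g : State → ℝ≥0∞) :
    Outcome.mean (PMF.pure (some s)) g = g s := by
  unfold Outcome.mean
  rw [tsum_eq_single (some s)]
  · simp
  · intro o ho; simp [ho]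

theorem mean_pure_none (g : State → ℝ≥0∞) : Outcome.mean (PMF.pure none) g = ⊤ := by
  unfold Outcome.mean
  rw [tsum_eq_single none]
  · simp
  · intro o ho; simp [ho]

theorem mean_bind {α : Type*} (p : PMF α) (f : α → Outcome) (g : State → ℝ≥0∞) :
    Outcome.mean (p.bind f) g = ∑' a, p a * (f a).mean g := by
  unfold Outcome.mean
  simp only [PMF.bind_apply, ← ENNReal.tsum_mul_right, ← ENNReal.tsum_mul_left]
  rw [ENNReal.tsum_comm]
  simp only [mul_assoc]

theorem mean_andThen (p : Outcome) (f : State → Outcome) (g : State → ℝ≥0∞) :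
    (p.andThen f).mean g = p.mean fun s => (f s).mean g := by
  unfold Outcome.andThen
  rw [mean_bind]
  refine tsum_congr fun o => ?_
  cases o with
  | none => simp [mean_pure_none]
  | some s => rfl

theorem mean_mono_of_sure {p : Outcome} {Q : State → Prop} (h : p.Sure Q) {g g' : State → ℝ≥0∞}
    (hg : ∀ s, Q s → g s ≤ g' s) : p.mean g ≤ p.mean g' := by
  refine ENNReal.tsum_le_tsum fun o => ?_
  by_cases ho : p o = 0
  · simp [ho]
  · obtain ⟨s, rfl, hs⟩ := h o ((PMF.mem_support_iff _ _).2 ho)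
    exact mul_le_mul_right (hg s hs) _

theorem mean_const_of_sure {p : Outcome} {Q : State → Prop} (h : p.Sure Q) (x : ℝ≥0∞) :
    (p.mean fun _ => x) = x := by
  have : (p.mean fun _ => x) = ∑' o, p o * x := by
    refine tsum_congr fun o => ?_
    by_cases ho : p o = 0
    · simp [ho]
    · obtain ⟨s, rfl, _⟩ := h o ((PMF.mem_support_iff _ _).2 ho)
      rfl
  rw [this, ENNReal.tsum_mul_right, PMF.tsum_coe, one_mul]

theorem mean_const_mul_of_sure {p : Outcome} {Q : State → Prop} (h : p.Sure Q) (x : ℝ≥0∞)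
    (g : State → ℝ≥0∞) : (p.mean fun s => x * g s) = x * p.mean g := by
  unfold Outcome.mean
  rw [← ENNReal.tsum_mul_left]
  refine tsum_congr fun o => ?_
  by_cases ho : p o = 0
  · simp [ho]
  · obtain ⟨s, rfl, _⟩ := h o ((PMF.mem_support_iff _ _).2 ho)
    simp only [Option.elim]
    ring

theorem mean_add (p : Outcome) (g g' : State → ℝ≥0∞) :
    (p.mean fun s => g s + g' s) = p.mean g + p.mean g' := by
  unfold Outcome.mean
  rw [← ENNReal.tsum_add]
  refine tsum_congr fun o => ?_
  cases o
  · simp [← mul_add]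
  · simp [mul_add]

open Classical in
/-- A finite mean of a function that is infinite off `Q` forces `Q`. -/
theorem bound_of_mean {p : Outcome} {Q : State → Prop} {g : State → ℝ≥0∞} {x : ℝ≥0∞}
    (hx : x ≠ ⊤) (h : (p.mean fun s => if Q s then g s else ⊤) ≤ x) : p.Bound Q g x := by
  have key : ∀ o ∈ p.support, ∃ s, o = some s ∧ Q s := by
    intro o ho
    have h1 : p o * o.elim ⊤ (fun s => if Q s then g s else ⊤) ≤ x :=
      (ENNReal.le_tsum o).trans h
    have h0 : p o ≠ 0 := (PMF.mem_support_iff _ _).1 ho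
    cases o with
    | none => simp [ENNReal.mul_top h0, hx] at h1
    | some s =>
      refine ⟨s, rfl, ?_⟩
      by_contra hQ
      simp [hQ, ENNReal.mul_top h0, hx] at h1
  refine ⟨key, le_trans ?_ h⟩
  exact mean_mono_of_sure key fun s hs => by simp [hs]

theorem sure_pure {s : State} {Q : State → Prop} (h : Q s) :
    Outcome.Sure (PMF.pure (some s)) Q := by
  intro o ho
  rw [PMF.support_pure] at ho
  exact ⟨s, ho, h⟩

theorem Outcome.Sure.mono {p : Outcome} {Q R : State → Prop} (h : p.Sure Q)
    (hQ : ∀ s, Q s → R s) : p.Sure R := by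
  intro o ho
  obtain ⟨s, rfl, hs⟩ := h o ho
  exact ⟨s, rfl, hQ s hs⟩

theorem Outcome.Sure.andThen {p : Outcome} {f : State → Outcome} {Q R : State → Prop}
    (h : p.Sure Q) (hf : ∀ s, Q s → (f s).Sure R) : (p.andThen f).Sure R := by
  intro o ho
  obtain ⟨o', ho', h'⟩ := (PMF.mem_support_bind_iff _ _ _).1 ho
  obtain ⟨s, rfl, hs⟩ := h o' ho'
  exact hf s hs o h'

theorem Outcome.Bound.andThen {p : Outcome} {f : State → Outcome} {Q R : State → Prop}
    {g g' : State → ℝ≥0∞} {x : ℝ≥0∞} (h : p.Bound Q g x) (hf : ∀ s, Q s → (f s).Bound R g' (g s)) :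
    (p.andThen f).Bound R g' x := by
  refine ⟨h.1.andThen fun s hs => (hf s hs).1, ?_⟩
  rw [mean_andThen]
  exact (mean_mono_of_sure h.1 fun s hs => (hf s hs).2).trans h.2

theorem Outcome.Sure.bound {p : Outcome} {Q : State → Prop} {g : State → ℝ≥0∞} {x : ℝ≥0∞}
    (h : p.Sure Q) (hg : ∀ s, Q s → g s ≤ x) : p.Bound Q g x :=
  ⟨h, (mean_mono_of_sure h hg).trans (mean_const_of_sure h x).le⟩

theorem Outcome.Bound.mono {p : Outcome} {Q R : State → Prop} {g g' : State → ℝ≥0∞}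
    {x y : ℝ≥0∞} (h : p.Bound Q g x) (hQ : ∀ s, Q s → R s) (hg : ∀ s, Q s → g' s ≤ g s)
    (hx : x ≤ y) : p.Bound R g' y :=
  ⟨h.1.mono hQ, (mean_mono_of_sure h.1 hg).trans (h.2.trans hx)⟩

open Classical in
/-- The mean of the indicator of failure is the probability of failure, so a judgement of the
program logic gives a success probability of at least `2 / 3`. -/
theorem Prog.computes_of_bound {P : Prog} {W T F : ℕ} {s : State} {good : State → Prop}
    (h : (P.exec W F s).Bound (fun s' => s'.time ≤ T) (fun s' => if good s' then 0 else 1) (1 / 3)) :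
    P.Computes W T s good := by
  refine ⟨F, h.1, ?_⟩
  set p := P.exec W F s
  set S : Set (Option State) := {o | ∃ s' : State, o = some s' ∧ good s'}
  have h1 : (1 : ℝ≥0∞) ≤ p.toOuterMeasure S + p.mean fun s' => if good s' then 0 else 1 := by
    rw [← PMF.tsum_coe p, PMF.toOuterMeasure_apply, Outcome.mean, ← ENNReal.tsum_add]
    refine ENNReal.tsum_le_tsum fun o => ?_
    cases o with
    | none =>
      by_cases h0 : p none = 0
      · simp [h0]
      · simp [ENNReal.mul_top h0]
    | some s' =>
      by_cases hg : good s'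
      · have : some s' ∈ S := ⟨s', rfl, hg⟩
        simp [this]
      · simp [hg]
  have h2 : (2 / 3 : ℝ≥0∞) + 1 / 3 ≤ p.toOuterMeasure S + 1 / 3 := by
    calc (2 / 3 : ℝ≥0∞) + 1 / 3 = 1 := by
          rw [← ENNReal.add_div]; norm_num; exact ENNReal.div_self (by simp) (by simp)
      _ ≤ _ := h1.trans (add_le_add_right h.2 _)
  exact (ENNReal.add_le_add_iff_right (by simp)).1 h2

open Classical in
/-- All runs halt within time `T` without a fault, and the final state fails to be `good` with
probability at most `1 / 3`, expressed by a single mean. -/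
def Outcome.Succeeds (p : Outcome) (T : ℕ) (good : State → Prop) : Prop :=
  p.mean (fun s => if s.time ≤ T then if good s then 0 else 1 else ⊤) ≤ 1 / 3

theorem Prog.Computes.succeeds {P : Prog} {W T : ℕ} {s : State} {good : State → Prop}
    (h : P.Computes W T s good) : ∃ F, (P.exec W F s).Succeeds T good := by
  classical
  obtain ⟨F, h1, h2⟩ := h
  refine ⟨F, ?_⟩
  unfold Outcome.Succeeds
  set p := P.exec W F s
  set S : Set (Option State) := {o | ∃ s' : State, o = some s' ∧ good s'}
  have h3 : p.toOuterMeasure S + (p.mean fun s' => if s'.time ≤ T then if good s' then 0 else 1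
      else ⊤) = 1 := by
    rw [← PMF.tsum_coe p, PMF.toOuterMeasure_apply, Outcome.mean, ← ENNReal.tsum_add]
    refine tsum_congr fun o => ?_
    by_cases h0 : p o = 0
    · simp [h0, Set.indicator_apply]
    obtain ⟨s', rfl, hs'⟩ := h1 o ((PMF.mem_support_iff _ _).2 h0)
    by_cases hg : good s'
    · have : some s' ∈ S := ⟨s', rfl, hg⟩
      simp [this, hs', hg]
    · have : some s' ∉ S := by rintro ⟨t, ht, hgt⟩; cases ht; exact hg hgt
      simp [hs', hg, this]
  have h4 : (2 / 3 : ℝ≥0∞) + (p.mean fun s' => if s'.time ≤ T then if good s' then 0 else 1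
      else ⊤) ≤ 2 / 3 + 1 / 3 := by
    calc _ ≤ (1 : ℝ≥0∞) := (add_le_add_left h2 _).trans h3.le
      _ = 2 / 3 + 1 / 3 := by
          rw [← ENNReal.add_div]; norm_num; exact (ENNReal.div_self (by simp) (by simp)).symm
  exact (ENNReal.add_le_add_iff_left (by finiteness)).1 h4

/-! ### A program logic for the word RAM -/

/-- The value of an expression on a machine with unbounded words. -/
def Expr.val (s : State) : Expr → ℕ
  | .const v => v
  | .var x => s.vars x
  | .cell a i => s.arrs a (i.val s)
  | .bin o e₁ e₂ => o.eval (e₁.val s) (e₂.val s)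

/-- All intermediate results in the evaluation of an expression fit into a word. -/
def Expr.Fits (W : ℕ) (s : State) : Expr → Prop
  | .const v => v < W
  | .var _ => True
  | .cell _ i => i.Fits W s
  | .bin o e₁ e₂ => e₁.Fits W s ∧ e₂.Fits W s ∧ o.eval (e₁.val s) (e₂.val s) < W

theorem Expr.Fits.eval_eq {W : ℕ} {s : State} : ∀ {e : Expr}, e.Fits W s →
    e.eval W s = some (e.val s)
  | .const v, h => by simp only [Expr.Fits] at h; simp [Expr.eval, checked, Expr.val, h]
  | .var x, _ => rfl
  | .cell a i, h => by
    simp only [Expr.Fits] at h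
    simp [Expr.eval, Expr.val, eval_eq h]
  | .bin o e₁ e₂, h => by
    obtain ⟨h1, h2, h3⟩ := h
    simp [Expr.eval, Expr.val, eval_eq h1, eval_eq h2, checked, h3]

@[simp] theorem State.setVar_vars (s : State) (x v y : ℕ) :
    (s.setVar x v).vars y = if y = x then v else s.vars y := by
  simp [State.setVar, Function.update_apply]
@[simp] theorem State.setVar_arrs (s : State) (x v : ℕ) : (s.setVar x v).arrs = s.arrs := rfl
@[simp] theorem State.setVar_time (s : State) (x v : ℕ) : (s.setVar x v).time = s.time := rfl
@[simp] theorem State.tick_vars (s : State) (t : ℕ) : (s.tick t).vars = s.vars := rfl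
@[simp] theorem State.tick_arrs (s : State) (t : ℕ) : (s.tick t).arrs = s.arrs := rfl
@[simp] theorem State.tick_time (s : State) (t : ℕ) : (s.tick t).time = s.time + t := rfl
@[simp] theorem State.setCell_vars (s : State) (a i v : ℕ) : (s.setCell a i v).vars = s.vars := rfl
@[simp] theorem State.setCell_time (s : State) (a i v : ℕ) : (s.setCell a i v).time = s.time := rfl
theorem State.setCell_arrs (s : State) (a i v b j : ℕ) :
    (s.setCell a i v).arrs b j = if b = a ∧ j = i then v else s.arrs b j := by
  by_cases hb : b = a
  · subst hb; simp [State.setCell, Function.update_apply]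
  · simp [State.setCell, hb]
@[simp] theorem State.setCell_arrs_of_ne (s : State) {a i v b : ℕ} (h : b ≠ a) :
    (s.setCell a i v).arrs b = s.arrs b := by
  simp [State.setCell, h]

variable {W F : ℕ} {s : State} {Q R : State → Prop} {g g' : State → ℝ≥0∞} {x : ℝ≥0∞}

theorem sure_skip (h : Q s) : (Prog.skip.exec W F s).Sure Q := sure_pure h

theorem sure_assign {y : ℕ} {e : Expr} (he : e.Fits W s)
    (h : Q ((s.setVar y (e.val s)).tick (e.size + 1))) :
    ((Prog.assign y e).exec W F s).Sure Q := by
  simp only [Prog.exec, he.eval_eq]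
  exact sure_pure h

theorem sure_store {a : ℕ} {i e : Expr} (hi : i.Fits W s) (he : e.Fits W s)
    (h : Q ((s.setCell a (i.val s) (e.val s)).tick (i.size + e.size + 1))) :
    ((Prog.store a i e).exec W F s).Sure Q := by
  simp only [Prog.exec, he.eval_eq, hi.eval_eq]
  exact sure_pure h

theorem sure_seq {p q : Prog} (hp : (p.exec W F s).Sure Q)
    (hq : ∀ s, Q s → (q.exec W F s).Sure R) : ((p.seq q).exec W F s).Sure R :=
  hp.andThen hq

theorem bound_seq {p q : Prog} (hp : (p.exec W F s).Bound Q g x)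
    (hq : ∀ s, Q s → (q.exec W F s).Bound R g' (g s)) : ((p.seq q).exec W F s).Bound R g' x :=
  hp.andThen hq

theorem sure_assign_seq {y : ℕ} {e : Expr} {q : Prog} (he : e.Fits W s)
    (h : (q.exec W F ((s.setVar y (e.val s)).tick (e.size + 1))).Sure Q) :
    (((Prog.assign y e).seq q).exec W F s).Sure Q :=
  sure_seq (Q := fun s' => s' = (s.setVar y (e.val s)).tick (e.size + 1))
    (sure_assign he rfl) (by rintro _ rfl; exact h)

theorem sure_store_seq {a : ℕ} {i e : Expr} {q : Prog} (hi : i.Fits W s) (he : e.Fits W s)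
    (h : (q.exec W F ((s.setCell a (i.val s) (e.val s)).tick (i.size + e.size + 1))).Sure Q) :
    (((Prog.store a i e).seq q).exec W F s).Sure Q :=
  sure_seq (Q := fun s' => s' = (s.setCell a (i.val s) (e.val s)).tick (i.size + e.size + 1))
    (sure_store hi he rfl) (by rintro _ rfl; exact h)

theorem exec_ite {e : Expr} {p q : Prog} (he : e.Fits W s) :
    (Prog.ite e p q).exec W F s = if e.val s = 0 then q.exec W F (s.tick (e.size + 1))
      else p.exec W F (s.tick (e.size + 1)) := by
  simp only [Prog.exec, he.eval_eq]
  cases h : e.val s <;> simp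

theorem exec_rand {y : ℕ} {e : Expr} {m : ℕ} (he : e.eval W s = some (m + 1)) :
    (Prog.rand y e).exec W F s = (PMF.uniformOfFintype (Fin (m + 1))).bind fun r =>
      PMF.pure (some ((s.setVar y (r : ℕ)).tick (e.size + 1))) := by
  simp only [Prog.exec, he]
  change PMF.map _ (PMF.bind _ fun a => PMF.pure _) = _
  rw [PMF.map_bind]
  simp [PMF.pure_map]

theorem mean_rand {y : ℕ} {e : Expr} (he : e.Fits W s) (h0 : e.val s ≠ 0) :
    ((Prog.rand y e).exec W F s).mean g = (e.val s : ℝ≥0∞)⁻¹ *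
      ∑ r ∈ Finset.range (e.val s), g ((s.setVar y r).tick (e.size + 1)) := by
  obtain ⟨m, hm⟩ := Nat.exists_eq_succ_of_ne_zero h0
  rw [exec_rand (he.eval_eq.trans (congrArg some hm)), mean_bind, tsum_fintype, hm]
  simp only [mean_pure, PMF.uniformOfFintype_apply, Fintype.card_fin]
  rw [Finset.mul_sum, Finset.sum_range]

theorem sure_rand {y : ℕ} {e : Expr} (he : e.Fits W s) (h0 : e.val s ≠ 0)
    (h : ∀ r < e.val s, Q ((s.setVar y r).tick (e.size + 1))) :
    ((Prog.rand y e).exec W F s).Sure Q := by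
  obtain ⟨m, hm⟩ := Nat.exists_eq_succ_of_ne_zero h0
  rw [exec_rand (he.eval_eq.trans (congrArg some hm))]
  intro o ho
  obtain ⟨r, -, hr⟩ := (PMF.mem_support_bind_iff _ _ _).1 ho
  rw [PMF.support_pure] at hr
  exact ⟨_, hr, h r (by have := r.2; omega)⟩

/-! ### Frame rule -/

/-- The variable `x` is the target of some assignment in the program. -/
def Prog.WritesVar (x : ℕ) : Prog → Prop
  | .skip => False
  | .assign y _ => x = y
  | .store _ _ _ => False
  | .rand y _ => x = y
  | .seq p q => p.WritesVar x ∨ q.WritesVar x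
  | .ite _ p q => p.WritesVar x ∨ q.WritesVar x
  | .while _ p => p.WritesVar x

/-- The array `a` is the target of some store instruction in the program. -/
def Prog.WritesArr (a : ℕ) : Prog → Prop
  | .skip => False
  | .assign _ _ => False
  | .store b _ _ => a = b
  | .rand _ _ => False
  | .seq p q => p.WritesArr a ∨ q.WritesArr a
  | .ite _ p q => p.WritesArr a ∨ q.WritesArr a
  | .while _ p => p.WritesArr a

/-- `p` changes neither the variables outside `V` nor the arrays outside `A` of `s`. -/
def Outcome.Frame (p : Outcome) (V A : ℕ → Prop) (s : State) : Prop :=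
  ∀ s', some s' ∈ p.support →
    (∀ x, ¬ V x → s'.vars x = s.vars x) ∧ ∀ a, ¬ A a → s'.arrs a = s.arrs a

theorem Outcome.Frame.andThen {p : Outcome} {f : State → Outcome} {V A : ℕ → Prop}
    (hp : p.Frame V A s) (hf : ∀ s, (f s).Frame V A s) : (p.andThen f).Frame V A s := by
  intro s' hs'
  obtain ⟨o, ho, h⟩ := (PMF.mem_support_bind_iff _ _ _).1 hs'
  cases o with
  | none => simp at h
  | some t =>
    have h1 := hp t ho
    have h2 := hf t s' h
    exact ⟨fun x hx => (h2.1 x hx).trans (h1.1 x hx), fun a ha => (h2.2 a ha).trans (h1.2 a ha)⟩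

theorem Outcome.Frame.mono {p : Outcome} {V A V' A' : ℕ → Prop}
    (hp : p.Frame V A s) (hV : ∀ x, V x → V' x) (hA : ∀ x, A x → A' x) : p.Frame V' A' s :=
  fun s' hs' => ⟨fun x hx => (hp s' hs').1 x (mt (hV x) hx),
    fun a ha => (hp s' hs').2 a (mt (hA a) ha)⟩

theorem Outcome.Frame.of_tick {p : Outcome} {V A : ℕ → Prop} {t : ℕ}
    (hp : p.Frame V A (s.tick t)) : p.Frame V A s := hp

theorem frame_none {V A : ℕ → Prop} : Outcome.Frame (PMF.pure none) V A s := by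
  intro s' hs'; simp at hs'

/-- A program changes only the variables and arrays that it mentions as targets. -/
theorem Prog.exec_frame (W F : ℕ) (p : Prog) (s : State) :
    (p.exec W F s).Frame (p.WritesVar ·) (p.WritesArr ·) s := by
  induction p generalizing s with
  | skip => intro s' hs'; simp [Prog.exec] at hs'; simp [hs']
  | assign y e =>
    intro s' hs'
    simp [Prog.exec] at hs'
    obtain ⟨v, -, rfl⟩ := hs'
    refine ⟨fun x hx => ?_, fun a _ => rfl⟩
    simp only [Prog.WritesVar] at hx
    simp [hx]
  | store a i e =>
    intro s' hs'
    simp only [Prog.exec, PMF.support_pure, Set.mem_singleton_iff] at hs'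
    have hs' := hs'.symm
    simp only [Option.bind_eq_some_iff, Option.map_eq_some_iff] at hs'
    obtain ⟨j, -, v, -, rfl⟩ := hs'
    refine ⟨fun x _ => rfl, fun b hb => ?_⟩
    simp only [Prog.WritesArr] at hb
    simp [hb]
  | rand y e =>
    simp only [Prog.exec]
    cases h : e.eval W s with
    | none => exact frame_none
    | some m =>
      cases m with
      | zero => exact frame_none
      | succ m =>
        intro s' hs'
        obtain ⟨r, -, hr⟩ := (PMF.mem_support_map_iff _ _ _).1 hs'
        obtain rfl := Option.some.inj hr
        refine ⟨fun x hx => ?_, fun a _ => rfl⟩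
        simp only [Prog.WritesVar] at hx
        simp [hx]
  | seq p q hp hq =>
    refine Outcome.Frame.andThen ?_ fun t => ?_
    · exact (hp s).mono (fun _ => Or.inl) fun _ => Or.inl
    · exact (hq t).mono (fun _ => Or.inr) fun _ => Or.inr
  | ite e p q hp hq =>
    simp only [Prog.exec]
    cases h : e.eval W s with
    | none => exact frame_none
    | some m =>
      cases m with
      | zero => exact (hq _).mono (fun _ => Or.inr) fun _ => Or.inr
      | succ m => exact (hp _).mono (fun _ => Or.inl) fun _ => Or.inl
  -- the constructor `while`
  | _ =>
    rename_i e p hp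
    simp only [Prog.exec]
    have : ∀ f s, (loop W e (p.exec W F) f s).Frame (p.WritesVar ·) (p.WritesArr ·) s := by
      intro f
      induction f with
      | zero => intro s; exact frame_none
      | succ f ih =>
        intro s
        simp only [loop]
        cases h : e.eval W s with
        | none => exact frame_none
        | some m =>
          cases m with
          | zero => intro s' hs'; simp at hs'; simp [hs']
          | succ m => exact ((hp (s.tick (e.size + 1))).andThen ih).of_tick
    exact this F s

theorem Outcome.Sure.frame {p : Prog} (h : (p.exec W F s).Sure Q) :
    (p.exec W F s).Sure fun s' => Q s' ∧ (∀ x, ¬ p.WritesVar x → s'.vars x = s.vars x) ∧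
      ∀ a, ¬ p.WritesArr a → s'.arrs a = s.arrs a := by
  intro o ho
  obtain ⟨s', rfl, hs'⟩ := h o ho
  exact ⟨s', rfl, hs', p.exec_frame W F s s' ho⟩

theorem Outcome.Bound.frame {p : Prog} (h : (p.exec W F s).Bound Q g x) :
    (p.exec W F s).Bound (fun s' => Q s' ∧ (∀ x, ¬ p.WritesVar x → s'.vars x = s.vars x) ∧
      ∀ a, ¬ p.WritesArr a → s'.arrs a = s.arrs a) g x :=
  ⟨h.1.frame, h.2⟩

/-! ### Counting loops -/

/-- `for y = 0, …, (value of variable h) - 1 do body`. -/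
def forLoop (y h : ℕ) (body : Prog) : Prog :=
  .seq (.assign y (.const 0)) (.while (.bin .lt (.var y) (.var h))
    (.seq body (.assign y (.bin .add (.var y) (.const 1)))))

/-- Rule for counting loops: if every iteration multiplies the mean of the potential `Φ` by at
most `ρ`, then `n` iterations multiply it by at most `ρ ^ n`. -/
theorem bound_for {y h n τ : ℕ} {body : Prog} (Inv : ℕ → State → Prop) (Φ : State → ℝ≥0∞)
    (ρ : ℝ≥0∞) (hyh : h ≠ y) (hy : ¬ body.WritesVar y) (hh : ¬ body.WritesVar h)
    (hW : 1 < W) (hnW : n < W) (hF : W ≤ F) (hs : s.vars h = n)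
    (hstep : ∀ i s v t, Inv i s → Inv i ((s.setVar y v).tick t))
    (hΦ : ∀ s v t, Φ ((s.setVar y v).tick t) = Φ s)
    (h0 : Inv 0 s)
    (hbody : ∀ i < n, ∀ s, s.vars y = i → s.vars h = n → Inv i s →
      (body.exec W F s).Bound (fun s' => Inv (i + 1) s' ∧ s'.time ≤ s.time + τ) Φ (ρ * Φ s)) :
    ((forLoop y h body).exec W F s).Bound
      (fun s' => Inv n s' ∧ s'.time ≤ s.time + 6 + n * (τ + 8)) Φ (ρ ^ n * Φ s) := by
  have key : ∀ m i f s, i + m = n → m < f → s.vars y = i → s.vars h = n → Inv i s →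
      (loop W (.bin .lt (.var y) (.var h)) ((Prog.seq body
        (.assign y (.bin .add (.var y) (.const 1)))).exec W F) f s).Bound
        (fun s' => Inv n s' ∧ s'.time ≤ s.time + 4 + m * (τ + 8)) Φ (ρ ^ m * Φ s) := by
    intro m
    induction m with
    | zero =>
      intro i f s hi hf hsy hsh hInv
      obtain ⟨f, rfl⟩ := Nat.exists_eq_succ_of_ne_zero (by omega : f ≠ 0)
      have hfit : (Expr.bin .lt (.var y) (.var h)).Fits W s := by
        simp only [Expr.Fits, BinOp.eval]; split_ifs <;> simp <;> omega
      have hval : (Expr.bin .lt (.var y) (.var h)).val s = 0 := by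
        simp [Expr.val, BinOp.eval, hsy, hsh]; omega
      simp only [loop, hfit.eval_eq, hval]
      refine ⟨sure_pure ⟨?_, by simp [Expr.size]⟩, ?_⟩
      · have := hstep i s (s.vars y) 4 hInv
        rw [show i = n by omega] at this
        have hs : s.tick ((Expr.bin .lt (.var y) (.var h)).size + 1) =
            (s.setVar y (s.vars y)).tick 4 := by simp [State.setVar, State.tick, Expr.size]
        rwa [hs]
      · rw [mean_pure, pow_zero, one_mul, ← hΦ s (s.vars y) 4]
        exact le_of_eq (congrArg Φ (by simp [State.setVar, State.tick, Expr.size]))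
    | succ m ih =>
      intro i f s hi hf hsy hsh hInv
      obtain ⟨f, rfl⟩ := Nat.exists_eq_succ_of_ne_zero (by omega : f ≠ 0)
      have hfit : (Expr.bin .lt (.var y) (.var h)).Fits W s := by
        simp only [Expr.Fits, BinOp.eval]; split_ifs <;> simp <;> omega
      have hval : (Expr.bin .lt (.var y) (.var h)).val s = 0 + 1 := by
        simp [Expr.val, BinOp.eval, hsy, hsh]; omega
      have htick : s.tick ((Expr.bin .lt (.var y) (.var h)).size + 1) = (s.setVar y (s.vars y)).tick 4 := by
        simp [State.setVar, State.tick, Expr.size]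
      simp only [loop, hfit.eval_eq, hval]
      rw [htick]
      have hb := (hbody i (by omega) ((s.setVar y (s.vars y)).tick 4) (by simp [hsy])
        (by simp [hyh, hsh]) (hstep _ _ _ _ hInv)).frame
      rw [hΦ] at hb
      have hseq : ((Prog.seq body (.assign y (.bin .add (.var y) (.const 1)))).exec W F
          ((s.setVar y (s.vars y)).tick 4)).Bound (fun s' => Inv (i + 1) s' ∧
            s'.time ≤ s.time + 4 + τ + 4 ∧ s'.vars y = i + 1 ∧ s'.vars h = n) Φ (ρ * Φ s) := by
        refine bound_seq hb ?_
        rintro s1 ⟨⟨h1, h2⟩, h3, -⟩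
        have hsy1 : s1.vars y = i := by rw [h3 y hy]; simp [hsy]
        have hsh1 : s1.vars h = n := by rw [h3 h hh]; simp [hyh, hsh]
        have hfit1 : (Expr.bin .add (.var y) (.const 1)).Fits W s1 := by
          simp only [Expr.Fits, BinOp.eval, Expr.val, hsy1]
          refine ⟨trivial, hW, ?_⟩
          omega
        refine Outcome.Sure.bound (Q := fun s' => s' = (s1.setVar y (i + 1)).tick 4)
          (g := Φ) (sure_assign hfit1 ?_) ?_ |>.mono ?_ (fun _ _ => le_rfl) le_rfl
        · simp [Expr.val, BinOp.eval, hsy1, Expr.size]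
        · rintro _ rfl; rw [hΦ]
        · rintro _ rfl
          refine ⟨hstep _ _ _ _ h1, ?_, by simp, by simp [hyh, hsh1]⟩
          simp at h2 ⊢; omega
      have hseq' : ((Prog.seq body (.assign y (.bin .add (.var y) (.const 1)))).exec W F
          ((s.setVar y (s.vars y)).tick 4)).Bound (fun s' => Inv (i + 1) s' ∧
            s'.time ≤ s.time + 4 + τ + 4 ∧ s'.vars y = i + 1 ∧ s'.vars h = n)
            (fun s' => ρ ^ m * Φ s') (ρ ^ (m + 1) * Φ s) := by
        refine ⟨hseq.1, ?_⟩
        rw [mean_const_mul_of_sure hseq.1, pow_succ, mul_assoc]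
        exact mul_le_mul_right hseq.2 _
      refine Outcome.Bound.andThen hseq' ?_
      rintro s2 ⟨h1, h2, h3, h4⟩
      refine (ih (i + 1) f s2 (by omega) (by omega) h3 h4 h1).mono ?_ (fun _ _ => le_rfl) le_rfl
      rintro s3 ⟨h5, h6⟩
      refine ⟨h5, ?_⟩
      rw [Nat.succ_mul]
      omega
  refine Outcome.Bound.andThen (Q := fun s' => s' = (s.setVar y 0).tick 2) (g := fun s' => ρ ^ n * Φ s')
    (Outcome.Sure.bound (sure_assign (by simp [Expr.Fits]; omega) ?_) ?_) ?_
  · simp [Expr.val, Expr.size]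
  · rintro _ rfl; rw [hΦ]
  · rintro _ rfl
    refine (key n 0 F _ (by omega) (by omega) (by simp) (by simp [hyh, hs])
      (hstep _ _ _ _ h0)).mono ?_ (fun _ _ => le_rfl) le_rfl
    rintro s' ⟨h1, h2⟩
    refine ⟨h1, ?_⟩
    simp at h2
    omega

theorem sure_for {y h n τ : ℕ} {body : Prog} (Inv : ℕ → State → Prop)
    (hyh : h ≠ y) (hy : ¬ body.WritesVar y) (hh : ¬ body.WritesVar h)
    (hW : 1 < W) (hnW : n < W) (hF : W ≤ F) (hs : s.vars h = n)
    (hstep : ∀ i s v t, Inv i s → Inv i ((s.setVar y v).tick t))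
    (h0 : Inv 0 s)
    (hbody : ∀ i < n, ∀ s, s.vars y = i → s.vars h = n → Inv i s →
      (body.exec W F s).Sure (fun s' => Inv (i + 1) s' ∧ s'.time ≤ s.time + τ)) :
    ((forLoop y h body).exec W F s).Sure
      (fun s' => Inv n s' ∧ s'.time ≤ s.time + 6 + n * (τ + 8)) :=
  (bound_for Inv (fun _ => 0) 0 hyh hy hh hW hnW hF hs hstep (fun _ _ _ => rfl) h0
    fun i hi s h1 h2 h3 => (hbody i hi s h1 h2 h3).bound fun _ _ => zero_le).1

end WordRAM

namespace WordRAM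

/-! ### Relocation: running a program in a fresh region of memory -/

/-- The expression `e` with its memory moved into the region that starts at the value of variable
`b`: variable `x` becomes the cell of array `a₀ + 2 * x + 1` at the start of the region, and array
`a` becomes the part of array `a₀ + 2 * a` inside the region. -/
def Expr.reloc (a₀ b : ℕ) : Expr → Expr
  | .const v => .const v
  | .var x => .cell (a₀ + 2 * x + 1) (.var b)
  | .cell a i => .cell (a₀ + 2 * a) (.bin .add (i.reloc a₀ b) (.var b))
  | .bin o e₁ e₂ => .bin o (e₁.reloc a₀ b) (e₂.reloc a₀ b)

/-- The program `p` with its memory moved as in `Expr.reloc`; random numbers pass through the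
variable `z`. -/
def Prog.reloc (a₀ b z : ℕ) : Prog → Prog
  | .skip => .skip
  | .assign x e => .store (a₀ + 2 * x + 1) (.var b) (e.reloc a₀ b)
  | .store a i e => .store (a₀ + 2 * a) (.bin .add (i.reloc a₀ b) (.var b)) (e.reloc a₀ b)
  | .rand x e => .seq (.rand z (e.reloc a₀ b)) (.store (a₀ + 2 * x + 1) (.var b) (.var z))
  | .seq p q => .seq (p.reloc a₀ b z) (q.reloc a₀ b z)
  | .ite e p q => .ite (e.reloc a₀ b) (p.reloc a₀ b z) (q.reloc a₀ b z)
  | .while e p => .while (e.reloc a₀ b) (p.reloc a₀ b z)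

/-- The state `s'` of the machine that runs a relocated program represents the state `s` of the
original program in the region `[base, base + V)`, and agrees with `r` outside that region. -/
structure Reloc (a₀ z V base t₀ : ℕ) (r s s' : State) : Prop where
  var : ∀ x, s'.arrs (a₀ + 2 * x + 1) base = s.vars x
  cell : ∀ a i, i < V → s'.arrs (a₀ + 2 * a) (base + i) = s.arrs a i
  var_lt : ∀ x, s.vars x < V
  cell_lt : ∀ a i, s.arrs a i < V
  frame_var : ∀ x, x ≠ z → s'.vars x = r.vars x
  frame_arr : ∀ a, a < a₀ → s'.arrs a = r.arrs a
  frame_cell : ∀ a i, base + V ≤ i → s'.arrs a i = r.arrs a i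
  time : s'.time ≤ t₀ + 4 * s.time

theorem Expr.one_le_size (e : Expr) : 1 ≤ e.size := by cases e <;> simp [Expr.size]

theorem Expr.size_reloc (a₀ b : ℕ) (e : Expr) : (e.reloc a₀ b).size ≤ 3 * e.size := by
  induction e with
  | const v => simp [Expr.reloc, Expr.size]
  | var x => simp [Expr.reloc, Expr.size]
  | cell a i ih => simp [Expr.reloc, Expr.size]; omega
  | bin o e₁ e₂ h₁ h₂ => simp [Expr.reloc, Expr.size]; omega

variable {a₀ b z V base t₀ W W' F F' : ℕ} {r s s' : State}

/-- Relocated expressions have the same values; no overflow occurs because `base + V ≤ W'`. -/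
theorem Reloc.eval (h : Reloc a₀ z V base t₀ r s s') (hbz : b ≠ z) (hb : r.vars b = base)
    (hW : W ≤ V) (hW' : base + V ≤ W') (e : Expr) (v : ℕ) (he : e.eval W s = some v) :
    v < V ∧ (e.reloc a₀ b).eval W' s' = some v := by
  have hb' : s'.vars b = base := (h.frame_var b hbz).trans hb
  induction e generalizing v with
  | const v' =>
    simp only [Expr.eval, checked] at he
    split_ifs at he with hv
    cases he
    refine ⟨by omega, ?_⟩
    simp only [Expr.reloc, Expr.eval, checked]
    rw [if_pos (by omega)]
  | var x =>
    simp only [Expr.eval] at he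
    cases he
    refine ⟨h.var_lt x, ?_⟩
    simp [Expr.reloc, Expr.eval, hb', h.var]
  | cell a i ih =>
    simp only [Expr.eval, Option.map_eq_some_iff] at he
    obtain ⟨j, hj, rfl⟩ := he
    obtain ⟨h1, h2⟩ := ih j hj
    refine ⟨h.cell_lt a j, ?_⟩
    have hlt : BinOp.add.eval j base < W' := by simp only [BinOp.eval]; omega
    simp only [Expr.reloc, Expr.eval, h2, hb', Option.bind_some, checked, if_pos hlt]
    simp [BinOp.eval, add_comm j, h.cell a j h1]
  | bin o e₁ e₂ ih₁ ih₂ =>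
    simp only [Expr.eval, Option.bind_eq_some_iff] at he
    obtain ⟨v₁, hv₁, v₂, hv₂, he⟩ := he
    unfold checked at he
    split_ifs at he with hv
    cases he
    refine ⟨by omega, ?_⟩
    simp only [Expr.reloc, Expr.eval, (ih₁ _ hv₁).2, (ih₂ _ hv₂).2, Option.bind_some, checked]
    rw [if_pos (by omega)]

theorem Reloc.tick (h : Reloc a₀ z V base t₀ r s s') {t t' : ℕ} (ht : t' ≤ 4 * t) :
    Reloc a₀ z V base t₀ r (s.tick t) (s'.tick t') where
  var := h.var
  cell := h.cell
  var_lt := h.var_lt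
  cell_lt := h.cell_lt
  frame_var := h.frame_var
  frame_arr := h.frame_arr
  frame_cell := h.frame_cell
  time := by have := h.time; simp; omega

theorem Reloc.setVar (h : Reloc a₀ z V base t₀ r s s') (x v : ℕ) (hv : v < V) :
    Reloc a₀ z V base t₀ r (s.setVar x v) (s'.setCell (a₀ + 2 * x + 1) base v) where
  var y := by
    rw [State.setCell_arrs, State.setVar_vars, h.var]
    by_cases hy : y = x <;> simp [hy]
  cell a i hi := by
    rw [State.setCell_arrs_of_ne _ (by omega)]
    exact h.cell a i hi
  var_lt y := by
    rw [State.setVar_vars]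
    split_ifs
    · exact hv
    · exact h.var_lt y
  cell_lt := h.cell_lt
  frame_var := h.frame_var
  frame_arr a ha := by rw [State.setCell_arrs_of_ne _ (by omega), h.frame_arr a ha]
  frame_cell a i hi := by rw [State.setCell_arrs, if_neg (by omega), h.frame_cell a i hi]
  time := h.time

theorem Reloc.setCell (h : Reloc a₀ z V base t₀ r s s') (a i v : ℕ) (hv : v < V) (hi : i < V) :
    Reloc a₀ z V base t₀ r (s.setCell a i v) (s'.setCell (a₀ + 2 * a) (base + i) v) where
  var y := by
    rw [State.setCell_arrs_of_ne _ (by omega)]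
    exact h.var y
  cell a' i' hi' := by
    rw [State.setCell_arrs, State.setCell_arrs, h.cell a' i' hi']
    exact if_congr (by omega) rfl rfl
  var_lt := h.var_lt
  cell_lt a' i' := by
    rw [State.setCell_arrs]
    split_ifs
    · exact hv
    · exact h.cell_lt a' i'
  frame_var := h.frame_var
  frame_arr a ha := by rw [State.setCell_arrs_of_ne _ (by omega), h.frame_arr a ha]
  frame_cell a i hi := by rw [State.setCell_arrs, if_neg (by omega), h.frame_cell a i hi]
  time := h.time

theorem Reloc.setTemp (h : Reloc a₀ z V base t₀ r s s') (v : ℕ) :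
    Reloc a₀ z V base t₀ r s (s'.setVar z v) where
  var := h.var
  cell := h.cell
  var_lt := h.var_lt
  cell_lt := h.cell_lt
  frame_var x hx := by rw [State.setVar_vars, if_neg hx, h.frame_var x hx]
  frame_arr := h.frame_arr
  frame_cell := h.frame_cell
  time := h.time

/-- A relocated program behaves like the original one, also with longer words and more fuel: a
functional that is smaller at related states has a smaller mean. -/
theorem mean_reloc_le (hbz : b ≠ z) (hb : r.vars b = base) (hW : W ≤ V) (hW' : base + V ≤ W')
    (hF : F ≤ F') (P : Prog) (s s' : State) (g g' : State → ℝ≥0∞)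
    (h : Reloc a₀ z V base t₀ r s s') (hg : ∀ s s', Reloc a₀ z V base t₀ r s s' → g' s' ≤ g s) :
    ((P.reloc a₀ b z).exec W' F' s').mean g' ≤ (P.exec W F s).mean g := by
  have hbs {s s' : State} (h : Reloc a₀ z V base t₀ r s s') : s'.vars b = base :=
    (h.frame_var b hbz).trans hb
  induction P generalizing s s' g g' with
  | skip => simpa only [Prog.reloc, Prog.exec, mean_pure] using hg s s' h
  | assign x e =>
    simp only [Prog.reloc, Prog.exec]
    cases he : e.eval W s with
    | none => simp [mean_pure_none]
    | some v =>
      obtain ⟨hv, he'⟩ := h.eval hbz hb hW hW' e v he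
      simp only [Expr.eval, he', Option.bind_some, Option.map_some, mean_pure, hbs h]
      refine hg _ _ ((h.setVar x v hv).tick ?_)
      have := e.size_reloc a₀ b
      simp only [Expr.size]; omega
  | store a i e =>
    simp only [Prog.reloc, Prog.exec]
    cases hi : i.eval W s with
    | none => simp [mean_pure_none]
    | some j =>
      cases he : e.eval W s with
      | none => simp [mean_pure_none]
      | some v =>
        obtain ⟨hv, he'⟩ := h.eval hbz hb hW hW' e v he
        obtain ⟨hj, hi'⟩ := h.eval hbz hb hW hW' i j hi
        have hlt : BinOp.add.eval j base < W' := by simp only [BinOp.eval]; omega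
        have hidx : (Expr.bin .add (i.reloc a₀ b) (.var b)).eval W' s' = some (base + j) := by
          simp only [Expr.eval, hi', Option.bind_some, hbs h, checked, if_pos hlt]
          simp [BinOp.eval, add_comm]
        simp only [he', hidx, Option.bind_some, Option.map_some, mean_pure]
        refine hg _ _ ((h.setCell a j v hv hj).tick ?_)
        have := e.size_reloc a₀ b
        have := i.size_reloc a₀ b
        simp only [Expr.size]; omega
  | rand x e =>
    cases he : e.eval W s with
    | none => simp [Prog.exec, he, mean_pure_none]
    | some m =>
      cases m with
      | zero => simp [Prog.exec, he, mean_pure_none]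
      | succ m =>
        obtain ⟨hv, he'⟩ := h.eval hbz hb hW hW' e _ he
        rw [exec_rand he, Prog.reloc, Prog.exec, exec_rand he', mean_andThen, mean_bind, mean_bind]
        refine ENNReal.tsum_le_tsum fun y => mul_le_mul_right ?_ _
        rw [mean_pure, mean_pure]
        have h1 := (h.setTemp y).tick (t := 0) (t' := 0) le_rfl
        simp only [Prog.exec, Expr.eval, Option.bind_some, Option.map_some, mean_pure]
        have hb1 := hbs (h.setTemp (y : ℕ))
        simp only [State.tick_vars, hb1]
        simp only [State.setVar_vars, if_pos]
        have := hg _ _ (((h.setTemp y).setVar x y (by have := y.2; omega)).tick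
          (t := e.size + 1) (t' := (e.reloc a₀ b).size + 1 + 3) ?_)
        · exact this
        · have := e.size_reloc a₀ b
          have := e.one_le_size
          omega
  | seq p q hp hq =>
    simp only [Prog.reloc, Prog.exec, mean_andThen]
    exact hp _ _ _ _ h fun t t' ht => hq _ _ _ _ ht hg
  | ite e p q hp hq =>
    simp only [Prog.reloc, Prog.exec]
    have hsz := e.size_reloc a₀ b
    cases he : e.eval W s with
    | none => simp [mean_pure_none]
    | some m =>
      obtain ⟨hv, he'⟩ := h.eval hbz hb hW hW' e m he
      simp only [he']
      cases m with
      | zero => exact hq _ _ _ _ (h.tick (by omega)) hg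
      | succ m => exact hp _ _ _ _ (h.tick (by omega)) hg
  -- the constructor `while`
  | _ =>
    rename_i e p hp
    simp only [Prog.reloc, Prog.exec]
    have hsz := e.size_reloc a₀ b
    -- the relocated loop may have more fuel left, which only avoids faults
    have key : ∀ f f' s s', f ≤ f' → Reloc a₀ z V base t₀ r s s' →
        (loop W' (e.reloc a₀ b) ((p.reloc a₀ b z).exec W' F') f' s').mean g' ≤
          (loop W e (p.exec W F) f s).mean g := by
      intro f
      induction f with
      | zero => intro f' s s' _ _; simp [loop, mean_pure_none]
      | succ f ih =>
        intro f' s s' hf h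
        obtain ⟨f', rfl⟩ := Nat.exists_eq_succ_of_ne_zero (by omega : f' ≠ 0)
        simp only [loop]
        cases he : e.eval W s with
        | none => simp [mean_pure_none]
        | some m =>
          obtain ⟨hv, he'⟩ := h.eval hbz hb hW hW' e m he
          simp only [he']
          cases m with
          | zero =>
            simp only [mean_pure]
            exact hg _ _ (h.tick (by omega))
          | succ m =>
            simp only [mean_andThen]
            exact hp _ _ _ _ (h.tick (by omega)) fun t t' ht => ih f' t t' (by omega) ht
    exact key F F' s s' hF h

end WordRAM

/-! ### The reduction to matching: vectors and distances -/

theorem encodeVectors_apply {m k : ℕ} (A : Fin m → Fin k → Bool) (i : Fin m) (l : Fin k) :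
    encodeVectors A (i * k + l) = (A i l).toNat := by
  have hu : ∀ (i' : Fin m) (l' : Fin k), (i : ℕ) * k + l = i' * k + l' → i' = i ∧ l' = l := by
    intro i' l' h
    have hk : 0 < k := l.pos
    have h1 := congrArg (· / k) h
    have h2 := congrArg (· % k) h
    simp only [Nat.add_div_of_dvd_right (Dvd.intro_left _ rfl), Nat.mul_div_cancel _ hk,
      Nat.div_eq_of_lt l.2, Nat.div_eq_of_lt l'.2, Nat.mul_add_mod_self_right,
      Nat.mod_eq_of_lt l.2, Nat.mod_eq_of_lt l'.2] at h1 h2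
    exact ⟨Fin.ext (by omega), Fin.ext h2.symm⟩
  unfold encodeVectors
  cases hA : A i l with
  | true => rw [if_pos ⟨i, l, rfl, hA⟩]; rfl
  | false =>
    rw [if_neg]; · rfl
    rintro ⟨i', l', h, hA'⟩
    obtain ⟨rfl, rfl⟩ := hu i' l' h
    simp [hA] at hA'

theorem encodeVectors_of_le {m k : ℕ} (A : Fin m → Fin k → Bool) {p : ℕ} (hp : m * k ≤ p) :
    encodeVectors A p = 0 := by
  unfold encodeVectors
  rw [if_neg]
  rintro ⟨i, l, rfl, -⟩
  have : (i : ℕ) * k + l < m * k := by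
    calc (i : ℕ) * k + l < i * k + k := by have := l.2; omega
      _ = (i + 1) * k := by ring
      _ ≤ m * k := Nat.mul_le_mul_right _ i.2
  omega

theorem encodeVectors_le_one {m k : ℕ} (A : Fin m → Fin k → Bool) (p : ℕ) :
    encodeVectors A p ≤ 1 := by
  unfold encodeVectors; split_ifs <;> simp

theorem dot_eq_sum {m n k : ℕ} (A : Fin m → Fin k → Bool) (B : Fin n → Fin k → Bool)
    (i : Fin m) (j : Fin n) :
    dot (A i) (B j) =
      ∑ l ∈ Finset.range k, encodeVectors A (i * k + l) * encodeVectors B (j * k + l) := by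
  rw [Finset.sum_range, dot]
  exact Finset.sum_congr rfl fun l _ => by rw [encodeVectors_apply, encodeVectors_apply]

/-- Each bit `x` of the vectors on the left becomes the block `x x 0 0 0`. -/
def leftGadget {m k : ℕ} (A : Fin m → Fin k → Bool) : Fin m → Fin (k * 5) → Bool :=
  fun i l => if (l.modNat : ℕ) ≤ 1 then A i l.divNat else false

/-- The `c` copies of each vector on the right: a bit `x` of the vector number `j` becomes the
block `x̄ 0 x y ȳ` in copy number `t`, where `y` is the same bit of the vector number `t`.  The last
two bits only serve to make the copies distinct. -/
def rightGadget {n k c : ℕ} (hc : c ≤ n) (B : Fin n → Fin k → Bool) :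
    Fin (n * c) → Fin (k * 5) → Bool :=
  fun p l =>
    if (l.modNat : ℕ) = 0 then !(B p.divNat l.divNat)
    else if (l.modNat : ℕ) = 1 then false
    else if (l.modNat : ℕ) = 2 then B p.divNat l.divNat
    else if (l.modNat : ℕ) = 3 then B (Fin.castLE hc p.modNat) l.divNat
    else !(B (Fin.castLE hc p.modNat) l.divNat)

theorem divNat_finProdFinEquiv {m n : ℕ} (x : Fin m × Fin n) :
    (finProdFinEquiv x).divNat = x.1 :=
  congrArg Prod.fst (finProdFinEquiv.symm_apply_apply x)

theorem modNat_finProdFinEquiv {m n : ℕ} (x : Fin m × Fin n) :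
    (finProdFinEquiv x).modNat = x.2 :=
  congrArg Prod.snd (finProdFinEquiv.symm_apply_apply x)

theorem leftGadget_injective {m k : ℕ} {A : Fin m → Fin k → Bool} (hA : Function.Injective A) :
    Function.Injective (leftGadget A) := by
  intro i i' h
  refine hA (funext fun q => ?_)
  simpa [leftGadget, divNat_finProdFinEquiv, modNat_finProdFinEquiv] using
    congrFun h (finProdFinEquiv (q, 0))

theorem rightGadget_injective {n k c : ℕ} (hc : c ≤ n) {B : Fin n → Fin k → Bool}
    (hB : Function.Injective B) : Function.Injective (rightGadget hc B) := by
  intro p p' h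
  have h1 : p.divNat = p'.divNat := by
    refine hB (funext fun q => ?_)
    simpa [rightGadget, divNat_finProdFinEquiv, modNat_finProdFinEquiv] using
      congrFun h (finProdFinEquiv (q, 2))
  have h2 : p.modNat = p'.modNat := by
    refine Fin.castLE_injective hc (hB (funext fun q => ?_))
    simpa [rightGadget, divNat_finProdFinEquiv, modNat_finProdFinEquiv] using
      congrFun h (finProdFinEquiv (q, 3))
  exact finProdFinEquiv.symm.injective (Prod.ext h1 h2)

/-- The gadgets turn the inner product into a distance. -/
theorem dist_gadgets {m n k c : ℕ} (hc : c ≤ n) (A : Fin m → Fin k → Bool)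
    (B : Fin n → Fin k → Bool) (i : Fin m) (p : Fin (n * c)) :
    dist (toPoint (leftGadget A i)) (toPoint (rightGadget hc B p)) =
      √(2 * k + 2 * dot (A i) (B p.divNat)) := by
  rw [EuclideanSpace.dist_eq]
  congr 1
  rw [← finProdFinEquiv.sum_comp, Fintype.sum_prod_type]
  have : ∀ q : Fin k, ∑ t : Fin 5, dist (toPoint (leftGadget A i) (finProdFinEquiv (q, t)))
      (toPoint (rightGadget hc B p) (finProdFinEquiv (q, t))) ^ 2 =
      2 + 2 * (((A i q).toNat * (B p.divNat q).toNat : ℕ) : ℝ) := by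
    intro q
    simp only [Fin.sum_univ_five, toPoint, leftGadget, rightGadget, divNat_finProdFinEquiv,
      modNat_finProdFinEquiv, Real.dist_eq]
    cases A i q <;> cases B p.divNat q <;> cases B (Fin.castLE hc p.modNat) q <;> norm_num
  rw [Finset.sum_congr rfl fun q _ => this q, Finset.sum_add_distrib, ← Finset.mul_sum, dot]
  push_cast
  simp [mul_comm]

/-- Content of the array that holds the left-hand side of the matching instance. -/
theorem encodeVectors_leftGadget {m k : ℕ} (A : Fin m → Fin k → Bool) (u t : ℕ) (ht : t < 5) :
    encodeVectors (leftGadget A) (5 * u + t) = if t ≤ 1 then encodeVectors A u else 0 := by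
  by_cases hu : u < m * k
  · have hx : 5 * u + t = ((⟨u, hu⟩ : Fin (m * k)).divNat : ℕ) * (k * 5) +
        (finProdFinEquiv ((⟨u, hu⟩ : Fin (m * k)).modNat, (⟨t, ht⟩ : Fin 5)) : ℕ) := by
      simp only [Fin.coe_divNat, finProdFinEquiv_apply_val, Fin.coe_modNat]
      have := Nat.div_add_mod u k
      have : 5 * u = 5 * (k * (u / k)) + 5 * (u % k) := by rw [← mul_add, this]
      rw [this]; ring
    have hu' : u = ((⟨u, hu⟩ : Fin (m * k)).divNat : ℕ) * k +
        ((⟨u, hu⟩ : Fin (m * k)).modNat : ℕ) := by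
      simp only [Fin.coe_divNat, Fin.coe_modNat]
      rw [mul_comm, Nat.div_add_mod]
    conv_rhs => rw [hu', encodeVectors_apply]
    rw [hx, encodeVectors_apply]
    simp only [leftGadget, divNat_finProdFinEquiv, modNat_finProdFinEquiv]
    split_ifs <;> rfl
  · rw [encodeVectors_of_le, encodeVectors_of_le] <;> [simp; omega; skip]
    rw [← mul_assoc]; omega

/-- Content of the array that holds the right-hand side of the matching instance. -/
theorem encodeVectors_rightGadget {n k c : ℕ} (hc : c ≤ n) (B : Fin n → Fin k → Bool) (u t : ℕ)
    (hu : u < n * c * k) (ht : t < 5) :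
    encodeVectors (rightGadget hc B) (5 * u + t) =
      if t = 0 then 1 - encodeVectors B (u / k / c * k + u % k)
      else if t = 1 then 0
      else if t = 2 then encodeVectors B (u / k / c * k + u % k)
      else if t = 3 then encodeVectors B (u / k % c * k + u % k)
      else 1 - encodeVectors B (u / k % c * k + u % k) := by
  set v : Fin (n * c * k) := ⟨u, hu⟩
  have hx : 5 * u + t = (v.divNat : ℕ) * (k * 5) +
      (finProdFinEquiv (v.modNat, (⟨t, ht⟩ : Fin 5)) : ℕ) := by
    simp only [Fin.coe_divNat, finProdFinEquiv_apply_val, Fin.coe_modNat, v]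
    have := Nat.div_add_mod u k
    have : 5 * u = 5 * (k * (u / k)) + 5 * (u % k) := by rw [← mul_add, this]
    rw [this]; ring
  have h1 : encodeVectors B (u / k / c * k + u % k) = (B v.divNat.divNat v.modNat).toNat :=
    encodeVectors_apply B v.divNat.divNat v.modNat
  have h2 : encodeVectors B (u / k % c * k + u % k) =
      (B (Fin.castLE hc v.divNat.modNat) v.modNat).toNat :=
    encodeVectors_apply B (Fin.castLE hc v.divNat.modNat) v.modNat
  rw [hx, encodeVectors_apply, h1, h2]
  simp only [rightGadget, divNat_finProdFinEquiv, modNat_finProdFinEquiv]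
  cases B v.divNat.divNat v.modNat <;> cases B (Fin.castLE hc v.divNat.modNat) v.modNat <;>
    split_ifs <;> rfl

theorem asymEMD_le {m n k : ℕ} (A : Fin m → EuclideanSpace ℝ (Fin k))
    (B : Fin n → EuclideanSpace ℝ (Fin k)) (σ : Fin m ↪ Fin n) :
    asymEMD A B ≤ matchingCost A B σ :=
  ciInf_le (Set.finite_range _).bddBelow σ

theorem asymEMD_nonneg {m n k : ℕ} (A : Fin m → EuclideanSpace ℝ (Fin k))
    (B : Fin n → EuclideanSpace ℝ (Fin k)) : 0 ≤ asymEMD A B :=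
  Real.iInf_nonneg fun _ => Finset.sum_nonneg fun _ _ => dist_nonneg

/-- If all vectors can be matched to orthogonal partners, then a nearly optimal matching gives
orthogonal partners to at least half of the vectors: the costs `√(2 * k)` and `√(2 * k + 2)` of good
and bad pairs differ by a factor of about `1 + 1 / (2 * k)`. -/
theorem two_mul_card_bad_le {m n k c : ℕ} (hc : c ≤ n) (hk : 1 ≤ k) (A : Fin m → Fin k → Bool)
    (B : Fin n → Fin k → Bool) (σ : Fin m ↪ Fin (n * c))
    (hσ : ∀ i, dot (A i) (B (σ i).divNat) = 0) (π : Fin m ↪ Fin (n * c)) {η : ℝ}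
    (hη : 8 * k * η ≤ 1)
    (hπ : matchingCost (toPoint ∘ leftGadget A) (toPoint ∘ rightGadget hc B) π ≤
      (1 + η) * asymEMD (toPoint ∘ leftGadget A) (toPoint ∘ rightGadget hc B)) :
    2 * (Finset.univ.filter fun i => dot (A i) (B (π i).divNat) ≠ 0).card ≤ m := by
  set a : ℝ := √(2 * k) with ha
  set b : ℝ := √(2 * k + 2) with hb
  set bad := Finset.univ.filter fun i => dot (A i) (B (π i).divNat) ≠ 0 with hbad
  have hk' : (1 : ℝ) ≤ k := by exact_mod_cast hk
  have ha2 : a ^ 2 = 2 * k := Real.sq_sqrt (by positivity)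
  have hb2 : b ^ 2 = 2 * k + 2 := Real.sq_sqrt (by positivity)
  have ha0 : 0 < a := Real.sqrt_pos.2 (by positivity)
  have hab : a < b := Real.sqrt_lt_sqrt (by positivity) (by linarith)
  have hcost : ∀ τ : Fin m ↪ Fin (n * c),
      matchingCost (toPoint ∘ leftGadget A) (toPoint ∘ rightGadget hc B) τ =
        ∑ i, √(2 * k + 2 * dot (A i) (B (τ i).divNat)) := fun τ =>
    Finset.sum_congr rfl fun i _ => dist_gadgets hc A B i (τ i)
  have hopt : asymEMD (toPoint ∘ leftGadget A) (toPoint ∘ rightGadget hc B) ≤ m * a := by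
    refine (asymEMD_le _ _ σ).trans (le_of_eq ?_)
    rw [hcost, Finset.sum_congr rfl fun i _ => by rw [hσ i]]
    simp [ha]
  -- a bad pair costs at least `b` because inner products are integers
  have hlow : m * a + bad.card * (b - a) ≤
      matchingCost (toPoint ∘ leftGadget A) (toPoint ∘ rightGadget hc B) π := by
    have : (m : ℝ) * a + bad.card * (b - a) =
        ∑ i : Fin m, (a + if dot (A i) (B (π i).divNat) ≠ 0 then b - a else 0) := by
      rw [Finset.sum_add_distrib, ← Finset.sum_filter, Finset.sum_const, Finset.sum_const]
      simp [hbad]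
    rw [this, hcost]
    refine Finset.sum_le_sum fun i _ => ?_
    split_ifs with h
    · have h1 : (1 : ℝ) ≤ dot (A i) (B (π i).divNat) := by
        exact_mod_cast Nat.one_le_iff_ne_zero.2 h
      rw [add_sub_cancel]
      exact Real.sqrt_le_sqrt (by linarith)
    · rw [add_zero]
      exact Real.sqrt_le_sqrt (by have := Nat.cast_nonneg (α := ℝ) (dot (A i) (B (π i).divNat)); linarith)
  have hopt0 := asymEMD_nonneg (toPoint ∘ leftGadget A) (toPoint ∘ rightGadget hc B)
  have hmain : (bad.card : ℝ) * (b - a) * (8 * k) ≤ m * a := by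
    have h1 : matchingCost (toPoint ∘ leftGadget A) (toPoint ∘ rightGadget hc B) π * (8 * k) ≤
        (8 * k + 1) * (m * a) := by
      calc _ ≤ ((1 + η) * asymEMD (toPoint ∘ leftGadget A) (toPoint ∘ rightGadget hc B)) * (8 * k) :=
            mul_le_mul_of_nonneg_right hπ (by positivity)
        _ = (8 * k + 8 * k * η) * asymEMD (toPoint ∘ leftGadget A) (toPoint ∘ rightGadget hc B) := by
            ring
        _ ≤ (8 * k + 1) * asymEMD (toPoint ∘ leftGadget A) (toPoint ∘ rightGadget hc B) :=
            mul_le_mul_of_nonneg_right (by linarith) hopt0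
        _ ≤ _ := mul_le_mul_of_nonneg_left hopt (by positivity)
    nlinarith [mul_le_mul_of_nonneg_right hlow (by positivity : (0 : ℝ) ≤ 8 * k)]
  -- `(b - a) * (b + a) = 2` and `a * (a + b) ≤ 2 * b ^ 2 ≤ 8 * k`
  have hmul : (bad.card : ℝ) * 2 * (8 * k) ≤ m * (8 * k) := by
    calc (bad.card : ℝ) * 2 * (8 * k) = (bad.card * (b - a) * (8 * k)) * (b + a) := by
          have : (b - a) * (b + a) = 2 := by nlinarith
          rw [← this]; ring
      _ ≤ (m * a) * (b + a) := mul_le_mul_of_nonneg_right hmain (by positivity)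
      _ = m * (a * (b + a)) := by ring
      _ ≤ m * (8 * k) := by
          refine mul_le_mul_of_nonneg_left ?_ (Nat.cast_nonneg _)
          nlinarith
  have : (bad.card : ℝ) * 2 ≤ m := le_of_mul_le_mul_right hmul (by positivity)
  exact_mod_cast (by linarith : (2 : ℝ) * bad.card ≤ m)

/-- A function whose fibres have at most `c` elements lifts to an injection into `c` copies of its
codomain. -/
theorem exists_embedding_copies {m n c : ℕ} (f : Fin m → Fin n)
    (hf : ∀ b, (Finset.univ.filter fun i => f i = b).card ≤ c) :
    ∃ σ : Fin m ↪ Fin (n * c), ∀ i, (σ i).divNat = f i := by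
  -- the copy used by `i` is the number of smaller elements of its fibre
  have hlt : ∀ i, (Finset.univ.filter fun i' => f i' = f i ∧ i' < i).card < c := by
    intro i
    refine lt_of_lt_of_le (Finset.card_lt_card ?_) (hf (f i))
    rw [Finset.ssubset_iff_of_subset]
    · exact ⟨i, by simp, by simp⟩
    · intro j hj; simp at hj ⊢; exact hj.1
  refine ⟨⟨fun i => finProdFinEquiv (f i, ⟨_, hlt i⟩), ?_⟩, fun i => divNat_finProdFinEquiv _⟩
  intro i i' h
  have h' := finProdFinEquiv.injective h
  simp only [Prod.mk.injEq, Fin.mk.injEq] at h'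
  obtain ⟨h1, h2⟩ := h'
  by_contra hne
  wlog hlt' : i < i' generalizing i i'
  · exact this h.symm h1.symm h2.symm (Ne.symm hne) (lt_of_le_of_ne (not_lt.1 hlt') (Ne.symm hne))
  refine absurd h2 (ne_of_lt (Finset.card_lt_card ?_))
  rw [Finset.ssubset_iff_of_subset]
  · exact ⟨i, by simp [h1, hlt'], by simp⟩
  · intro j hj
    simp at hj ⊢
    exact ⟨hj.1.trans h1, hj.2.trans hlt'⟩

/-! ### The algorithm: testing orthogonality -/

/-- The inner product of the vectors number `i` and `j`, read off from the input arrays. -/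
noncomputable def dotAt {m n k : ℕ} (A : Fin m → Fin k → Bool) (B : Fin n → Fin k → Bool)
    (i j : ℕ) : ℕ :=
  ∑ l ∈ Finset.range k, encodeVectors A (i * k + l) * encodeVectors B (j * k + l)

namespace WordRAM

/-! The registers and arrays of the algorithm: the input (`regN`, `regK`, `arrA`, `arrB`), the
number of copies, the size of a memory region and the start of the current one, the temporary
variable of relocated programs, the list of alive vectors (`regLen`, `arrAlive`), loop counters and
bounds, and the arrays into which relocation moves the input and output arrays `0`, `1` and `2` of
the matching program. -/

local notation "regN" => (0 : ℕ)
local notation "regK" => (2 : ℕ)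
local notation "regC" => (3 : ℕ)
local notation "regV" => (4 : ℕ)
local notation "regBase" => (5 : ℕ)
local notation "regTemp" => (6 : ℕ)
local notation "regLen" => (7 : ℕ)
local notation "regI" => (8 : ℕ)
local notation "regL" => (9 : ℕ)
local notation "regAcc" => (10 : ℕ)
local notation "regKept" => (11 : ℕ)
local notation "regCand" => (12 : ℕ)
local notation "regT" => (13 : ℕ)
local notation "regBound" => (14 : ℕ)
local notation "regX" => (15 : ℕ)
local notation "regFound" => (16 : ℕ)
local notation "regSize" => (17 : ℕ)
local notation "arrA" => (0 : ℕ)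
local notation "arrB" => (1 : ℕ)
local notation "arrAlive" => (2 : ℕ)
local notation "arrLeft" => (4 : ℕ)
local notation "arrRight" => (6 : ℕ)
local notation "arrMatch" => (8 : ℕ)

/-- The parameters of the instance and the parameters `c` (copies) and `V` (size of a region) are
in their registers, and the input arrays are intact. -/
structure Ctx {n k : ℕ} (c V : ℕ) (A B : Fin n → Fin k → Bool) (s : State) : Prop where
  n : s.vars regN = n
  k : s.vars regK = k
  c : s.vars regC = c
  V : s.vars regV = V
  A : s.arrs arrA = encodeVectors A
  B : s.arrs arrB = encodeVectors B

theorem Ctx.congr {n k c V : ℕ} {A B : Fin n → Fin k → Bool} {s s' : State} (h : Ctx c V A B s)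
    (h0 : s'.vars regN = s.vars regN) (h2 : s'.vars regK = s.vars regK)
    (h3 : s'.vars regC = s.vars regC) (h4 : s'.vars regV = s.vars regV)
    (hA : s'.arrs arrA = s.arrs arrA) (hB : s'.arrs arrB = s.arrs arrB) : Ctx c V A B s' :=
  ⟨h0.trans h.n, h2.trans h.k, h3.trans h.c, h4.trans h.V, hA.trans h.A, hB.trans h.B⟩

/-- Computes the inner product of the vectors with the numbers in `regX` and `regCand`. -/
def dotProg : Prog :=
  .seq (.assign regAcc (.const 0))
    (forLoop regL regK (.assign regAcc (.bin .add (.var regAcc) (.bin .mul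
      (.cell arrA (.bin .add (.bin .mul (.var regX) (.var regK)) (.var regL)))
      (.cell arrB (.bin .add (.bin .mul (.var regCand) (.var regK)) (.var regL)))))))

/-- Bounds that make all numbers in the algorithm fit into words. -/
structure Room (n k c V W F : ℕ) : Prop where
  n_pos : 1 ≤ n
  k_pos : 1 ≤ k
  c_pos : 1 ≤ c
  c_le : c ≤ n
  V_gt : n * c * (k * 5) + n * c + n * k + 5 * k + n + 20 < V
  W_ge : V * (2 * k + 8) ≤ W
  F_ge : W ≤ F

variable {n k c V W F : ℕ} {A B : Fin n → Fin k → Bool} {s : State}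

theorem Room.V_lt (h : Room n k c V W F) : 8 * V ≤ W := by
  have := h.W_ge
  nlinarith

theorem index_lt {n k i l : ℕ} (hi : i < n) (hl : l < k) : i * k + l < n * k := by
  calc i * k + l < i * k + k := by omega
    _ = (i + 1) * k := by ring
    _ ≤ n * k := Nat.mul_le_mul_right _ hi

theorem sure_dotProg (hR : Room n k c V W F) (hs : Ctx c V A B s) (hx : s.vars regX < n)
    (hy : s.vars regCand < n) :
    (dotProg.exec W F s).Sure fun s' =>
      s'.vars regAcc = dotAt A B (s.vars regX) (s.vars regCand) ∧ s'.time ≤ s.time + 40 * k + 8 := by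
  have hV := hR.V_gt
  have hW := hR.V_lt
  refine sure_assign_seq (by simp only [Expr.Fits]; omega) ?_
  refine (sure_for (τ := 24) (n := k) (fun i s' => Ctx c V A B s' ∧ s'.vars regX = s.vars regX ∧
    s'.vars regCand = s.vars regCand ∧ s'.vars regAcc = ∑ l ∈ Finset.range i,
      encodeVectors A (s.vars regX * k + l) * encodeVectors B (s.vars regCand * k + l))
    (by decide) (by simp [Prog.WritesVar]) (by simp [Prog.WritesVar]) (by omega) (by omega) hR.F_ge
    (by simp [hs.k]) ?_ ?_ ?_).mono ?_
  · rintro i s' v t ⟨h1, h2, h3, h4⟩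
    exact ⟨h1.congr (by simp) (by simp) (by simp) (by simp) rfl rfl, by simp [h2], by simp [h3],
      by simp [h4]⟩
  · exact ⟨hs.congr (by simp) (by simp) (by simp) (by simp) rfl rfl, by simp, by simp,
      by simp [Expr.val]⟩
  · rintro i hi s' hs1 hs2 ⟨h1, h2, h3, h4⟩
    have e1 := index_lt hx hi
    have e2 := index_lt hy hi
    have hsum : s'.vars regAcc ≤ i := by
      rw [h4]
      refine (Finset.sum_le_card_nsmul _ _ 1 fun l _ => ?_).trans (by simp)
      exact Nat.mul_le_mul (encodeVectors_le_one A _) (encodeVectors_le_one B _)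
    have hbit := Nat.mul_le_mul (encodeVectors_le_one A (s.vars regX * k + i))
      (encodeVectors_le_one B (s.vars regCand * k + i))
    refine sure_assign ?_ ?_
    · simp only [Expr.Fits, Expr.val, BinOp.eval, hs1, h2, h3, h1.k, h1.A, h1.B]
      refine ⟨trivial, ⟨⟨⟨trivial, trivial, ?_⟩, trivial, ?_⟩, ⟨⟨trivial, trivial, ?_⟩, trivial, ?_⟩, ?_⟩, ?_⟩ <;>
        omega
    · refine ⟨⟨h1.congr (by simp) (by simp) (by simp) (by simp) rfl rfl, by simp [h2], by simp [h3],
        ?_⟩, by simp [Expr.size]⟩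
      simp only [State.tick_vars, State.setVar_vars, if_pos, Finset.sum_range_succ, Expr.val,
        BinOp.eval, hs1, h2, h3, h1.k, h1.A, h1.B, ← h4]
  · rintro s' ⟨⟨-, -, -, h⟩, ht⟩
    refine ⟨h, ?_⟩
    simp [Expr.size] at ht
    omega

/-- The last `j < m` with `D x j = 0`, or `0` if there is none. -/
def lastZero (D : ℕ → ℕ → ℕ) (x : ℕ) : ℕ → ℕ
  | 0 => 0
  | j + 1 => if D x j = 0 then j else lastZero D x j

theorem lastZero_lt (D : ℕ → ℕ → ℕ) (x : ℕ) {m : ℕ} (hm : 0 < m) : lastZero D x m < m := by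
  induction m with
  | zero => omega
  | succ m ih =>
    simp only [lastZero]
    split_ifs
    · omega
    · rcases Nat.eq_zero_or_pos m with rfl | h
      · simp [lastZero]
      · have := ih h; omega

theorem lastZero_spec (D : ℕ → ℕ → ℕ) (x : ℕ) {m : ℕ} (h : ∃ j < m, D x j = 0) :
    D x (lastZero D x m) = 0 := by
  induction m with
  | zero => obtain ⟨j, hj, -⟩ := h; omega
  | succ m ih =>
    simp only [lastZero]
    split_ifs with h0
    · exact h0
    · obtain ⟨j, hj, hD⟩ := h
      refine ih ⟨j, ?_, hD⟩
      rcases Nat.lt_succ_iff_lt_or_eq.1 hj with h | rfl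
      · exact h
      · exact absurd hD h0

/-- Searches for a vector on the right that is orthogonal to the one with the number in `regX`. -/
def searchProg : Prog :=
  .seq (.assign regFound (.const 0)) (forLoop regI regN
    (.seq (.assign regCand (.var regI)) (.seq dotProg
      (.ite (.var regAcc) .skip (.assign regFound (.var regI))))))

theorem sure_searchProg (hR : Room n k c V W F) (hs : Ctx c V A B s) (hx : s.vars regX < n) :
    (searchProg.exec W F s).Sure fun s' =>
      s'.vars regFound = lastZero (dotAt A B) (s.vars regX) n ∧
        s'.time ≤ s.time + 8 + n * (40 * k + 24) := by
  have hV := hR.V_gt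
  have hW := hR.V_lt
  refine sure_assign_seq (by simp only [Expr.Fits]; omega) ?_
  refine (sure_for (τ := 40 * k + 16) (n := n) (fun i s' => Ctx c V A B s' ∧
    s'.vars regX = s.vars regX ∧ s'.vars regFound = lastZero (dotAt A B) (s.vars regX) i)
    (by decide) (by simp [Prog.WritesVar, dotProg, forLoop])
    (by simp [Prog.WritesVar, dotProg, forLoop]) (by omega) (by omega) hR.F_ge
    (by simp [hs.n]) ?_ ?_ ?_).mono ?_
  · rintro i s' v t ⟨h1, h2, h3⟩
    exact ⟨h1.congr (by simp) (by simp) (by simp) (by simp) rfl rfl, by simp [h2], by simp [h3]⟩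
  · exact ⟨hs.congr (by simp) (by simp) (by simp) (by simp) rfl rfl, by simp,
      by simp [Expr.val, lastZero]⟩
  · rintro i hi s' hs1 hs2 ⟨h1, h2, h3⟩
    refine sure_assign_seq trivial ?_
    refine sure_seq (sure_dotProg hR (h1.congr (by simp) (by simp) (by simp) (by simp) (by rfl) (by rfl))
      (by simp [h2, hx]) (by simp [Expr.val, hs1, hi])).frame ?_
    rintro s2 ⟨⟨h4, h5⟩, h6, h7⟩
    simp only [dotProg, forLoop, Prog.WritesVar, Prog.WritesArr] at h6 h7
    simp [Expr.val, Expr.size, hs1, h2] at h4 h5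
    rw [exec_ite (e := .var regAcc) trivial]
    have hx2 := h6 regX (by simp)
    have hf2 := h6 regFound (by simp)
    have hi2 := h6 regI (by simp)
    simp [Expr.val, h2, h3, hs1] at hx2 hf2 hi2
    have hctx : Ctx c V A B s2 := h1.congr (by simp [h6]) (by simp [h6]) (by simp [h6])
      (by simp [h6]) (by simp [h7]) (by simp [h7])
    simp only [Expr.val, h4]
    split_ifs with hD
    · refine sure_assign trivial ⟨⟨hctx.congr (by simp) (by simp) (by simp) (by simp) rfl rfl,
        by simp [hx2], ?_⟩, ?_⟩
      · simp [lastZero, hD, Expr.val, hi2]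
      · simp [Expr.size]; omega
    · refine sure_skip ⟨⟨hctx.congr (by simp) (by simp) (by simp) (by simp) rfl rfl,
        by simp [hx2], ?_⟩, ?_⟩
      · simp [lastZero, hD, hf2]
      · simp [Expr.size]; omega
  · rintro s' ⟨⟨-, -, h⟩, ht⟩
    refine ⟨h, ?_⟩
    simp [Expr.size] at ht
    omega

/-! ### The algorithm: shrinking the list of alive vectors -/

/-- The list of the numbers of those vectors for which no orthogonal vector is known yet. -/
def alive (s : State) : List ℕ := (List.range (s.vars regLen)).map (s.arrs arrAlive)

/-- Those entries `x` of `l` for which `D x y ≠ 0`, where `y` is the candidate at the position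
of `x`. -/
def survivors (D : ℕ → ℕ → ℕ) (l : List ℕ) (cand : ℕ → ℕ) : List ℕ :=
  ((List.range l.length).filter fun i => D (l.getD i 0) (cand i) ≠ 0).map (l.getD · 0)

theorem map_range_getD (l : List ℕ) : (List.range l.length).map (l.getD · 0) = l := by
  refine List.ext_getElem (by simp) fun i h1 h2 => ?_
  simp [List.getD_eq_getElem?_getD, List.getElem?_eq_getElem h2]

theorem survivors_sublist (D : ℕ → ℕ → ℕ) (l : List ℕ) (cand : ℕ → ℕ) :
    (survivors D l cand).Sublist l := by
  conv_rhs => rw [← map_range_getD l]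
  exact List.filter_sublist.map _

/-- Removes from the list of alive vectors those that are orthogonal to their candidates; the
number of the candidate for the position in `regI` is the value of `e`. -/
def filterProg (e : Expr) : Prog :=
  .seq (.assign regKept (.const 0)) (.seq
    (forLoop regI regLen
      (.seq (.assign regX (.cell arrAlive (.var regI)))
      (.seq (.assign regCand e)
      (.seq dotProg
        (.ite (.var regAcc)
          (.seq (.store arrAlive (.var regKept) (.var regX))
            (.assign regKept (.bin .add (.var regKept) (.const 1))))
          .skip)))))
    (.assign regLen (.var regKept)))

theorem alive_getD {i : ℕ} (hi : i < s.vars regLen) : (alive s).getD i 0 = s.arrs arrAlive i := by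
  simp [alive, List.getD_eq_getElem?_getD, hi]

/-- If the expression `e` evaluates to `cand i` in iteration `i`, then `filterProg e` keeps exactly
the alive vectors that are not orthogonal to their candidate. -/
theorem sure_filterProg (hR : Room n k c V W F) (hs : Ctx c V A B s) (hlen : s.vars regLen ≤ n)
    (hal : ∀ x ∈ alive s, x < n) (e : Expr) (cand : ℕ → ℕ) (hcand : ∀ i, cand i < n)
    (he : ∀ i < s.vars regLen, ∀ s', s'.vars regI = i → (∀ x, ¬ (filterProg e).WritesVar x → s'.vars x = s.vars x) →
      (∀ a, a ≠ arrAlive → s'.arrs a = s.arrs a) → e.Fits W s' ∧ e.val s' = cand i) :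
    ((filterProg e).exec W F s).Sure fun s' =>
      alive s' = survivors (dotAt A B) (alive s) cand ∧
        s'.time ≤ s.time + 10 + n * (40 * k + e.size + 34) := by
  have hV := hR.V_gt
  have hW := hR.V_lt
  set D := dotAt A B
  set r := s.vars regLen with hr
  set keep : ℕ → Bool := fun i => D (s.arrs arrAlive i) (cand i) ≠ 0 with hkeep
  refine sure_assign_seq (by simp only [Expr.Fits]; omega) ?_
  refine sure_seq (sure_for (τ := 40 * k + e.size + 26) (n := r) (fun i s' =>
    (∀ x, ¬ (filterProg e).WritesVar x → s'.vars x = s.vars x) ∧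
    (∀ a, a ≠ arrAlive → s'.arrs a = s.arrs a) ∧
    s'.vars regLen = r ∧ s'.vars regKept = ((List.range i).filter keep).length ∧
    (∀ j, i ≤ j → s'.arrs arrAlive j = s.arrs arrAlive j) ∧
    (List.range (s'.vars regKept)).map (s'.arrs arrAlive) =
      ((List.range i).filter keep).map (s.arrs arrAlive))
    (by decide) (by simp [Prog.WritesVar, dotProg, forLoop])
    (by simp [Prog.WritesVar, dotProg, forLoop]) (by omega) (by omega) hR.F_ge
    (by simp [hr]) ?_ ?_ ?_) ?_
  · rintro i s' v t ⟨h1, h2, h3, h4, h5, h6⟩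
    refine ⟨fun x hx => ?_, by simpa using h2, by simp [h3], by simp [h4], by simpa using h5,
      by simpa using h6⟩
    rw [← h1 x hx]
    have : x ≠ regI := by rintro rfl; simp [filterProg, forLoop, Prog.WritesVar] at hx
    simp [this]
  · refine ⟨fun x hx => ?_, by simp, by simp [hr], by simp [Expr.val], by simp,
      by simp [Expr.val]⟩
    have : x ≠ regKept := by rintro rfl; simp [filterProg, forLoop, Prog.WritesVar] at hx
    simp [this]
  · rintro i hi s1 hs1 hs2 ⟨h1, h2, h3, h4, h5, h6⟩
    have hxn : s.arrs arrAlive i < n := hal _ (by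
      simp only [alive, List.mem_map, List.mem_range]; exact ⟨i, hi, rfl⟩)
    have hkl : s1.vars regKept ≤ i := by
      rw [h4]; exact (List.length_filter_le _ _).trans (by simp)
    have hctx1 : Ctx c V A B s1 := hs.congr (h1 _ (by simp [filterProg, forLoop, Prog.WritesVar, dotProg]))
      (h1 _ (by simp [filterProg, forLoop, Prog.WritesVar, dotProg]))
      (h1 _ (by simp [filterProg, forLoop, Prog.WritesVar, dotProg]))
      (h1 _ (by simp [filterProg, forLoop, Prog.WritesVar, dotProg])) (h2 _ (by simp)) (h2 _ (by simp))
    refine sure_assign_seq (by simp [Expr.Fits]) ?_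
    obtain ⟨hfit, hval⟩ := he i hi ((s1.setVar regX ((Expr.cell arrAlive (.var regI)).val s1)).tick
      ((Expr.cell arrAlive (.var regI)).size + 1)) (by simp [hs1]) (fun x hx => by
        have : x ≠ regX := by rintro rfl; simp [filterProg, forLoop, Prog.WritesVar] at hx
        simp [this, h1 x hx]) (by simpa using h2)
    refine sure_assign_seq hfit ?_
    rw [hval]
    refine sure_seq (sure_dotProg hR (hctx1.congr (by simp) (by simp) (by simp) (by simp) (by rfl) (by rfl))
      (by simp [Expr.val, hs1, h5, hxn]) (by simp [hcand])).frame ?_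
    rintro s2 ⟨⟨h7, h8⟩, h9, h10⟩
    simp only [dotProg, forLoop, Prog.WritesVar, Prog.WritesArr] at h9 h10
    simp [Expr.val, Expr.size, hs1, h5] at h7 h8
    have hv2 : ∀ x, ¬ (filterProg e).WritesVar x → s2.vars x = s.vars x := by
      intro x hx
      rw [← h1 x hx]
      simp [filterProg, forLoop, Prog.WritesVar, dotProg] at hx
      have hne : x ≠ regCand ∧ x ≠ regX := by omega
      rw [h9 x (by simp; omega)]
      simp [hne]
    have ha2 : s2.arrs = s1.arrs := by funext a; exact h10 a (by simp)
    have hlen2 : s2.vars regLen = r := by rw [h9 _ (by simp)]; simp [h3]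
    have hk2 : s2.vars regKept = s1.vars regKept := by rw [h9 _ (by simp)]; simp
    have hx2 : s2.vars regX = s.arrs arrAlive i := by
      rw [h9 _ (by simp)]; simp [Expr.val, hs1, h5]
    rw [exec_ite (e := .var regAcc) trivial]
    simp only [Expr.val, h7]
    split_ifs with hD
    · have hkf : keep i = false := by simp [hkeep, D, hD]
      refine sure_skip ⟨⟨by simpa using hv2, by simpa [ha2] using h2, by simp [hlen2], ?_, ?_, ?_⟩, ?_⟩
      · simp [hk2, h4, List.range_succ, hkf]
      · intro j hj; simp [ha2, h5 j (by omega)]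
      · simp [ha2, hk2, h6, List.range_succ, hkf]
      · simp [Expr.size]; omega
    · have hkf : keep i = true := by simp [hkeep, D, hD]
      refine sure_store_seq trivial trivial (sure_assign ?_ ⟨⟨?_, ?_, ?_, ?_, ?_, ?_⟩, ?_⟩)
      · simp only [Expr.Fits, Expr.val, BinOp.eval, State.tick_vars, State.setCell_vars, hk2]
        refine ⟨trivial, ?_, ?_⟩ <;> omega
      · intro x hx
        have : x ≠ regKept := by rintro rfl; simp [filterProg, forLoop, Prog.WritesVar] at hx
        simp [this, hv2 x hx]
      · intro a ha
        simp [ha, ha2, h2 a ha]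
      · simp [hlen2]
      · simp [Expr.val, BinOp.eval, hk2, h4, List.range_succ, hkf]
      · intro j hj
        simp only [State.tick_arrs, State.setVar_arrs, State.setCell_arrs, Expr.val]
        rw [if_neg (by simp; omega), ha2]
        exact h5 j (by omega)
      · simp only [State.tick_vars, State.setVar_vars, if_pos, Expr.val, BinOp.eval, State.setCell_vars, hk2,
          State.tick_arrs, State.setVar_arrs, List.range_succ, List.filter_append, List.map_append]
        congr 1
        · rw [← h6]
          refine List.map_congr_left fun j hj => ?_
          have hj := List.mem_range.1 hj
          rw [State.setCell_arrs, if_neg (by simp; omega), State.tick_arrs, ha2]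
        · simp [hkf, State.setCell_arrs, hx2]
      · simp [Expr.size]; omega
  · rintro s1 ⟨⟨h1, h2, h3, h4, h5, h6⟩, ht⟩
    refine sure_assign trivial ⟨?_, ?_⟩
    · have hl : (alive s).length = r := by simp [alive, hr]
      have e1 : alive ((s1.setVar regLen ((Expr.var regKept).val s1)).tick ((Expr.var regKept).size + 1)) =
          (List.range (s1.vars regKept)).map (s1.arrs arrAlive) := by
        simp [alive, Expr.val]
      rw [e1, h6, survivors, hl]
      have e2 : ∀ i ∈ List.range r, (alive s).getD i 0 = s.arrs arrAlive i := fun i hi =>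
        alive_getD (List.mem_range.1 hi)
      have e3 : (List.range r).filter keep =
          (List.range r).filter fun i => D ((alive s).getD i 0) (cand i) ≠ 0 :=
        List.filter_congr fun i hi => by rw [hkeep, e2 i hi]
      rw [e3]
      exact List.map_congr_left fun i hi => (e2 i (List.mem_of_mem_filter hi)).symm
    · simp [Expr.size] at ht ⊢
      have := Nat.mul_le_mul_right (40 * k + e.size + 26 + 8) hlen
      rw [show 40 * k + e.size + 26 + 8 = 40 * k + e.size + 34 by ring] at this ht
      omega

theorem survivors_const (D : ℕ → ℕ → ℕ) (l : List ℕ) (b : ℕ) :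
    (survivors D l fun _ => b) = l.filter fun x => D x b ≠ 0 := by
  conv_rhs => rw [← map_range_getD l]
  rw [List.filter_map]
  rfl

theorem mem_survivors_of_mem {D : ℕ → ℕ → ℕ} {l : List ℕ} {cand : ℕ → ℕ} {x : ℕ} (hx : x ∈ l)
    (hD : ∀ i, D x (cand i) ≠ 0) : x ∈ survivors D l cand := by
  obtain ⟨i, hi, rfl⟩ := List.mem_iff_getElem.1 hx
  refine List.mem_map.2 ⟨i, ?_, by simp [List.getD_eq_getElem?_getD, hi]⟩
  simpa [List.getD_eq_getElem?_getD, hi] using hD i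

/-- The list `l` of alive vectors is sound: it has no repetitions, and it contains all vectors that
hit every vector on the right. -/
structure Sound (A B : Fin n → Fin k → Bool) (l : List ℕ) : Prop where
  nodup : l.Nodup
  lt : ∀ x ∈ l, x < n
  hit : ∀ x < n, (∀ j < n, dotAt A B x j ≠ 0) → x ∈ l

theorem Sound.survivors {l : List ℕ} (h : Sound A B l) {cand : ℕ → ℕ} (hc : ∀ i, cand i < n) :
    Sound A B (survivors (dotAt A B) l cand) where
  nodup := h.nodup.sublist (survivors_sublist _ _ _)
  lt x hx := h.lt x ((survivors_sublist _ _ _).subset hx)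
  hit x hx hD := mem_survivors_of_mem (h.hit x hx hD) fun i => hD _ (hc i)

theorem Sound.length_le {l : List ℕ} (h : Sound A B l) : l.length ≤ n := by
  have := (List.subperm_of_subset h.nodup (l₂ := List.range n) fun x hx =>
    List.mem_range.2 (h.lt x hx)).length_le
  simpa using this

theorem hasHittingVector_iff : HasHittingVector A B ↔ ∃ x < n, ∀ j < n, dotAt A B x j ≠ 0 := by
  constructor
  · rintro ⟨i, hi⟩
    refine ⟨i, i.2, fun j hj => ?_⟩
    have := hi ⟨j, hj⟩
    rwa [dot_eq_sum] at this
  · rintro ⟨x, hx, h⟩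
    refine ⟨⟨x, hx⟩, fun j => ?_⟩
    rw [dot_eq_sum]
    exact h j j.2

theorem length_alive : (alive s).length = s.vars regLen := by simp [alive]

theorem alive_congr {s s' : State} (h1 : s'.vars regLen = s.vars regLen)
    (h2 : s'.arrs arrAlive = s.arrs arrAlive) : alive s' = alive s := by
  simp [alive, h1, h2]

/-! ### The algorithm: heavy vectors -/

/-- The number of a vector on the right that is orthogonal to the vector number `x` on the left,
if there is one. -/
noncomputable def partner (A B : Fin n → Fin k → Bool) (x : ℕ) : ℕ := lastZero (dotAt A B) x n

/-- The partner of `x` is the partner of more than `c` vectors. -/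
def Heavy (c : ℕ) (A B : Fin n → Fin k → Bool) (x : ℕ) : Prop :=
  c < ((Finset.range n).filter fun i => partner A B i = partner A B x).card

theorem partner_lt (hn : 0 < n) (x : ℕ) : partner A B x < n := lastZero_lt _ _ hn

theorem dotAt_partner (h : ¬ HasHittingVector A B) {x : ℕ} (hx : x < n) :
    dotAt A B x (partner A B x) = 0 := by
  refine lastZero_spec _ _ ?_
  rw [hasHittingVector_iff] at h
  push Not at h
  exact h x hx

open Classical in
/-- The number of alive vectors with a partner that is the partner of many vectors; it does not
matter when the answer is yes. -/
noncomputable def heavyPotential (c : ℕ) (A B : Fin n → Fin k → Bool) (l : List ℕ) : ℝ≥0∞ :=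
  if HasHittingVector A B then 0 else (l.countP (Heavy c A B ·) : ℕ)

open Classical in
/-- A heavy vector survives the removal of all vectors orthogonal to the partner of a random vector
with probability at most `1 - c / n`. -/
theorem sum_countP_heavy_le (h : ¬ HasHittingVector A B) (l : List ℕ) (hl : ∀ x ∈ l, x < n) :
    ∑ i ∈ Finset.range n, (l.filter fun x => dotAt A B x (partner A B i) ≠ 0).countP (Heavy c A B ·)
      ≤ (n - c) * l.countP (Heavy c A B ·) := by
  induction l with
  | nil => simp
  | cons x l ih =>
    have ih := ih fun y hy => hl y (List.mem_cons_of_mem _ hy)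
    have hx := dotAt_partner h (hl x List.mem_cons_self)
    by_cases hH : Heavy c A B x
    · have h1 : ∀ i, ((x :: l).filter fun x => dotAt A B x (partner A B i) ≠ 0).countP (Heavy c A B ·) ≤
          (l.filter fun x => dotAt A B x (partner A B i) ≠ 0).countP (Heavy c A B ·) +
            if partner A B i ≠ partner A B x then 1 else 0 := by
        intro i
        by_cases hi : partner A B i = partner A B x
        · simp [hi, hx]
        · rw [List.filter_cons]
          split_ifs
          · simp [hH]
          · simp
      refine (Finset.sum_le_sum fun i _ => h1 i).trans ?_
      rw [Finset.sum_add_distrib, List.countP_cons, ← Finset.card_filter, mul_add]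
      refine add_le_add ih ?_
      have hcard := Finset.card_filter_add_card_filter_not (s := Finset.range n)
        (fun i => partner A B i = partner A B x)
      unfold Heavy at hH
      rw [Finset.card_range] at hcard
      have : c < ((Finset.range n).filter fun i => partner A B i = partner A B x).card := hH
      simp [Heavy, hH]
      omega
    · have h1 : ∀ i, ((x :: l).filter fun x => dotAt A B x (partner A B i) ≠ 0).countP (Heavy c A B ·) =
          (l.filter fun x => dotAt A B x (partner A B i) ≠ 0).countP (Heavy c A B ·) := by
        intro i
        rw [List.filter_cons]
        split_ifs
        · simp [hH]
        · rfl
      rw [Finset.sum_congr rfl fun i _ => h1 i, List.countP_cons]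
      simpa [hH] using ih

/-- Removes all vectors that are orthogonal to the partner of a random vector. -/
def pickProg : Prog :=
  .seq (.rand regX (.var regN)) (.seq searchProg (filterProg (.var regFound)))

/-- Enough random picks to remove all heavy vectors with high probability. -/
def pickLoop : Prog :=
  .seq (.assign regBound (.bin .mul (.bin .add (.bin .div (.var regN) (.var regC)) (.const 1))
    (.bin .add (.var regK) (.const 2))))
  (forLoop regT regBound pickProg)

/-- One random pick multiplies the expected number of heavy vectors by at most `1 - c / n`. -/
theorem bound_pickProg (hR : Room n k c V W F) (hs : Ctx c V A B s) (hal : Sound A B (alive s)) :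
    (pickProg.exec W F s).Bound
      (fun s' => (Ctx c V A B s' ∧ Sound A B (alive s')) ∧ s'.time ≤ s.time + n * (80 * k + 80))
      (fun s' => heavyPotential c A B (alive s'))
      (((n - c : ℕ) : ℝ≥0∞) / n * heavyPotential c A B (alive s)) := by
  classical
  have hV := hR.V_gt
  have hW := hR.V_lt
  have hn := hR.n_pos
  refine bound_seq (Q := fun s1 => ∃ i < n, s1 = (s.setVar regX i).tick 2)
    (g := fun s1 => heavyPotential c A B
      ((alive s).filter fun x => dotAt A B x (partner A B (s1.vars regX)) ≠ 0)) ⟨?_, ?_⟩ ?_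
  · refine sure_rand trivial (by simp only [Expr.val, hs.n]; omega) fun r hr => ?_
    simp only [Expr.val, hs.n] at hr
    exact ⟨r, hr, rfl⟩
  · rw [mean_rand (e := .var regN) trivial (by simp only [Expr.val, hs.n]; omega)]
    simp only [Expr.val, hs.n, State.tick_vars, State.setVar_vars, if_pos]
    unfold heavyPotential
    split_ifs with hh
    · simp
    · rw [← Nat.cast_sum, ENNReal.div_eq_inv_mul, mul_assoc, ← Nat.cast_mul]
      exact mul_le_mul_right (Nat.cast_le.2 (sum_countP_heavy_le hh _ hal.lt)) _
  · rintro _ ⟨i, hi, rfl⟩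
    have hs1 : Ctx c V A B ((s.setVar regX i).tick 2) :=
      hs.congr (by simp) (by simp) (by simp) (by simp) (by rfl) (by rfl)
    have hlen : s.vars regLen ≤ n := length_alive (s := s) ▸ hal.length_le
    refine Outcome.Sure.bound (Q := fun s' => (Ctx c V A B s' ∧ alive s' = (alive s).filter
      fun x => dotAt A B x (partner A B i) ≠ 0) ∧ s'.time ≤ s.time + n * (80 * k + 80)) ?_ ?_ |>.mono
      ?_ (fun _ _ => le_rfl) le_rfl
    · refine sure_seq (sure_searchProg hR hs1 (by simp [hi])).frame ?_
      rintro s2 ⟨⟨h1, h2⟩, h3, h4⟩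
      simp only [searchProg, dotProg, forLoop, Prog.WritesVar, Prog.WritesArr] at h3 h4
      simp at h1 h2
      have hs2 : Ctx c V A B s2 := hs1.congr (h3 _ (by simp)) (h3 _ (by simp)) (h3 _ (by simp))
        (h3 _ (by simp)) (h4 _ (by simp)) (h4 _ (by simp))
      have hlen2 : s2.vars regLen = s.vars regLen := by simp [h3]
      have hal2 : alive s2 = alive s := alive_congr hlen2 (by simp [h4])
      refine (sure_filterProg hR hs2 (by omega) (by rw [hal2]; exact hal.lt) (.var regFound)
        (fun _ => partner A B i) (fun _ => partner_lt hn i) ?_).frame.mono ?_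
      · rintro j - s3 - h5 -
        refine ⟨trivial, ?_⟩
        simp only [Expr.val]
        rw [h5 _ (by simp [filterProg, forLoop, dotProg, Prog.WritesVar])]
        exact h1
      · rintro s3 ⟨⟨h5, h6⟩, h7, h8⟩
        simp only [filterProg, dotProg, forLoop, Prog.WritesVar, Prog.WritesArr] at h7 h8
        refine ⟨⟨hs2.congr (h7 _ (by simp)) (h7 _ (by simp)) (h7 _ (by simp))
          (h7 _ (by simp)) (h8 _ (by simp)) (h8 _ (by simp)), ?_⟩, ?_⟩
        · rw [h5, hal2, survivors_const]
        · simp [Expr.size] at h6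
          nlinarith
    · rintro s' ⟨⟨-, h⟩, -⟩
      simp [h]
    · rintro s' ⟨⟨h1, h2⟩, h3⟩
      refine ⟨⟨h1, ?_⟩, h3⟩
      rw [h2, ← survivors_const]
      exact hal.survivors fun _ => partner_lt hn i

theorem bound_pickLoop (hR : Room n k c V W F) (hs : Ctx c V A B s) (hal : Sound A B (alive s)) :
    (pickLoop.exec W F s).Bound
      (fun s' => (Ctx c V A B s' ∧ Sound A B (alive s')) ∧
        s'.time ≤ s.time + 20 + (n / c + 1) * (k + 2) * (n * (80 * k + 80) + 8))
      (fun s' => heavyPotential c A B (alive s'))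
      ((((n - c : ℕ) : ℝ≥0∞) / n) ^ ((n / c + 1) * (k + 2)) * heavyPotential c A B (alive s)) := by
  have hV := hR.V_gt
  have hW := hR.V_lt
  have hn := hR.n_pos
  have hc := hR.c_pos
  have hdiv : n / c ≤ n := Nat.div_le_self _ _
  have hmul : (n / c + 1) * (k + 2) ≤ (n + 1) * (k + 2) := Nat.mul_le_mul_right _ (by omega)
  have hexp : (n + 1) * (k + 2) = n * k + 2 * n + k + 2 := by ring
  set s1 := (s.setVar regBound ((n / c + 1) * (k + 2))).tick 10
  have hs1 : Ctx c V A B s1 := hs.congr (by simp [s1]) (by simp [s1]) (by simp [s1]) (by simp [s1])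
    (by rfl) (by rfl)
  have hal1 : alive s1 = alive s := alive_congr (by simp [s1]) (by rfl)
  refine bound_seq (Q := fun s' => s' = s1) (g := fun _ => (((n - c : ℕ) : ℝ≥0∞) / n) ^
    ((n / c + 1) * (k + 2)) * heavyPotential c A B (alive s))
    (Outcome.Sure.bound (sure_assign ?_ ?_) fun _ _ => le_rfl) ?_
  · simp only [Expr.Fits, Expr.val, BinOp.eval, hs.n, hs.c, hs.k]
    refine ⟨⟨⟨trivial, trivial, ?_⟩, ?_, ?_⟩, ⟨trivial, ?_, ?_⟩, ?_⟩ <;> omega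
  · simp [Expr.val, BinOp.eval, hs.n, hs.c, hs.k, s1, Expr.size]
  · rintro _ rfl
    rw [← hal1] at hal ⊢
    refine (bound_for (n := (n / c + 1) * (k + 2)) (τ := n * (80 * k + 80))
      (fun _ s' => Ctx c V A B s' ∧ Sound A B (alive s')) (fun s' => heavyPotential c A B (alive s'))
      _ (by decide) (by simp [pickProg, filterProg, searchProg, dotProg, forLoop, Prog.WritesVar])
      (by simp [pickProg, filterProg, searchProg, dotProg, forLoop, Prog.WritesVar]) (by omega)
      (by omega) hR.F_ge (by simp [s1]) ?_ ?_ ⟨hs1, hal⟩ ?_).mono ?_ (fun _ _ => le_rfl) le_rfl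
    · rintro i s' v t ⟨h1, h2⟩
      have e : alive ((s'.setVar regT v).tick t) = alive s' := alive_congr (by simp) rfl
      exact ⟨h1.congr (by simp) (by simp) (by simp) (by simp) (by rfl) (by rfl), by rwa [e]⟩
    · intro s' v t
      have e : alive ((s'.setVar regT v).tick t) = alive s' := alive_congr (by simp) rfl
      simp only [e]
    · rintro i hi s' - - ⟨h1, h2⟩
      exact bound_pickProg hR h1 h2
    · rintro s' ⟨h1, h2⟩
      refine ⟨h1, ?_⟩
      simp [s1] at h2
      omega

/-! ### The algorithm: building the matching instance -/

/-- Writes the gadgets of the alive vectors into the current region. -/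
def buildLeft : Prog :=
  .seq (.assign regSize (.bin .mul (.var regLen) (.var regK)))
  (forLoop regI regSize
    (.seq (.assign regX (.cell arrA (.bin .add (.bin .mul
      (.cell arrAlive (.bin .div (.var regI) (.var regK))) (.var regK))
      (.bin .mod (.var regI) (.var regK)))))
    (.seq (.store arrLeft (.bin .add (.var regBase) (.bin .mul (.const 5) (.var regI))) (.var regX))
    (.store arrLeft (.bin .add (.bin .add (.var regBase) (.bin .mul (.const 5) (.var regI)))
      (.const 1)) (.var regX)))))

/-- Writes the gadgets of the copies of the vectors on the right into the current region. -/
def buildRight : Prog :=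
  .seq (.assign regSize (.bin .mul (.bin .mul (.var regN) (.var regC)) (.var regK)))
  (forLoop regI regSize
    (.seq (.assign regX (.cell arrB (.bin .add (.bin .mul
      (.bin .div (.bin .div (.var regI) (.var regK)) (.var regC)) (.var regK))
      (.bin .mod (.var regI) (.var regK)))))
    (.seq (.assign regCand (.cell arrB (.bin .add (.bin .mul
      (.bin .mod (.bin .div (.var regI) (.var regK)) (.var regC)) (.var regK))
      (.bin .mod (.var regI) (.var regK)))))
    (.seq (.store arrRight (.bin .add (.var regBase) (.bin .mul (.const 5) (.var regI)))
      (.bin .sub (.const 1) (.var regX)))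
    (.seq (.store arrRight (.bin .add (.bin .add (.var regBase) (.bin .mul (.const 5) (.var regI)))
      (.const 2)) (.var regX))
    (.seq (.store arrRight (.bin .add (.bin .add (.var regBase) (.bin .mul (.const 5) (.var regI)))
      (.const 3)) (.var regCand))
    (.store arrRight (.bin .add (.bin .add (.var regBase) (.bin .mul (.const 5) (.var regI)))
      (.const 4)) (.bin .sub (.const 1) (.var regCand)))))))))

theorem sure_buildLeft (hR : Room n k c V W F) (hs : Ctx c V A B s) (hlen : s.vars regLen ≤ n)
    (hal : ∀ x ∈ alive s, x < n) (hbase : s.vars regBase + V ≤ W)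
    (hzero : ∀ x, s.arrs arrLeft (s.vars regBase + x) = 0) (E : ℕ → ℕ)
    (hE : ∀ u < s.vars regLen * k, ∀ t < 5, E (5 * u + t) =
      if t ≤ 1 then encodeVectors A (s.arrs arrAlive (u / k) * k + u % k) else 0)
    (hE0 : ∀ x, 5 * (s.vars regLen * k) ≤ x → E x = 0) :
    (buildLeft.exec W F s).Sure fun s' =>
      (∀ x, s'.arrs arrLeft (s.vars regBase + x) = E x) ∧ s'.time ≤ s.time + 10 + n * k * 40 := by
  have hV := hR.V_gt
  have hW := hR.V_lt
  have hn := hR.n_pos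
  have hk := hR.k_pos
  have hlk := Nat.mul_le_mul_right k hlen
  have h5 : 5 * (n * k) ≤ n * c * (k * 5) := by
    have := Nat.mul_le_mul_left (5 * (n * k)) hR.c_pos
    nlinarith
  set r := s.vars regLen with hr
  set b := s.vars regBase with hb
  refine sure_assign_seq ?_ ?_
  · simp only [Expr.Fits, Expr.val, BinOp.eval, hs.k, ← hr]
    refine ⟨trivial, trivial, ?_⟩; omega
  refine (sure_for (τ := 32) (n := r * k) (fun i s' => Ctx c V A B s' ∧ s'.vars regBase = b ∧
    s'.arrs arrAlive = s.arrs arrAlive ∧ ∀ x, s'.arrs arrLeft (b + x) = if x < 5 * i then E x else 0)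
    (by decide) (by simp [Prog.WritesVar]) (by simp [Prog.WritesVar]) (by omega) (by omega) hR.F_ge
    (by simp [Expr.val, BinOp.eval, hs.k, hr]) ?_ ?_ ?_).mono ?_
  · rintro i s' v t ⟨h1, h2, h3, h4⟩
    exact ⟨h1.congr (by simp) (by simp) (by simp) (by simp) rfl rfl, by simp [h2], h3, h4⟩
  · exact ⟨hs.congr (by simp) (by simp) (by simp) (by simp) rfl rfl, by simp [hb], rfl,
      by simpa using hzero⟩
  · rintro i hi s' hs1 hs2 ⟨h1, h2, h3, h4⟩
    have hik : i / k < r := Nat.div_lt_of_lt_mul (by rwa [mul_comm] at hi)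
    have hx : s.arrs arrAlive (i / k) < n := hal _ (List.mem_map.2 ⟨_, List.mem_range.2 hik, rfl⟩)
    have hmod : i % k < k := Nat.mod_lt _ hk
    have hdk := Nat.div_le_self i k
    have e1 := index_lt hx hmod
    have hbit := encodeVectors_le_one A (s.arrs arrAlive (i / k) * k + i % k)
    set v := encodeVectors A (s.arrs arrAlive (i / k) * k + i % k) with hv
    have e2 := hE i hi
    refine sure_assign_seq ?_ (sure_store_seq ?_ trivial (sure_store ?_ trivial ?_))
    · simp only [Expr.Fits, Expr.val, BinOp.eval, hs1, h1.k, h3]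
      refine ⟨⟨⟨trivial, trivial, ?_⟩, trivial, ?_⟩, ⟨trivial, trivial, ?_⟩, ?_⟩ <;> omega
    · simp [Expr.Fits, Expr.val, BinOp.eval, hs1, h2]
      omega
    · simp [Expr.Fits, Expr.val, BinOp.eval, hs1, h2]
      omega
    · refine ⟨⟨h1.congr (by simp) (by simp) (by simp) (by simp) (by simp) (by simp), by simp [h2],
        by simp [h3], fun x => ?_⟩, by simp [Expr.size]⟩
      simp only [State.tick_arrs, State.tick_vars, State.setCell_arrs, State.setVar_arrs,
        State.setVar_vars, State.setCell_vars, Expr.val, BinOp.eval, hs1, h1.k, h1.A, h2, h3, h4, true_and]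
      simp only [reduceIte, Nat.reduceEqDiff, ← hv]
      by_cases hx1 : x < 5 * i
      · rw [if_neg (by omega), if_neg (by omega), if_pos hx1, if_pos (by omega)]
      by_cases hx2 : x < 5 * (i + 1)
      · rw [if_pos hx2, if_neg hx1]
        obtain ⟨t, rfl⟩ := Nat.exists_eq_add_of_le (not_lt.1 hx1)
        rw [e2 t (by omega)]
        split_ifs <;> omega
      · rw [if_neg (by omega), if_neg (by omega), if_neg hx1, if_neg hx2]
  · rintro s' ⟨⟨-, -, -, h⟩, ht⟩
    refine ⟨fun x => ?_, ?_⟩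
    · rw [h x]
      split_ifs with hx
      · rfl
      · exact (hE0 x (by omega)).symm
    · simp [Expr.size] at ht
      omega

theorem sure_buildRight (hR : Room n k c V W F) (hs : Ctx c V A B s) (hbase : s.vars regBase + V ≤ W)
    (hzero : ∀ x, s.arrs arrRight (s.vars regBase + x) = 0) :
    (buildRight.exec W F s).Sure fun s' =>
      (∀ x, s'.arrs arrRight (s.vars regBase + x) = encodeVectors (rightGadget hR.c_le B) x) ∧
        s'.time ≤ s.time + 20 + n * c * k * 80 := by
  have hV := hR.V_gt
  have hW := hR.V_lt
  have hn := hR.n_pos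
  have hk := hR.k_pos
  have hc := hR.c_pos
  have h5 : n * c * (k * 5) = 5 * (n * c * k) := by ring
  set b := s.vars regBase with hb
  set E := encodeVectors (rightGadget hR.c_le B) with hEdef
  refine sure_assign_seq ?_ ?_
  · simp only [Expr.Fits, Expr.val, BinOp.eval, hs.k, hs.n, hs.c]
    refine ⟨⟨trivial, trivial, ?_⟩, trivial, ?_⟩ <;> omega
  refine (sure_for (τ := 72) (n := n * c * k) (fun i s' => Ctx c V A B s' ∧ s'.vars regBase = b ∧
    ∀ x, s'.arrs arrRight (b + x) = if x < 5 * i then E x else 0)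
    (by decide) (by simp [Prog.WritesVar]) (by simp [Prog.WritesVar]) (by omega) (by omega) hR.F_ge
    (by simp [Expr.val, BinOp.eval, hs.k, hs.n, hs.c]) ?_ ?_ ?_).mono ?_
  · rintro i s' v t ⟨h1, h2, h3⟩
    exact ⟨h1.congr (by simp) (by simp) (by simp) (by simp) rfl rfl, by simp [h2], h3⟩
  · exact ⟨hs.congr (by simp) (by simp) (by simp) (by simp) rfl rfl, by simp [hb],
      by simpa using hzero⟩
  · rintro i hi s' hs1 hs2 ⟨h1, h2, h3⟩
    have hik : i / k < n * c := Nat.div_lt_of_lt_mul (by rwa [mul_comm] at hi)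
    have hx : i / k / c < n := Nat.div_lt_of_lt_mul (by rwa [mul_comm] at hik)
    have hy : i / k % c < n := (Nat.mod_lt _ hc).trans_le hR.c_le
    have hmod : i % k < k := Nat.mod_lt _ hk
    have hdk := Nat.div_le_self i k
    have e1 := index_lt hx hmod
    have e1' := index_lt hy hmod
    have hbit := encodeVectors_le_one B (i / k / c * k + i % k)
    have hbit' := encodeVectors_le_one B (i / k % c * k + i % k)
    have e2 := encodeVectors_rightGadget hR.c_le B i
    set v := encodeVectors B (i / k / c * k + i % k) with hv
    set v' := encodeVectors B (i / k % c * k + i % k) with hv'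
    refine sure_assign_seq ?_ (sure_assign_seq ?_ (sure_store_seq ?_ ?_ (sure_store_seq ?_ ?_
      (sure_store_seq ?_ ?_ (sure_store ?_ ?_ ?_)))))
    · simp only [Expr.Fits, Expr.val, BinOp.eval, hs1, h1.k, h1.c]
      refine ⟨⟨⟨⟨trivial, trivial, ?_⟩, trivial, ?_⟩, trivial, ?_⟩, ⟨trivial, trivial, ?_⟩, ?_⟩ <;> omega
    · simp [Expr.Fits, Expr.val, BinOp.eval, hs1, h1.k, h1.c]
      refine ⟨⟨⟨?_, ?_⟩, ?_⟩, ?_, ?_⟩ <;> omega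
    · simp [Expr.Fits, Expr.val, BinOp.eval, hs1, h2]
      omega
    · simp [Expr.Fits, Expr.val, BinOp.eval, hs1]
      omega
    · simp [Expr.Fits, Expr.val, BinOp.eval, hs1, h2]
      omega
    · trivial
    · simp [Expr.Fits, Expr.val, BinOp.eval, hs1, h2]
      omega
    · trivial
    · simp [Expr.Fits, Expr.val, BinOp.eval, hs1, h2]
      omega
    · simp [Expr.Fits, Expr.val, BinOp.eval, hs1, h2]
      omega
    · refine ⟨⟨h1.congr (by simp) (by simp) (by simp) (by simp) (by simp) (by simp), by simp [h2],
        fun x => ?_⟩, by simp [Expr.size]⟩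
      simp only [State.tick_arrs, State.tick_vars, State.setCell_arrs, State.setVar_arrs,
        State.setVar_vars, State.setCell_vars, Expr.val, BinOp.eval, hs1, h1.k, h1.c, h1.B, h2, h3, true_and]
      simp only [reduceIte, Nat.reduceEqDiff, ← hv, ← hv']
      by_cases hx1 : x < 5 * i
      · rw [if_neg (by omega), if_neg (by omega), if_neg (by omega), if_neg (by omega), if_pos hx1,
          if_pos (by omega)]
      by_cases hx2 : x < 5 * (i + 1)
      · rw [if_pos hx2, if_neg hx1]
        obtain ⟨t, rfl⟩ := Nat.exists_eq_add_of_le (not_lt.1 hx1)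
        rw [hEdef, e2 t hi (by omega)]
        split_ifs <;> omega
      · rw [if_neg (by omega), if_neg (by omega), if_neg (by omega), if_neg (by omega), if_neg hx1,
          if_neg hx2]
  · rintro s' ⟨⟨-, -, h⟩, ht⟩
    refine ⟨fun x => ?_, ?_⟩
    · rw [h x]
      split_ifs with hx
      · rfl
      · refine (encodeVectors_of_le _ ?_).symm
        omega
    · simp [Expr.size] at ht
      omega

/-- The vectors with the numbers in the list `l`. -/
def subfamily (A : Fin n → Fin k → Bool) (l : List ℕ) (hl : ∀ x ∈ l, x < n) :
    Fin l.length → Fin k → Bool :=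
  fun i => A ⟨l[i], hl _ (List.getElem_mem _)⟩

theorem subfamily_injective (hA : Function.Injective A) {l : List ℕ} (hl : ∀ x ∈ l, x < n)
    (hnd : l.Nodup) : Function.Injective (subfamily A l hl) := by
  intro i j h
  have h1 := congrArg Fin.val (hA h)
  exact Fin.ext ((hnd.getElem_inj_iff).1 h1)

theorem encodeVectors_subfamily {l : List ℕ} (hl : ∀ x ∈ l, x < n) {u : ℕ} (hu : u < l.length * k) :
    encodeVectors (subfamily A l hl) u = encodeVectors A (l.getD (u / k) 0 * k + u % k) := by
  set v : Fin (l.length * k) := ⟨u, hu⟩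
  have h1 : u = (v.divNat : ℕ) * k + (v.modNat : ℕ) := by
    simp only [Fin.coe_divNat, Fin.coe_modNat, v]
    rw [mul_comm, Nat.div_add_mod]
  have h2 : u / k < l.length := v.divNat.2
  conv_lhs => rw [h1, encodeVectors_apply]
  have h3 : l.getD (u / k) 0 = l[u / k] := by
    simp [List.getD_eq_getElem?_getD, h2]
  rw [h3]
  exact (encodeVectors_apply A ⟨l[u / k], hl _ (List.getElem_mem _)⟩ v.modNat).symm

theorem dotAt_getD {l : List ℕ} (hl : ∀ x ∈ l, x < n) (i : Fin l.length) (j : Fin n) :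
    dotAt A B (l.getD i 0) j = dot (subfamily A l hl i) (B j) := by
  have h3 : l.getD i 0 = l[i] := by simp [List.getD_eq_getElem?_getD]
  rw [h3]
  exact (dot_eq_sum A B ⟨l[i], hl _ (List.getElem_mem _)⟩ j).symm

/-- Sets up the matching instance in the region after the current one. -/
def prepareProg : Prog :=
  .seq (.assign regBase (.bin .add (.var regBase) (.var regV)))
  (.seq (.store 5 (.var regBase) (.bin .mul (.var regN) (.var regC)))
  (.seq (.store 7 (.var regBase) (.var regLen))
  (.seq (.store 9 (.var regBase) (.bin .mul (.var regK) (.const 5)))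
  (.seq buildLeft buildRight))))

/-- All regions after the current one are empty. -/
def Fresh (V : ℕ) (s : State) : Prop :=
  ∀ a, 4 ≤ a → ∀ x, s.arrs a (s.vars regBase + V + x) = 0

/-- The state after the preparation is a relocated copy of the input state of the matching
program. -/
theorem sure_prepareProg (hR : Room n k c V W F) (hs : Ctx c V A B s) (hal : Sound A B (alive s))
    (hfresh : Fresh V s) (hbase : s.vars regBase + 2 * V ≤ W) :
    (prepareProg.exec W F s).Sure fun s' => Ctx c V A B s' ∧ alive s' = alive s ∧
      s'.vars regLen = s.vars regLen ∧ s'.vars regBase = s.vars regBase + V ∧ Fresh V s' ∧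
      Reloc 4 regTemp V (s.vars regBase + V) s'.time s' (inputState
        (leftGadget (subfamily A (alive s) hal.lt)) (rightGadget hR.c_le B)) s' ∧
      s'.time ≤ s.time + 50 + n * c * k * 120 := by
  have hV := hR.V_gt
  have hW := hR.V_lt
  have hn := hR.n_pos
  have hk := hR.k_pos
  have hc := hR.c_pos
  have hlen : s.vars regLen ≤ n := length_alive (s := s) ▸ hal.length_le
  have hnk : n * k ≤ n * c * k := by nlinarith [Nat.mul_le_mul_left (n * k) hc]
  have hlen5 : s.vars regLen * (k * 5) ≤ n * c * (k * 5) := by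
    refine Nat.mul_le_mul_right _ (hlen.trans ?_)
    nlinarith
  set b := s.vars regBase + V with hb
  refine sure_assign_seq ?_ (sure_store_seq trivial ?_ (sure_store_seq trivial trivial
    (sure_store_seq trivial ?_ ?_)))
  · simp only [Expr.Fits, Expr.val, BinOp.eval, hs.V]
    refine ⟨trivial, trivial, ?_⟩; omega
  · simp [Expr.Fits, Expr.val, BinOp.eval, hs.n, hs.c]; omega
  · simp [Expr.Fits, Expr.val, BinOp.eval, hs.k]; omega
  simp only [Expr.val, BinOp.eval, State.tick_vars, State.setVar_vars, State.setCell_vars, hs.n, hs.c,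
    hs.k, hs.V, reduceIte, Nat.reduceEqDiff, ← hb]
  generalize hs1 : State.tick _ _ = s1
  have hv1 : ∀ x, x ≠ regBase → s1.vars x = s.vars x := fun x hx => by simp [← hs1, hx]
  have hb1 : s1.vars regBase = b := by simp [← hs1]
  have ha1 : ∀ a, a ≠ 5 → a ≠ 7 → a ≠ 9 → s1.arrs a = s.arrs a := fun a h5 h7 h9 => by
    simp [← hs1, h5, h7, h9]
  have ha1' : ∀ a x, s1.arrs a x = if a = 9 ∧ x = b then k * 5 else if a = 7 ∧ x = b then
      s.vars regLen else if a = 5 ∧ x = b then n * c else s.arrs a x := fun a x => by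
    simp [← hs1, State.setCell_arrs]
  have ht1 : s1.time = s.time + 17 := by simp [← hs1, Expr.size]
  clear hs1
  have hctx1 : Ctx c V A B s1 := hs.congr (hv1 _ (by simp)) (hv1 _ (by simp)) (hv1 _ (by simp))
    (hv1 _ (by simp)) (ha1 _ (by simp) (by simp) (by simp)) (ha1 _ (by simp) (by simp) (by simp))
  have hlen1 : s1.vars regLen = s.vars regLen := hv1 _ (by simp)
  have hal1 : alive s1 = alive s := alive_congr hlen1 (ha1 _ (by simp) (by simp) (by simp))
  set A' := subfamily A (alive s) hal.lt with hA'
  have hl : (alive s).length = s.vars regLen := length_alive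
  refine sure_seq (sure_buildLeft hR hctx1 (by omega) (by rw [hal1]; exact hal.lt) (by omega)
    (fun x => ?_) (encodeVectors (leftGadget A')) ?_ ?_).frame ?_
  · rw [ha1 _ (by simp) (by simp) (by simp), hb1, hb, hfresh _ le_rfl]
  · intro u hu t ht
    rw [hlen1] at hu
    rw [encodeVectors_leftGadget _ _ _ ht, encodeVectors_subfamily hal.lt (by rwa [hl]),
      alive_getD (Nat.div_lt_of_lt_mul (by rwa [mul_comm] at hu)),
      ha1 _ (by simp) (by simp) (by simp)]
  · intro x hx
    refine encodeVectors_of_le _ ?_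
    rw [hl, ← hlen1]
    linarith
  rintro s2 ⟨⟨h1, h2⟩, h3, h4⟩
  simp only [buildLeft, forLoop, Prog.WritesVar, Prog.WritesArr] at h3 h4
  rw [hb1] at h1
  have hctx2 : Ctx c V A B s2 := hctx1.congr (h3 _ (by simp)) (h3 _ (by simp)) (h3 _ (by simp))
    (h3 _ (by simp)) (h4 _ (by simp)) (h4 _ (by simp))
  have hb2 : s2.vars regBase = b := by rw [h3 _ (by simp), hb1]
  refine (sure_buildRight hR hctx2 (by omega) (fun x => ?_)).frame.mono ?_
  · rw [h4 _ (by simp), ha1 _ (by simp) (by simp) (by simp), hb2, hb, hfresh _ (by simp)]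
  rintro s3 ⟨⟨h5, h6⟩, h7, h8⟩
  simp only [buildRight, forLoop, Prog.WritesVar, Prog.WritesArr] at h7 h8
  rw [hb2] at h5
  have hlen3 : s3.vars regLen = s.vars regLen := by rw [h7 _ (by simp), h3 _ (by simp), hlen1]
  have hb3 : s3.vars regBase = b := by rw [h7 _ (by simp), hb2]
  -- the arrays that hold neither of the two sets of vectors
  have hother : ∀ a, a ≠ 4 → a ≠ 6 → s3.arrs a = s1.arrs a := fun a h h' => by
    rw [h8 a (by simp [h']), h4 a (by simp [h])]
  have hL : ∀ x, s3.arrs 4 (b + x) = encodeVectors (leftGadget A') x := fun x => by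
    rw [h8 _ (by simp), h1]
  have hRt : ∀ x, s3.arrs 6 (b + x) = encodeVectors (rightGadget hR.c_le B) x := h5
  have hzero : ∀ a, 4 ≤ a → a ≠ 4 → a ≠ 6 → ∀ x, x ≠ 0 → s3.arrs a (b + x) = 0 := by
    intro a ha h4 h6 x hx
    rw [hother a h4 h6, ha1', if_neg (by omega), if_neg (by omega), if_neg (by omega), hb,
      hfresh a ha]
  refine ⟨hctx2.congr (h7 _ (by simp)) (h7 _ (by simp)) (h7 _ (by simp))
    (h7 _ (by simp)) (h8 _ (by simp)) (h8 _ (by simp)), ?_, hlen3, hb3, ?_, ⟨?_, ?_, ?_, ?_, fun _ _ => rfl,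
      fun _ _ => rfl, fun _ _ _ => rfl, by omega⟩, ?_⟩
  · refine alive_congr hlen3 ?_
    rw [hother _ (by simp) (by simp), ha1 _ (by simp) (by simp) (by simp)]
  · intro a ha x
    rw [hb3, add_assoc]
    by_cases h4 : a = 4
    · rw [h4, hL]
      refine encodeVectors_of_le _ ?_
      rw [hl]; omega
    by_cases h6 : a = 6
    · rw [h6, hRt]
      refine encodeVectors_of_le _ ?_
      omega
    exact hzero a ha h4 h6 _ (by omega)
  · intro x
    have := hother (4 + 2 * x + 1) (by omega) (by omega)
    rw [this, ha1']
    have hf := hfresh (4 + 2 * x + 1) (by omega) 0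
    rw [add_zero, ← hb] at hf
    simp only [inputState, hf, hl, and_true]
    split_ifs <;> first | rfl | omega
  · intro a i hi
    simp only [inputState]
    split_ifs with h0 h1
    · subst h0; exact hL i
    · subst h1; exact hRt i
    · rw [hother _ (by omega) (by omega), ha1', if_neg (by omega), if_neg (by omega),
        if_neg (by omega), hb, hfresh _ (by omega)]
  · intro x
    simp only [inputState]
    split_ifs <;> omega
  · intro a i
    simp only [inputState]
    split_ifs
    · have := encodeVectors_le_one (leftGadget A') i; omega
    · have := encodeVectors_le_one (rightGadget hR.c_le B) i; omega
    · change 0 < V; omega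
  · rw [ht1] at h2
    omega

/-! ### The algorithm: matching rounds -/

/-- In the final state `s` of a matching algorithm, array `2` holds a nearly optimal matching. -/
def GoodMatching {m n k : ℕ} (η : ℝ) (A : Fin m → Fin k → Bool) (B : Fin n → Fin k → Bool)
    (s : State) : Prop :=
  ∃ π : Fin m ↪ Fin n, (∀ i : Fin m, s.arrs 2 (i : ℕ) = (π i : ℕ)) ∧
    matchingCost (toPoint ∘ A) (toPoint ∘ B) π ≤ (1 + η) * asymEMD (toPoint ∘ A) (toPoint ∘ B)

open Classical in
/-- The number of alive vectors, provided that none of them is heavy; it does not matter when the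
answer is yes. -/
noncomputable def lightPotential (c : ℕ) (A B : Fin n → Fin k → Bool) (l : List ℕ) : ℝ≥0∞ :=
  if HasHittingVector A B then 0 else if ∀ x ∈ l, ¬ Heavy c A B x then (l.length : ℝ≥0∞) else ⊤

/-- The candidate for the alive vector at position `i` that the matching in the region at `b`
proposes. -/
def proposal (n c b : ℕ) (s : State) (i : ℕ) : ℕ := s.arrs arrMatch (b + i) / c % n

theorem length_survivors (D : ℕ → ℕ → ℕ) (l : List ℕ) (cand : ℕ → ℕ) :
    (survivors D l cand).length =
      (Finset.univ.filter fun i : Fin l.length => D (l.getD i 0) (cand i) ≠ 0).card := by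
  rw [survivors, List.length_map, Finset.card_filter,
    ← Finset.sum_range (fun i => if D (l.getD i 0) (cand i) ≠ 0 then 1 else 0), ← Finset.card_filter]
  rfl

/-- If no alive vector is heavy, then a nearly optimal matching halves the list of alive vectors. -/
theorem two_mul_length_survivors_le (hR : Room n k c V W F) (hh : ¬ HasHittingVector A B)
    {l : List ℕ} (hl : Sound A B l) (hlight : ∀ x ∈ l, ¬ Heavy c A B x) {η : ℝ}
    (hη : 8 * k * η ≤ 1) {t : State}
    (hgood : GoodMatching η (leftGadget (subfamily A l hl.lt)) (rightGadget hR.c_le B) t)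
    (cand : ℕ → ℕ) (hcand : ∀ i < l.length, cand i = t.arrs 2 i / c % n) :
    2 * (survivors (dotAt A B) l cand).length ≤ l.length := by
  obtain ⟨π, hπ, hcost⟩ := hgood
  have hmem : ∀ i : Fin l.length, l[i] ∈ l := fun i => List.getElem_mem _
  obtain ⟨σ, hσ⟩ := exists_embedding_copies (c := c)
    (fun i : Fin l.length => (⟨partner A B l[i], partner_lt hR.n_pos _⟩ : Fin n)) (fun b => by
      by_cases hb : ∃ i : Fin l.length, (⟨partner A B l[i], partner_lt hR.n_pos _⟩ : Fin n) = b
      · obtain ⟨i, rfl⟩ := hb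
        refine le_trans ?_ (not_lt.1 (hlight l[i] (hmem i)))
        refine Finset.card_le_card_of_injOn (fun j => l[j]) ?_ ?_
        · intro j hj
          simp at hj ⊢
          exact ⟨hl.lt _ (hmem j), hj⟩
        · intro j _ j' _ h
          exact Fin.ext ((hl.nodup.getElem_inj_iff).1 h)
      · push Not at hb
        rw [Finset.filter_false_of_mem fun i _ => hb i]
        simp)
  have key := two_mul_card_bad_le hR.c_le hR.k_pos (subfamily A l hl.lt) B σ (fun i => by
    rw [hσ, ← dotAt_getD hl.lt]
    have h3 : l.getD i 0 = l[i] := by simp [List.getD_eq_getElem?_getD]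
    rw [h3]
    exact dotAt_partner hh (hl.lt _ (hmem i))) π hη hcost
  rw [length_survivors]
  convert key using 5 with i
  rw [← dotAt_getD hl.lt, hcand i i.2, hπ i]
  have : (π i : ℕ) / c < n := (π i).divNat.2
  rw [Nat.mod_eq_of_lt this]
  rfl

/-- One round: match the alive vectors to copies of the vectors on the right by the program `P`,
and remove the vectors that got an orthogonal partner. -/
def roundProg (P : Prog) : Prog :=
  .seq prepareProg (.seq (P.reloc 4 regBase regTemp)
    (filterProg (.bin .mod (.bin .div (.cell arrMatch (.bin .add (.var regBase) (.var regI)))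
      (.var regC)) (.var regN))))

open Classical in
/-- A call of the relocated program yields `y` if its output is good and `y + w` otherwise; since it
succeeds with probability at least `2 / 3`, the mean is at most `y + w / 3`. -/
theorem bound_reloc {P : Prog} {a₀ b z base t₀ W₀ F₀ T : ℕ} {r s₀ s' : State} {good : State → Prop}
    (hbz : b ≠ z) (hb : r.vars b = base) (hW : W₀ ≤ V) (hW' : base + V ≤ W) (hF : F₀ ≤ F)
    (h : Reloc a₀ z V base t₀ r s₀ s')
    (hP : (P.exec W₀ F₀ s₀).Succeeds T good)
    {y w : ℝ≥0∞} (hy : y ≠ ⊤) (hw : w ≠ ⊤) :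
    ((P.reloc a₀ b z).exec W F s').Bound
      (fun t' => ∃ t, Reloc a₀ z V base t₀ r t t' ∧ t.time ≤ T)
      (fun t' => if ∃ t, Reloc a₀ z V base t₀ r t t' ∧ good t then y else y + w) (y + w * (1 / 3)) := by
  refine bound_of_mean (by finiteness) ?_
  refine (mean_reloc_le hbz hb hW hW' hF P s₀ s' (fun t => if t.time ≤ T then
    (if good t then y else y + w) else ⊤) _ h ?_).trans ?_
  · intro t t' ht
    by_cases h1 : t.time ≤ T
    · rw [if_pos h1, if_pos ⟨t, ht, h1⟩]
      by_cases h2 : good t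
      · rw [if_pos h2, if_pos ⟨t, ht, h2⟩]
      · rw [if_neg h2]
        split_ifs
        · exact le_self_add
        · exact le_rfl
    · rw [if_neg h1]; exact le_top
  · have hS : (P.exec W₀ F₀ s₀).Sure fun t => t.time ≤ T :=
      (bound_of_mean (g := fun t => if good t then 0 else 1) (x := 1 / 3) (by finiteness)
        (by unfold Outcome.Succeeds at hP; convert hP)).1
    refine (mean_mono_of_sure (g' := fun t => y + w * (if t.time ≤ T then if good t then 0 else 1
      else ⊤)) hS fun t ht => ?_).trans ?_
    · rw [if_pos ht, if_pos ht]
      split_ifs <;> simp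
    · rw [mean_add, mean_const_of_sure hS, mean_const_mul_of_sure hS]
      unfold Outcome.Succeeds at hP
      gcongr

/-- One round multiplies the expected number of alive vectors by at most `2 / 3`: at most half of
them survive a successful call of `P`, and a call fails with probability at most `1 / 3`. -/
theorem bound_roundProg {P : Prog} {W₀ T : ℕ} {η : ℝ} (hR : Room n k c V W F)
    (hA : Function.Injective A) (hW₀ : W₀ ≤ V) (hη : 8 * k * η ≤ 1)
    (hP : ∀ (m : ℕ) (A' : Fin m → Fin (k * 5) → Bool), m ≤ n * c → Function.Injective A' →
      ∃ F₀ ≤ F, (P.exec W₀ F₀ (inputState A' (rightGadget hR.c_le B))).Succeeds T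
        (GoodMatching η A' (rightGadget hR.c_le B)))
    (hs : Ctx c V A B s) (hal : Sound A B (alive s))
    (hfresh : Fresh V s) (hbase : s.vars regBase + 2 * V ≤ W) :
    ((roundProg P).exec W F s).Bound
      (fun s' => (Ctx c V A B s' ∧ Sound A B (alive s') ∧ Fresh V s' ∧
        s'.vars regBase = s.vars regBase + V) ∧
        s'.time ≤ s.time + (4 * T + 60 + n * c * k * 120 + n * (40 * k + 50)))
      (fun s' => lightPotential c A B (alive s')) (2 / 3 * lightPotential c A B (alive s)) := by
  classical
  have hV := hR.V_gt
  have hW := hR.V_lt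
  have hn := hR.n_pos
  have hc := hR.c_pos
  have hlen : s.vars regLen ≤ n := length_alive (s := s) ▸ hal.length_le
  have hcn : n ≤ n * c := by nlinarith
  refine bound_seq (g := fun _ => 2 / 3 * lightPotential c A B (alive s))
    ((sure_prepareProg hR hs hal hfresh hbase).bound fun _ _ => le_rfl) ?_
  rintro s1 ⟨hctx1, hal1, hlen1, hb1, hfresh1, hrel, ht1⟩
  set b := s.vars regBase + V with hb
  set A' := subfamily A (alive s) hal.lt
  have hl : (alive s).length = s.vars regLen := length_alive
  obtain ⟨F₀, hF₀, hP'⟩ := hP _ (leftGadget A') (by omega)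
    (leftGadget_injective (subfamily_injective hA hal.lt hal.nodup))
  have hcall := fun {y w : ℝ≥0∞} => bound_reloc (y := y) (w := w) (a₀ := 4) (by decide) hb1 hW₀
    (show b + V ≤ W by omega) hF₀ hrel hP'
  have hmid : ((P.reloc 4 regBase regTemp).exec W F s1).Bound
      (fun t' => ∃ t, Reloc 4 regTemp V b s1.time s1 t t' ∧ t.time ≤ T)
      (fun t' => lightPotential c A B (survivors (dotAt A B) (alive s) (proposal n c b t')))
      (2 / 3 * lightPotential c A B (alive s)) := by
    have hsure := (hcall (y := 0) (w := 0) (by simp) (by simp)).1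
    -- the potential is `0` if there is a hitting vector, and `∞` if some alive vector is heavy
    by_cases hh : HasHittingVector A B
    · exact hsure.bound fun _ _ => by simp [lightPotential, hh]
    by_cases hlight : ∀ x ∈ alive s, ¬ Heavy c A B x
    · refine (hcall (y := s.vars regLen / 2) (w := s.vars regLen / 2) (by finiteness)
        (by finiteness)).mono (fun _ h => h) ?_ ?_
      · rintro t' -
        have hsub := survivors_sublist (dotAt A B) (alive s) (proposal n c b t')
        rw [lightPotential, if_neg hh, if_pos fun x hx => hlight x (hsub.subset hx)]
        split_ifs with hg
        · obtain ⟨t, ht, hgood⟩ := hg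
          have := two_mul_length_survivors_le hR hh hal hlight hη hgood (proposal n c b t')
            fun i hi => by rw [proposal, show t'.arrs arrMatch (b + i) = _ from ht.cell 2 i (by omega)]
          rw [ENNReal.le_div_iff_mul_le (by simp) (by simp), mul_comm]
          exact_mod_cast hl ▸ this
        · rw [ENNReal.add_halves]
          exact_mod_cast hl ▸ hsub.length_le
      · rw [lightPotential, if_neg hh, if_pos hlight, hl]
        set R : ℝ≥0∞ := (s.vars regLen : ℝ≥0∞)
        have h2 : R = R / 2 * 2 := (ENNReal.div_mul_cancel (by simp) (by simp)).symm
        have h3 : (3 : ℝ≥0∞) * (1 / 3) = 1 := ENNReal.mul_div_cancel (by simp) (by simp)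
        -- half of the vectors survive a correct matching, all of them survive a failure
        calc R / 2 + R / 2 * (1 / 3) = R / 2 * (3 * (1 / 3)) + R / 2 * (1 / 3) := by rw [h3, mul_one]
          _ = 2 * (1 / 3) * (R / 2 * 2) := by ring
          _ = 2 / 3 * R := by rw [← h2]; simp [div_eq_mul_inv]
          _ ≤ _ := le_rfl
    · refine hsure.bound fun _ _ => ?_
      rw [show lightPotential c A B (alive s) = ⊤ by rw [lightPotential, if_neg hh, if_neg hlight]]
      rw [ENNReal.mul_top (by simp)]
      exact le_top
  refine bound_seq hmid ?_
  rintro s2 ⟨t, ht, htT⟩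
  have hctx2 : Ctx c V A B s2 := hctx1.congr (ht.frame_var _ (by simp)) (ht.frame_var _ (by simp))
    (ht.frame_var _ (by simp)) (ht.frame_var _ (by simp)) (ht.frame_arr _ (by simp))
    (ht.frame_arr _ (by simp))
  have hlen2 : s2.vars regLen = s.vars regLen := (ht.frame_var _ (by simp)).trans hlen1
  have hal2 : alive s2 = alive s :=
    (alive_congr (ht.frame_var _ (by simp)) (ht.frame_arr _ (by simp))).trans hal1
  have hb2 : s2.vars regBase = b := (ht.frame_var _ (by simp)).trans hb1
  have hcand : ∀ i, proposal n c b s2 i < n := fun i => Nat.mod_lt _ hn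
  refine Outcome.Sure.bound (Q := fun s' => (Ctx c V A B s' ∧
    alive s' = survivors (dotAt A B) (alive s) (proposal n c b s2) ∧ Fresh V s' ∧
    s'.vars regBase = b) ∧
    s'.time ≤ s.time + (4 * T + 60 + n * c * k * 120 + n * (40 * k + 50))) ?_ ?_ |>.mono
      ?_ (fun _ _ => le_rfl) le_rfl
  · refine (sure_filterProg hR hctx2 (by omega) (by rw [hal2]; exact hal.lt) _
      (proposal n c b s2) hcand ?_).frame.mono ?_
    · intro i hi s3 hs3 h3 h4
      have e0 := h3 regN (by simp [filterProg, forLoop, dotProg, Prog.WritesVar])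
      have e1 := h3 regC (by simp [filterProg, forLoop, dotProg, Prog.WritesVar])
      have e2 := h3 regBase (by simp [filterProg, forLoop, dotProg, Prog.WritesVar])
      rw [hctx2.n] at e0
      rw [hctx2.c] at e1
      rw [hb2] at e2
      have e3 := h4 arrMatch (by decide)
      have e4 : s2.arrs arrMatch (b + i) < V := by
        rw [show s2.arrs arrMatch (b + i) = _ from ht.cell 2 i (by omega)]
        exact ht.cell_lt _ _
      have e5 := Nat.div_le_self (s2.arrs arrMatch (b + i)) c
      have e6 := hcand i
      rw [proposal] at e6
      simp only [Expr.Fits, Expr.val, BinOp.eval, e0, e1, e2, e3, hs3, proposal, and_true]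
      refine ⟨⟨⟨trivial, trivial, ?_⟩, trivial, ?_⟩, trivial, ?_⟩ <;> omega
    · rintro s3 ⟨⟨h1, h2⟩, h3, h4⟩
      simp only [filterProg, dotProg, forLoop, Prog.WritesVar, Prog.WritesArr] at h3 h4
      refine ⟨⟨hctx2.congr (h3 _ (by simp)) (h3 _ (by simp)) (h3 _ (by simp))
          (h3 _ (by simp)) (h4 _ (by simp)) (h4 _ (by simp)), by rw [h1, hal2], ?_, ?_⟩, ?_⟩
      · intro a ha x
        rw [h3 _ (by simp), hb2, h4 _ (by simp; omega), ht.frame_cell _ _ (by omega)]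
        have := hfresh1 a ha x
        rwa [hb1] at this
      · rw [h3 _ (by simp), hb2]
      · have := ht.time
        simp [Expr.size] at h2
        have e : n * (40 * k + 8 + 34) ≤ n * (40 * k + 50) := Nat.mul_le_mul_left _ (by omega)
        omega
  · rintro s' ⟨⟨-, h, -⟩, -⟩
    simp [h]
  · rintro s' ⟨⟨h1, h2, h3, h4⟩, h5⟩
    refine ⟨⟨h1, ?_, h3, h4⟩, h5⟩
    rw [h2]
    exact hal.survivors hcand

theorem Prog.writesVar_reloc {a₀ b z x : ℕ} (P : Prog) (h : (P.reloc a₀ b z).WritesVar x) :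
    x = z := by
  induction P with
  | skip => exact h.elim
  | assign y e => exact h.elim
  | store a i e => exact h.elim
  | rand y e => exact h.elim id fun h => h.elim
  | seq p q hp hq => exact h.elim hp hq
  | ite e p q hp hq => exact h.elim hp hq
  -- the constructor `while`
  | _ =>
    rename_i hp
    exact hp h

/-- Enough rounds to match all vectors with high probability if there are no heavy ones. -/
def roundLoop (P : Prog) : Prog :=
  .seq (.assign regBound (.bin .add (.bin .mul (.const 2) (.var regK)) (.const 5)))
  (forLoop regT regBound (roundProg P))

theorem bound_roundLoop {P : Prog} {W₀ T : ℕ} {η : ℝ} (hR : Room n k c V W F)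
    (hA : Function.Injective A) (hW₀ : W₀ ≤ V) (hη : 8 * k * η ≤ 1)
    (hP : ∀ (m : ℕ) (A' : Fin m → Fin (k * 5) → Bool), m ≤ n * c → Function.Injective A' →
      ∃ F₀ ≤ F, (P.exec W₀ F₀ (inputState A' (rightGadget hR.c_le B))).Succeeds T
        (GoodMatching η A' (rightGadget hR.c_le B)))
    (hs : Ctx c V A B s) (hal : Sound A B (alive s))
    (hfresh : Fresh V s) (hbase : s.vars regBase = 0) :
    ((roundLoop P).exec W F s).Bound
      (fun s' => Sound A B (alive s') ∧
        s'.time ≤ s.time + 20 + (2 * k + 5) * (4 * T + 60 + n * c * k * 120 + n * (40 * k + 50) + 8))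
      (fun s' => lightPotential c A B (alive s'))
      ((2 / 3) ^ (2 * k + 5) * lightPotential c A B (alive s)) := by
  have hV := hR.V_gt
  have hW := hR.V_lt
  have hn := hR.n_pos
  set s1 := (s.setVar regBound (2 * k + 5)).tick 6
  have hs1 : Ctx c V A B s1 := hs.congr (by simp [s1]) (by simp [s1]) (by simp [s1]) (by simp [s1])
    (by rfl) (by rfl)
  have hal1 : alive s1 = alive s := alive_congr (by simp [s1]) (by rfl)
  refine bound_seq (Q := fun s' => s' = s1)
    (g := fun _ => (2 / 3) ^ (2 * k + 5) * lightPotential c A B (alive s))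
    (Outcome.Sure.bound (sure_assign ?_ ?_) fun _ _ => le_rfl) ?_
  · simp only [Expr.Fits, Expr.val, BinOp.eval, hs.k]
    refine ⟨⟨?_, trivial, ?_⟩, ?_, ?_⟩ <;> omega
  · simp [Expr.val, BinOp.eval, hs.k, s1, Expr.size]
  · rintro _ rfl
    rw [← hal1] at hal ⊢
    have hw : ¬ (P.reloc 4 regBase regTemp).WritesVar regT := fun h => by
      simpa using P.writesVar_reloc h
    have hw' : ¬ (P.reloc 4 regBase regTemp).WritesVar regBound := fun h => by
      simpa using P.writesVar_reloc h
    refine (bound_for (n := 2 * k + 5) (τ := 4 * T + 60 + n * c * k * 120 + n * (40 * k + 50))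
      (fun i s' => Ctx c V A B s' ∧ Sound A B (alive s') ∧ Fresh V s' ∧ s'.vars regBase = i * V)
      (fun s' => lightPotential c A B (alive s'))
      _ (by decide)
      (by simp [roundProg, prepareProg, buildLeft, buildRight, filterProg, dotProg, forLoop,
        Prog.WritesVar, hw])
      (by simp [roundProg, prepareProg, buildLeft, buildRight, filterProg, dotProg, forLoop,
        Prog.WritesVar, hw']) (by omega)
      (by omega) hR.F_ge (by simp [s1]) ?_ ?_ ⟨hs1, hal, ?_, by simp [s1, hbase]⟩ ?_).mono ?_
      (fun _ _ => le_rfl) le_rfl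
    · rintro i s' v t ⟨h1, h2, h3, h4⟩
      have e : alive ((s'.setVar regT v).tick t) = alive s' := alive_congr (by simp) rfl
      refine ⟨h1.congr (by simp) (by simp) (by simp) (by simp) (by rfl) (by rfl), by rwa [e], ?_,
        by simp [h4]⟩
      intro a ha x
      simpa using h3 a ha x
    · intro s' v t
      have e : alive ((s'.setVar regT v).tick t) = alive s' := alive_congr (by simp) rfl
      simp only [e]
    · intro a ha x
      simpa [s1] using hfresh a ha x
    · rintro i hi s' - - ⟨h1, h2, h3, h4⟩
      have hle : s'.vars regBase + 2 * V ≤ W := by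
        have h5 := Nat.mul_le_mul_left V (show i + 2 ≤ 2 * k + 8 by omega)
        have h6 := hR.W_ge
        rw [h4]
        linarith
      refine (bound_roundProg hR hA hW₀ hη hP h1 h2 h3 hle).mono ?_ (fun _ _ => le_rfl) le_rfl
      rintro s2 ⟨⟨h5, h6, h7, h8⟩, h9⟩
      exact ⟨⟨h5, h6, h7, by rw [h8, h4]; ring⟩, h9⟩
    · rintro s' ⟨⟨-, h1, -⟩, h2⟩
      refine ⟨h1, ?_⟩
      simp [s1] at h2
      omega

/-! ### The algorithm: initialization -/

/-- The `q`-th power of an expression. -/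
def powExpr (e : Expr) : ℕ → Expr
  | 0 => .const 1
  | q + 1 => .bin .mul (powExpr e q) e

theorem val_powExpr (e : Expr) (q : ℕ) : (powExpr e q).val s = e.val s ^ q := by
  induction q with
  | zero => rfl
  | succ q ih => simp [powExpr, Expr.val, BinOp.eval, ih, pow_succ]

theorem fits_powExpr {e : Expr} {q : ℕ} (he : e.Fits W s) (h0 : 1 ≤ e.val s) (hW : e.val s ^ q < W) :
    (powExpr e q).Fits W s := by
  induction q with
  | zero => simpa [powExpr, Expr.Fits] using hW
  | succ q ih =>
    refine ⟨ih (lt_of_le_of_lt (Nat.pow_le_pow_right h0 (Nat.le_succ q)) hW), he, ?_⟩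
    rw [val_powExpr]
    exact hW

theorem size_powExpr (e : Expr) (q : ℕ) : (powExpr e q).size = q * (e.size + 1) + 1 := by
  induction q with
  | zero => simp [powExpr, Expr.size]
  | succ q ih => simp only [powExpr, Expr.size, ih]; ring

/-- The number of copies of each vector on the right, about `n ^ (1 / q)`. -/
def copies (q n : ℕ) : ℕ := Nat.findGreatest (fun c => c ^ q ≤ n) n

/-- Computes the number of copies and the size of a region, and makes all vectors alive. -/
def setupProg (q w : ℕ) : Prog :=
  .seq (forLoop regI regN
    (.ite (.bin .lt (.var regN) (powExpr (.bin .add (.var regI) (.const 1)) q)) .skip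
      (.assign regC (.bin .add (.var regI) (.const 1)))))
  (.seq (.assign regV (powExpr (.bin .add (.bin .add (.bin .mul (.var regN) (.var regC))
      (.bin .mul (.var regK) (.const 5))) (.const 2)) (w + 2)))
  (.seq (forLoop regI regN (.store arrAlive (.var regI) (.var regI)))
  (.assign regLen (.var regN))))

theorem sure_setupProg (A B : Fin n → Fin k → Bool) {q w t₀ : ℕ}
    (hR : Room n k (copies q n) ((n * copies q n + k * 5 + 2) ^ (w + 2)) W F) (hq : n ^ q < W) :
    ((setupProg q w).exec W F ((inputState A B).tick t₀)).Sure fun s' =>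
      Ctx (copies q n) ((n * copies q n + k * 5 + 2) ^ (w + 2)) A B s' ∧ alive s' = List.range n ∧
        (∀ a, 4 ≤ a → ∀ x, s'.arrs a x = 0) ∧ s'.vars regBase = 0 ∧
        s'.time ≤ t₀ + n * (4 * q + 60) + 10 * w + 100 := by
  have hV := hR.V_gt
  have hW := hR.V_lt
  have hn := hR.n_pos
  have hk := hR.k_pos
  have hin : ((inputState A B).tick t₀).vars regN = n := rfl
  have hik : ((inputState A B).tick t₀).vars regK = k := rfl
  refine sure_seq (sure_for (n := n) (τ := 4 * q + 20) (fun i s' => s'.vars regC =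
    Nat.findGreatest (fun c => c ^ q ≤ n) i) (by decide) (by simp [Prog.WritesVar])
    (by simp [Prog.WritesVar]) (by omega) (by omega) hR.F_ge hin ?_ rfl ?_).frame ?_
  · intro i s' v t h; simpa using h
  · rintro i hi s' h1 h2 h3
    have hpow : (i + 1) ^ q < W := lt_of_le_of_lt (Nat.pow_le_pow_left hi q) hq
    have hfit : (Expr.bin .lt (.var regN) (powExpr (.bin .add (.var regI) (.const 1)) q)).Fits W s' := by
      refine ⟨trivial, fits_powExpr ?_ ?_ ?_, ?_⟩
      · simp only [Expr.Fits, Expr.val, BinOp.eval, h1]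
        refine ⟨trivial, ?_, ?_⟩ <;> omega
      · simp [Expr.val, BinOp.eval]
      · simpa [Expr.val, BinOp.eval, h1] using hpow
      · simp only [BinOp.eval]; split_ifs <;> omega
    rw [exec_ite hfit]
    simp only [Expr.val, val_powExpr, BinOp.eval, h1, h2]
    have hstep := Nat.findGreatest_succ (P := fun c => c ^ q ≤ n) i
    by_cases hc : n < (i + 1) ^ q
    · rw [if_pos hc, if_neg (by simp)]
      rw [if_neg (by omega)] at hstep
      refine sure_skip ⟨?_, ?_⟩
      · rw [hstep]; simpa using h3
      · simp [Expr.size, size_powExpr]; omega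
    · rw [if_neg hc, if_pos rfl]
      rw [if_pos (by omega)] at hstep
      refine sure_assign ?_ ⟨?_, ?_⟩
      · simp only [Expr.Fits, Expr.val, BinOp.eval, State.tick_vars, h1]
        refine ⟨trivial, ?_, ?_⟩ <;> omega
      · rw [hstep]; simp [Expr.val, BinOp.eval, h1]
      · simp [Expr.size, size_powExpr]; omega
  rintro s1 ⟨⟨h1, h2⟩, h3, h4⟩
  simp only [forLoop, Prog.WritesVar, Prog.WritesArr] at h3 h4
  set c := copies q n with hc
  set V := (n * c + k * 5 + 2) ^ (w + 2) with hVdef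
  have h1 : s1.vars regC = c := h1
  have e0 : s1.vars regN = n := (h3 _ (by simp)).trans hin
  have e2 : s1.vars regK = k := (h3 _ (by simp)).trans hik
  have e5 : s1.vars regBase = 0 := (h3 _ (by simp)).trans rfl
  have ha1 : s1.arrs = ((inputState A B).tick t₀).arrs := funext fun a => h4 a (by simp)
  have hbig : n * c + k * 5 + 2 < W := by omega
  refine sure_assign_seq (fits_powExpr ?_ ?_ ?_) ?_
  · simp only [Expr.Fits, Expr.val, BinOp.eval, e0, e2, h1]
    refine ⟨⟨⟨trivial, trivial, ?_⟩, ⟨trivial, ?_, ?_⟩, ?_⟩, ?_, ?_⟩ <;> omega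
  · simp [Expr.val, BinOp.eval]
  · simp only [Expr.val, BinOp.eval, e0, e2, h1, ← hVdef]; omega
  rw [val_powExpr]
  simp only [Expr.val, BinOp.eval, e0, e2, h1, ← hVdef]
  generalize hs2 : State.tick _ _ = s2
  have hctx2 : Ctx c V A B s2 := by
    refine ⟨?_, ?_, ?_, ?_, ?_, ?_⟩
    · simp [← hs2, e0]
    · simp [← hs2, e2]
    · simp [← hs2, h1]
    · simp [← hs2]
    · simp [← hs2, ha1, inputState]
    · simp [← hs2, ha1, inputState]
  have hb2 : s2.vars regBase = 0 := by simp [← hs2, e5]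
  have ha2 : s2.arrs = ((inputState A B).tick t₀).arrs := by simp [← hs2, ha1]
  have ht2 : s2.time ≤ t₀ + n * (4 * q + 28) + 10 * w + 40 := by
    have ht0 : ((inputState A B).tick t₀).time = t₀ := by simp [inputState]
    have e : n * (4 * q + 20 + 8) = n * (4 * q + 28) := by ring
    rw [ht0] at h2
    simp [← hs2, size_powExpr, Expr.size]
    omega
  clear hs2
  refine sure_seq (sure_for (n := n) (τ := 3) (fun i s' => ∀ j < i, s'.arrs arrAlive j = j)
    (by decide) (by simp [Prog.WritesVar])
    (by simp [Prog.WritesVar]) (by omega) (by omega) hR.F_ge hctx2.n ?_ (by simp) ?_).frame ?_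
  · intro i s' v t h; simpa using h
  · rintro i hi s' h5 h6 h7
    refine sure_store trivial trivial ⟨fun j hj => ?_, by simp [Expr.size]⟩
    simp only [State.tick_arrs, State.setCell_arrs, Expr.val, h5, true_and]
    split_ifs with hji
    · exact hji.symm
    · exact h7 j (by omega)
  rintro s3 ⟨⟨h5, h6⟩, h7, h8⟩
  simp only [forLoop, Prog.WritesVar, Prog.WritesArr] at h7 h8
  refine sure_assign trivial ⟨?_, ?_, ?_, ?_, ?_⟩
  · exact hctx2.congr (by simp [h7]) (by simp [h7]) (by simp [h7]) (by simp [h7]) (by simp [h8])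
      (by simp [h8])
  · have : s3.vars regN = n := (h7 _ (by simp)).trans hctx2.n
    simp only [alive, Expr.val, State.tick_vars, State.setVar_vars, State.tick_arrs,
      State.setVar_arrs, if_pos, this]
    conv_rhs => rw [← List.map_id (List.range n)]
    exact List.map_congr_left fun j hj => h5 j (List.mem_range.1 hj)
  · intro a ha x
    simp only [State.tick_arrs, State.setVar_arrs]
    rw [h8 a (by simp; omega), ha2]
    simp only [inputState, State.tick_arrs]
    rw [if_neg (by omega), if_neg (by omega)]
  · simp [h7, hb2]
  · simp [Expr.size]
    have e : n * (4 * q + 60) = n * (4 * q + 28) + n * 32 := by ring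
    omega

theorem copies_pow_le (q n : ℕ) (hq : 1 ≤ q) : copies q n ^ q ≤ n :=
  Nat.findGreatest_spec (P := fun c => c ^ q ≤ n) (Nat.zero_le n)
    (by rw [zero_pow (by omega)]; exact Nat.zero_le n)

theorem lt_copies_succ_pow (q n : ℕ) (hq : 1 ≤ q) : n < (copies q n + 1) ^ q := by
  by_contra h
  have h1 : copies q n + 1 ≤ n :=
    (Nat.le_self_pow (by omega) _).trans (not_lt.1 h)
  have := Nat.le_findGreatest (P := fun c => c ^ q ≤ n) h1 (not_lt.1 h)
  unfold copies at this
  omega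

theorem copies_pos (q : ℕ) {n : ℕ} (hn : 1 ≤ n) : 1 ≤ copies q n :=
  Nat.le_findGreatest hn (by simpa using hn)

theorem copies_le (q n : ℕ) : copies q n ≤ n := Nat.findGreatest_le n

theorem room_of_pos {q w : ℕ} (hn : 1 ≤ n) (hk : 1 ≤ k) (hF : (n + k + 2) ^ (2 * w + q + 8) ≤ F) :
    Room n k (copies q n) ((n * copies q n + k * 5 + 2) ^ (w + 2))
      ((n + k + 2) ^ (2 * w + q + 8)) F := by
  have hc := copies_pos q hn
  have hcn := copies_le q n
  set c := copies q n
  have hN : n ≤ n * c := by nlinarith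
  refine ⟨hn, hk, hc, hcn, ?_, ?_, hF⟩
  · have h1 : (n * c + k * 5 + 2) ^ 2 ≤ (n * c + k * 5 + 2) ^ (w + 2) :=
      Nat.pow_le_pow_right (by omega) (by omega)
    have h2 : n * k ≤ n * c * k := Nat.mul_le_mul_right k hN
    nlinarith
  · have h1 : n * c + k * 5 + 2 ≤ (n + k + 2) ^ 2 := by
      have := Nat.mul_le_mul_left n hcn
      have := Nat.mul_le_mul_right k hn
      nlinarith
    have h2 : 2 * k + 8 ≤ (n + k + 2) ^ 2 := by nlinarith
    calc (n * c + k * 5 + 2) ^ (w + 2) * (2 * k + 8) ≤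
        ((n + k + 2) ^ 2) ^ (w + 2) * (n + k + 2) ^ 2 :=
          Nat.mul_le_mul (Nat.pow_le_pow_left h1 _) h2
      _ = (n + k + 2) ^ (2 * w + 6) := by rw [← pow_mul, ← pow_add]; ring_nf
      _ ≤ _ := Nat.pow_le_pow_right (by omega) (by omega)

theorem le_two_pow_of_injective (hA : Function.Injective A) : n ≤ 2 ^ k := by
  simpa using Fintype.card_le_of_injective A hA

/-! ### Success probabilities -/

theorem heavyPotential_le {l : List ℕ} (hl : l.length ≤ n) : heavyPotential c A B l ≤ n := by
  unfold heavyPotential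
  split_ifs
  · exact zero_le
  · exact_mod_cast List.countP_le_length.trans hl

/-- The phase that removes heavy vectors fails with probability at most `1 / 6`. -/
theorem pick_probability_le (hn : 1 ≤ n) (hc : 1 ≤ c) (hcn : c ≤ n) (hnk : n ≤ 2 ^ k) :
    ((((n - c : ℕ) : ℝ≥0∞) / n) ^ ((n / c + 1) * (k + 2))) * n ≤ 1 / 6 := by
  have hn0 : (0 : ℝ) < n := by exact_mod_cast hn
  have h1 : (((n - c : ℕ) : ℝ≥0∞) / n) = ENNReal.ofReal (1 - c / n) := by
    rw [show (1 : ℝ) - c / n = ((n - c : ℕ) : ℝ) / n by rw [Nat.cast_sub hcn]; field_simp,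
      ENNReal.ofReal_div_of_pos hn0, ENNReal.ofReal_natCast, ENNReal.ofReal_natCast]
  have hx0 : (0 : ℝ) ≤ 1 - c / n := by
    rw [sub_nonneg, div_le_one hn0]; exact_mod_cast hcn
  have h6 : (1 / 6 : ℝ≥0∞) = ENNReal.ofReal (1 / 6) := by
    rw [ENNReal.ofReal_div_of_pos (by norm_num)]; simp
  rw [h1, ← ENNReal.ofReal_pow hx0, ← ENNReal.ofReal_natCast, ← ENNReal.ofReal_mul (by positivity), h6]
  refine ENNReal.ofReal_le_ofReal ?_
  set H := (n / c + 1) * (k + 2)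
  -- `c * H / n ≥ k + 2`, so the product is at most `2 ^ k * exp (-(k + 2))`
  have hH : (n : ℝ) * (k + 2) ≤ c * H := by
    have h2 : n ≤ c * (n / c + 1) := by
      have := Nat.div_add_mod n c
      have := Nat.mod_lt n hc
      rw [mul_add]; omega
    have h3 : n * (k + 2) ≤ c * H := by
      rw [← mul_assoc]; exact Nat.mul_le_mul_right _ h2
    exact_mod_cast h3
  have h2 : (1 - c / n : ℝ) ^ H ≤ Real.exp (-(k + 2)) := by
    calc (1 - c / n : ℝ) ^ H ≤ Real.exp (-(c / n)) ^ H :=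
          pow_le_pow_left₀ hx0 (by have := Real.add_one_le_exp (-(c / n : ℝ)); linarith) _
      _ = Real.exp (H * -(c / n)) := (Real.exp_nat_mul _ _).symm
      _ ≤ _ := by
        refine Real.exp_le_exp.2 ?_
        have : (k + 2 : ℝ) ≤ c * H / n := by rw [le_div_iff₀ hn0]; linarith
        calc (H * -(c / n) : ℝ) = -(c * H / n) := by ring
          _ ≤ _ := by linarith
  have h3 : (n : ℝ) ≤ Real.exp k := by
    calc (n : ℝ) ≤ 2 ^ k := by exact_mod_cast hnk
      _ ≤ Real.exp 1 ^ k := pow_le_pow_left₀ (by norm_num)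
        (by have := Real.exp_one_gt_d9; linarith) _
      _ = _ := by rw [← Real.exp_nat_mul]; simp
  calc (1 - c / n : ℝ) ^ H * n ≤ Real.exp (-(k + 2)) * Real.exp k := by gcongr
    _ = (Real.exp 1 ^ 2)⁻¹ := by
      rw [← Real.exp_add, ← Real.exp_nat_mul, ← Real.exp_neg]; congr 1; push_cast; ring
    _ ≤ 1 / 6 := by
      rw [one_div]
      refine inv_anti₀ (by norm_num) ?_
      have := Real.exp_one_gt_d9
      nlinarith

/-- If there are no heavy vectors, the expected number of vectors left after all rounds is at most
`1 / 6`. -/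
theorem round_probability_le (hnk : n ≤ 2 ^ k) :
    ((2 / 3 : ℝ≥0∞) ^ (2 * k + 5)) * n ≤ 1 / 6 := by
  have h1 : (2 / 3 : ℝ≥0∞) = ENNReal.ofReal (2 / 3) := by
    rw [ENNReal.ofReal_div_of_pos (by norm_num)]; simp
  have h6 : (1 / 6 : ℝ≥0∞) = ENNReal.ofReal (1 / 6) := by
    rw [ENNReal.ofReal_div_of_pos (by norm_num)]; simp
  rw [h1, ← ENNReal.ofReal_pow (by norm_num), ← ENNReal.ofReal_natCast,
    ← ENNReal.ofReal_mul (by positivity), h6]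
  refine ENNReal.ofReal_le_ofReal ?_
  have h3 : (n : ℝ) ≤ 2 ^ k := by exact_mod_cast hnk
  calc (2 / 3 : ℝ) ^ (2 * k + 5) * n ≤ (2 / 3 : ℝ) ^ (2 * k + 5) * 2 ^ k := by gcongr
    _ = ((2 / 3) ^ 2 * 2) ^ k * (2 / 3) ^ 5 := by rw [pow_add, pow_mul, mul_pow]; ring
    _ ≤ 1 * (2 / 3) ^ 5 := by
      gcongr
      exact pow_le_one₀ (by norm_num) (by norm_num)
    _ ≤ 1 / 6 := by norm_num

/-! ### The algorithm for the hitting set problem -/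

/-- Decides the hitting set problem with the help of the matching program `P`. -/
def hittingProg (q w : ℕ) (P : Prog) : Prog :=
  .ite (.bin .mul (.var regN) (.var regK))
    (.seq (setupProg q w) (.seq pickLoop (.seq (roundLoop P) (.assign regN (.var regLen)))))
    (.assign regN (.const 0))

/-- The running time of `hittingProg` on a machine on which the matching program needs `T`
steps. -/
def hittingTime (q w T n k : ℕ) : ℕ :=
  n * (4 * q + 60) + 10 * w + 160 +
    (n / copies q n + 1) * (k + 2) * (n * (80 * k + 80) + 8) +
    (2 * k + 5) * (4 * T + 60 + n * copies q n * k * 120 + n * (40 * k + 50) + 8)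

open Classical in
/-- The last phase errs with probability at most `1 / 6` if no heavy vectors are left. -/
theorem bound_finish {P : Prog} {W₀ T : ℕ} {η : ℝ} (hR : Room n k c V W F)
    (hA : Function.Injective A) (hW₀ : W₀ ≤ V) (hη : 8 * k * η ≤ 1)
    (hP : ∀ (m : ℕ) (A' : Fin m → Fin (k * 5) → Bool), m ≤ n * c → Function.Injective A' →
      ∃ F₀ ≤ F, (P.exec W₀ F₀ (inputState A' (rightGadget hR.c_le B))).Succeeds T
        (GoodMatching η A' (rightGadget hR.c_le B)))
    (hs : Ctx c V A B s) (hal : Sound A B (alive s))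
    (hfresh : Fresh V s) (hbase : s.vars regBase = 0) :
    (((roundLoop P).seq (.assign regN (.var regLen))).exec W F s).Bound
      (fun s' => s'.time ≤ s.time + 22 +
        (2 * k + 5) * (4 * T + 60 + n * c * k * 120 + n * (40 * k + 50) + 8))
      (fun s' => if s'.vars regN ≠ 0 ↔ HasHittingVector A B then 0 else 1)
      (heavyPotential c A B (alive s) + 1 / 6) := by
  have hloop := bound_roundLoop hR hA hW₀ hη hP hs hal hfresh hbase
  -- the error is at most the light potential, and at most `1`
  have hlast : ∀ g : State → ℝ≥0∞, (∀ s, Sound A B (alive s) →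
      (if s.vars regLen ≠ 0 ↔ HasHittingVector A B then 0 else 1) ≤ g s) → ∀ x,
      ((roundLoop P).exec W F s).mean g ≤ x →
      (((roundLoop P).seq (.assign regN (.var regLen))).exec W F s).Bound
      (fun s' => s'.time ≤ s.time + 22 +
        (2 * k + 5) * (4 * T + 60 + n * c * k * 120 + n * (40 * k + 50) + 8))
      (fun s' => if s'.vars regN ≠ 0 ↔ HasHittingVector A B then 0 else 1) x := by
    intro g hg x hx
    refine bound_seq (Q := _) (g := g) ⟨hloop.1, hx⟩ ?_
    rintro s1 ⟨h1, h2⟩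
    refine Outcome.Sure.bound (Q := fun s' => s' = (s1.setVar regN (s1.vars regLen)).tick 2)
      (sure_assign (e := .var regLen) trivial rfl) ?_ |>.mono ?_ (fun _ _ => le_rfl) le_rfl
    · rintro _ rfl
      simpa using hg s1 h1
    · rintro _ rfl
      simp
      omega
  by_cases hh : HasHittingVector A B
  · refine hlast (fun _ => 0) (fun s hs => ?_) _ ?_
    · have : s.vars regLen ≠ 0 := by
        obtain ⟨x, hx, h⟩ := hasHittingVector_iff.1 hh
        have := List.length_pos_of_mem (hs.hit x hx h)
        rw [length_alive] at this
        omega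
      simp [this, hh]
    · rw [mean_const_of_sure hloop.1]; exact zero_le
  by_cases hlight : ∀ x ∈ alive s, ¬ Heavy c A B x
  · refine hlast (fun s' => lightPotential c A B (alive s')) (fun s hs => ?_) _ (hloop.2.trans ?_)
    · by_cases h0 : s.vars regLen = 0
      · simp [h0, hh]
      · rw [lightPotential, if_neg hh, if_neg (by simp [h0, hh])]
        split_ifs
        · rw [length_alive]; exact_mod_cast Nat.one_le_iff_ne_zero.2 h0
        · exact le_top
    · rw [lightPotential, if_neg hh, if_pos hlight]
      refine le_trans ?_ le_add_self
      refine le_trans ?_ (round_probability_le (le_two_pow_of_injective hA))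
      gcongr
      exact hal.length_le
  · refine hlast (fun _ => 1) (fun s hs => ?_) _ ?_
    · split_ifs <;> simp
    · rw [mean_const_of_sure hloop.1]
      refine le_trans ?_ le_self_add
      rw [heavyPotential, if_neg hh]
      push Not at hlight
      have : 0 < (alive s).countP (Heavy c A B ·) := by
        rw [List.countP_pos_iff]
        obtain ⟨x, hx, h⟩ := hlight
        exact ⟨x, hx, by simpa using h⟩
      exact_mod_cast this

/-- The reduction is correct: heavy vectors remain with probability at most `1 / 6`, and so do alive
vectors in their absence.  An instance with a hitting vector is always answered correctly. -/
theorem computes_hittingProg {P : Prog} {q w T : ℕ} {η : ℝ}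
    (hA : Function.Injective A) (hB : Function.Injective B) (hη : 8 * k * η ≤ 1)
    (hP : ∀ (m : ℕ) (A' : Fin m → Fin (k * 5) → Bool) (B' : Fin (n * copies q n) → Fin (k * 5) → Bool),
      m ≤ n * copies q n → Function.Injective A' → Function.Injective B' →
      P.Computes ((n * copies q n + k * 5 + 2) ^ w) T (inputState A' B') (GoodMatching η A' B')) :
    (hittingProg q w P).Computes ((n + k + 2) ^ (2 * w + q + 8)) (hittingTime q w T n k)
      (inputState A B) fun s => s.vars regN ≠ 0 ↔ HasHittingVector A B := by
  classical
  have hin : (inputState A B).vars regN = n := rfl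
  have hik : (inputState A B).vars regK = k := rfl
  have hit : (inputState A B).time = 0 := rfl
  by_cases hnk : n * k = 0
  · -- without vectors or without coordinates there is no hitting vector
    have hno : ¬ HasHittingVector A B := by
      rintro ⟨i, hi⟩
      rcases Nat.mul_eq_zero.1 hnk with rfl | rfl
      · exact i.elim0
      · exact hi i (by simp [dot])
    have hW : 2 * w + q + 8 < (n + k + 2) ^ (2 * w + q + 8) := Nat.lt_pow_self (by omega)
    refine Prog.computes_of_bound (F := 0) ?_
    rw [hittingProg, exec_ite (by simp only [Expr.Fits, Expr.val, BinOp.eval, hin, hik]; simp [hnk]),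
      if_pos (by simp [Expr.val, BinOp.eval, hin, hik, hnk])]
    refine Outcome.Sure.bound (Q := fun s' => s' = ((((inputState A B).tick 4).setVar regN 0).tick 2))
      (sure_assign (by simp only [Expr.Fits]; omega) (by simp [Expr.val, Expr.size])) ?_ |>.mono ?_
      (fun _ _ => le_rfl) le_rfl
    · rintro _ rfl; simp [hno]
    · rintro _ rfl; simp [hit, hittingTime]; omega
  have hn : 1 ≤ n := Nat.one_le_iff_ne_zero.2 fun h => hnk (by simp [h])
  have hk : 1 ≤ k := Nat.one_le_iff_ne_zero.2 fun h => hnk (by simp [h])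
  set c := copies q n with hc
  -- fuel for all matching instances together
  have hcomp := fun (m : ℕ) (A' : Fin m → Fin (k * 5) → Bool) (hm : m ≤ n * c)
    (hA' : Function.Injective A') => (hP m A' (rightGadget (copies_le q n) B) hm hA'
      (rightGadget_injective _ hB)).succeeds
  have hfuel : ∃ F₁, ∀ (m : ℕ) (A' : Fin m → Fin (k * 5) → Bool), m ≤ n * c →
      Function.Injective A' → ∃ F₀ ≤ F₁, (P.exec ((n * c + k * 5 + 2) ^ w) F₀
        (inputState A' (rightGadget (copies_le q n) B))).Succeeds T
          (GoodMatching η A' (rightGadget (copies_le q n) B)) := by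
    choose f hf using hcomp
    let ι := Σ m : Fin (n * c + 1), Fin m → Fin (k * 5) → Bool
    let φ : ι → ℕ := fun x => if h : Function.Injective x.2 then
      f x.1 x.2 (Nat.lt_succ_iff.1 x.1.2) h else 0
    refine ⟨Finset.univ.sup φ, fun m A' hm hA' => ⟨_, ?_, hf m A' hm hA'⟩⟩
    have := Finset.le_sup (f := φ) (Finset.mem_univ (⟨⟨m, by omega⟩, A'⟩ : ι))
    simpa [φ, hA'] using this
  obtain ⟨F₁, hF₁⟩ := hfuel
  set W := (n + k + 2) ^ (2 * w + q + 8)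
  set V := (n * c + k * 5 + 2) ^ (w + 2)
  have hR : Room n k c V W (W + F₁) := room_of_pos hn hk (Nat.le_add_right _ _)
  have hV := hR.V_gt
  have hW := hR.V_lt
  have hnq : n ^ q < W := lt_of_le_of_lt (Nat.pow_le_pow_left (by omega : n ≤ n + k + 2) q)
    (Nat.pow_lt_pow_right (by omega) (by omega))
  refine Prog.computes_of_bound (F := W + F₁) ?_
  rw [hittingProg, exec_ite (by
      simp only [Expr.Fits, Expr.val, BinOp.eval, hin, hik]; refine ⟨trivial, trivial, ?_⟩; omega),
    if_neg (by simpa [Expr.val, BinOp.eval, hin, hik] using hnk)]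
  refine bound_seq (g := fun _ => 1 / 3) ((sure_setupProg A B hR hnq).bound fun _ _ => le_rfl) ?_
  rintro s1 ⟨hs1, hal1, hzero, hb, ht⟩
  have hsound : Sound A B (alive s1) := by
    rw [hal1]
    exact ⟨List.nodup_range, fun x => List.mem_range.1, fun x hx _ => List.mem_range.2 hx⟩
  have hpick := (bound_pickLoop hR hs1 hsound).frame
  refine bound_seq (Q := _) (g := fun s' => heavyPotential c A B (alive s') + 1 / 6)
    ⟨hpick.1, ?_⟩ ?_
  · rw [mean_add, mean_const_of_sure hpick.1]
    have h1 : heavyPotential c A B (alive s1) ≤ n := heavyPotential_le hsound.length_le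
    have h2 := pick_probability_le hn hR.c_pos hR.c_le (le_two_pow_of_injective hA)
    have h3 : (1 / 6 : ℝ≥0∞) + 1 / 6 = 1 / 3 := by
      rw [← ENNReal.add_div, show (1 : ℝ≥0∞) + 1 = 2 * 1 by norm_num,
        show (6 : ℝ≥0∞) = 2 * 3 by norm_num, ENNReal.mul_div_mul_left _ _ (by simp) (by simp)]
    rw [← h3]
    refine add_le_add_left (hpick.2.trans (le_trans ?_ h2)) _
    gcongr
  · rintro s2 ⟨⟨⟨h1, h2⟩, h3⟩, h4, h5⟩
    simp only [pickLoop, pickProg, filterProg, searchProg, dotProg, forLoop, Prog.WritesVar,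
      Prog.WritesArr] at h4 h5
    refine (bound_finish (T := T) (W₀ := (n * c + k * 5 + 2) ^ w) hR hA
      (Nat.pow_le_pow_right (by omega) (by omega)) hη
      (fun m A' hm hA' => ?_) h1 h2 ?_ ?_).mono ?_ (fun _ _ => le_of_eq (by congr)) le_rfl
    · obtain ⟨F₀, hF₀, h⟩ := hF₁ m A' hm hA'
      exact ⟨F₀, by omega, h⟩
    · intro a ha x
      rw [h5 _ (by simp; omega)]
      exact hzero a ha _
    · rw [h4 _ (by simp), hb]
    · intro s3 h6
      simp only [Expr.size] at ht
      unfold hittingTime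
      rw [← hc]
      omega

end WordRAM

open WordRAM

/-! ### Asymptotics -/

theorem IsBigOPow.mono {T : ℕ → ℕ} {e e' : ℝ} (h : IsBigOPow T e) (he : e ≤ e') :
    IsBigOPow T e' := by
  refine h.trans (IsBigO.of_bound 1 ?_)
  filter_upwards [eventually_ge_atTop 1] with n hn
  have hn' : (1 : ℝ) ≤ n := by exact_mod_cast hn
  rw [one_mul, Real.norm_of_nonneg (by positivity), Real.norm_of_nonneg (by positivity)]
  exact Real.rpow_le_rpow_of_exponent_le hn' he

theorem tendsto_log_natCast : Tendsto (fun n : ℕ => Real.log n) atTop atTop :=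
  Real.tendsto_log_atTop.comp tendsto_natCast_atTop_atTop

theorem IsOmegaLog.min {f g : ℕ → ℕ} (hf : IsOmegaLog fun n => (f n : ℝ))
    (hg : IsOmegaLog fun n => (g n : ℝ)) : IsOmegaLog fun n => ((min (f n) (g n) : ℕ) : ℝ) := by
  refine isLittleO_iff.2 fun c hc => ?_
  filter_upwards [isLittleO_iff.1 hf hc, isLittleO_iff.1 hg hc] with n h1 h2
  rcases min_choice (f n) (g n) with h | h <;> rw [h] <;> assumption

theorem isOmegaLog_log_sq : IsOmegaLog fun n => ((Nat.log 2 n ^ 2 : ℕ) : ℝ) := by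
  refine isLittleO_iff.2 fun c hc => ?_
  filter_upwards [tendsto_log_natCast.eventually_ge_atTop 2,
    tendsto_log_natCast.eventually_ge_atTop (4 / c), eventually_ge_atTop 1] with n h1 h2 hn
  have h3 : Real.log n ≤ Nat.log 2 n + 1 := by
    have h4 : (n : ℝ) ≤ 2 ^ (Nat.log 2 n + 1) := by
      exact_mod_cast (Nat.lt_pow_succ_log_self (by norm_num) n).le
    have h5 := Real.log_le_log (by positivity) h4
    rw [Real.log_pow] at h5
    have := Real.log_two_lt_d9
    push_cast at h5
    nlinarith [Nat.cast_nonneg (α := ℝ) (Nat.log 2 n)]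
  rw [Real.norm_of_nonneg (by linarith), Real.norm_of_nonneg (by positivity)]
  rw [div_le_iff₀ hc] at h2
  push_cast
  have h6 : Real.log n / 2 ≤ Nat.log 2 n := by linarith
  have h7 : (Real.log n / 2) ^ 2 ≤ (Nat.log 2 n : ℝ) ^ 2 := pow_le_pow_left₀ (by linarith) h6 2
  nlinarith

/-- Composition with a function `N n ≥ n`, division by a constant and rounding preserve
`ω (log n)`. -/
theorem IsOmegaLog.floor_comp {f : ℕ → ℝ} (hf : IsOmegaLog f) (hpos : ∀ᶠ n in atTop, 0 ≤ f n)
    {N : ℕ → ℕ} (hN : ∀ n, n ≤ N n) {a : ℝ} (ha : 0 < a) :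
    IsOmegaLog fun n => ((⌊f (N n) / a⌋₊ : ℕ) : ℝ) := by
  have hNt : Tendsto N atTop atTop := tendsto_atTop_mono hN tendsto_id
  refine isLittleO_iff.2 fun c hc => ?_
  filter_upwards [hNt.eventually (isLittleO_iff.1 hf (show 0 < c / (2 * a) by positivity)),
    hNt.eventually hpos, tendsto_log_natCast.eventually_ge_atTop c, eventually_ge_atTop 1]
    with n h1 h2 h3 hn
  have hn' : (0 : ℝ) < n := by exact_mod_cast hn
  have h4 : Real.log n ≤ Real.log (N n) := Real.log_le_log hn' (by exact_mod_cast hN n)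
  rw [Real.norm_of_nonneg (by linarith), Real.norm_of_nonneg h2] at h1
  rw [Real.norm_of_nonneg (by linarith), Real.norm_of_nonneg (by positivity)]
  have h5 := (Nat.lt_floor_add_one (f (N n) / a)).le
  have h6 : c * (f (N n) / a) = 2 * (c / (2 * a) * f (N n)) := by field_simp
  nlinarith [mul_le_mul_of_nonneg_left h5 hc.le]

theorem hittingTime_mono {q w T n k k' : ℕ} (h : k ≤ k') :
    hittingTime q w T n k ≤ hittingTime q w T n k' := by
  unfold hittingTime
  gcongr

theorem hittingTime_le {q w T n k : ℕ} (hn : 1 ≤ n) :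
    hittingTime q w T n k ≤ (4 * q + 10 * w + 2000) * ((k + 1) ^ 2 *
      (n * (n / copies q n) + n + n * copies q n + T)) := by
  have hc := copies_pos q hn
  unfold hittingTime
  set c := copies q n
  set e := n / c
  set K := k + 1 with hK
  set X := n * e + n + n * c + T with hX
  have hK1 : 1 ≤ K := by omega
  have hN : n ≤ n * c := by nlinarith
  have hXK : X ≤ K ^ 2 * X := by nlinarith [Nat.mul_le_mul hK1 hK1, Nat.zero_le X]
  have hXK' : K * X ≤ K ^ 2 * X := by rw [pow_two]; gcongr; nlinarith
  have h1 : n * (4 * q + 60) + 10 * w + 160 ≤ (4 * q + 10 * w + 220) * (K ^ 2 * X) := by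
    have : n * (4 * q + 60) + 10 * w + 160 ≤ (4 * q + 10 * w + 220) * X := by
      have hnX : n ≤ X := by omega
      nlinarith
    exact this.trans (Nat.mul_le_mul_left _ hXK)
  have h2 : (e + 1) * (k + 2) * (n * (80 * k + 80) + 8) ≤ 176 * (K ^ 2 * X) := by
    calc (e + 1) * (k + 2) * (n * (80 * k + 80) + 8) ≤ (e + 1) * (2 * K) * (88 * (n * K)) := by
          refine Nat.mul_le_mul (Nat.mul_le_mul_left _ (by omega)) ?_
          nlinarith
      _ = 176 * (K ^ 2 * (n * e + n)) := by ring
      _ ≤ _ := by gcongr; omega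
  have h3 : (2 * k + 5) * (4 * T + 60 + n * c * k * 120 + n * (40 * k + 50) + 8) ≤
      1600 * (K ^ 2 * X) := by
    have h4 : 4 * T + 60 + n * c * k * 120 + n * (40 * k + 50) + 8 ≤ 300 * (K * X) := by
      have e1 : n * c * k ≤ K * X := by
        rw [mul_comm K]; exact Nat.mul_le_mul (by omega) (by omega)
      have e2 : n * k ≤ K * X := by
        rw [mul_comm K]; exact Nat.mul_le_mul (by omega) (by omega)
      have e3 : X ≤ K * X := by nlinarith
      have e4 : T + n ≤ X := by omega
      nlinarith
    calc _ ≤ 5 * K * (300 * (K * X)) := Nat.mul_le_mul (by omega) h4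
      _ = 1500 * (K ^ 2 * X) := by ring
      _ ≤ _ := by gcongr; omega
  calc _ ≤ (4 * q + 10 * w + 220) * (K ^ 2 * X) + 176 * (K ^ 2 * X) + 1600 * (K ^ 2 * X) := by
        gcongr
    _ ≤ _ := by nlinarith [Nat.zero_le (K ^ 2 * X)]

theorem copies_le_rpow {q n : ℕ} (hq : 1 ≤ q) : (copies q n : ℝ) ≤ (n : ℝ) ^ (1 / q : ℝ) := by
  have h1 : ((copies q n : ℝ)) ^ q ≤ n := by exact_mod_cast copies_pow_le q n hq
  rw [one_div]
  calc (copies q n : ℝ) = ((copies q n : ℝ) ^ q) ^ (q : ℝ)⁻¹ :=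
        (Real.pow_rpow_inv_natCast (by positivity) (by omega)).symm
    _ ≤ _ := Real.rpow_le_rpow (by positivity) h1 (by positivity)

theorem rpow_le_two_mul_copies {q n : ℕ} (hq : 1 ≤ q) (hn : 1 ≤ n) :
    (n : ℝ) ^ (1 / q : ℝ) ≤ 2 * copies q n := by
  have hc : (1 : ℝ) ≤ copies q n := by exact_mod_cast copies_pos q hn
  have h1 : (n : ℝ) ≤ ((copies q n : ℝ) + 1) ^ q := by exact_mod_cast (lt_copies_succ_pow q n hq).le
  have h2 : (n : ℝ) ≤ (2 * copies q n : ℝ) ^ q :=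
    h1.trans (pow_le_pow_left₀ (by positivity) (by linarith) q)
  rw [one_div]
  calc (n : ℝ) ^ (q : ℝ)⁻¹ ≤ ((2 * copies q n : ℝ) ^ q) ^ (q : ℝ)⁻¹ :=
        Real.rpow_le_rpow (by positivity) h2 (by positivity)
    _ = _ := Real.pow_rpow_inv_natCast (by positivity) (by omega)

theorem isBigO_polylog {κ : ℕ → ℕ} (hκ : ∀ n, κ n ≤ Nat.log 2 n ^ 2) {γ : ℝ} (hγ : 0 < γ) :
    (fun n => (((κ n + 1) ^ 2 : ℕ) : ℝ)) =O[atTop] fun n : ℕ => (n : ℝ) ^ γ := by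
  have h1 : (fun n : ℕ => Real.log n ^ (4 : ℝ)) =O[atTop] fun n : ℕ => (n : ℝ) ^ γ :=
    ((isLittleO_log_rpow_rpow_atTop 4 hγ).comp_tendsto tendsto_natCast_atTop_atTop).isBigO
  refine IsBigO.trans (IsBigO.of_bound 25 ?_) h1
  filter_upwards [tendsto_log_natCast.eventually_ge_atTop 1, eventually_ge_atTop 1] with n hl hn
  have h2 : (Nat.log 2 n : ℝ) ≤ 2 * Real.log n := by
    have h4 : (2 : ℝ) ^ (Nat.log 2 n) ≤ n := by exact_mod_cast Nat.pow_log_le_self 2 (by omega)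
    have h5 := Real.log_le_log (by positivity) h4
    rw [Real.log_pow] at h5
    have := Real.log_two_gt_d9
    nlinarith [Nat.cast_nonneg (α := ℝ) (Nat.log 2 n)]
  have h3 : (κ n : ℝ) ≤ 4 * Real.log n ^ 2 := by
    calc (κ n : ℝ) ≤ (Nat.log 2 n : ℝ) ^ 2 := by exact_mod_cast hκ n
      _ ≤ (2 * Real.log n) ^ 2 := pow_le_pow_left₀ (by positivity) h2 2
      _ = _ := by ring
  rw [Real.norm_of_nonneg (by positivity), Real.norm_of_nonneg (by positivity)]
  rw [show (4 : ℝ) = ((4 : ℕ) : ℝ) by norm_num, Real.rpow_natCast]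
  push_cast
  calc ((κ n : ℝ) + 1) ^ 2 ≤ (5 * Real.log n ^ 2) ^ 2 := by
        refine pow_le_pow_left₀ (by positivity) ?_ 2
        nlinarith
    _ = 25 * Real.log n ^ 4 := by ring

/-- Both phases are truly subquadratic, by the exponent `1 / q`. -/
theorem isBigO_matching_time {q : ℕ} {T : ℕ → ℕ} {ε : ℝ} (hε1 : ε ≤ 1) (hq : 4 ≤ ε * q)
    (hq4 : 4 ≤ q) (hT : IsBigOPow T (2 - ε)) :
    (fun n => ((n * (n / copies q n) + n + n * copies q n + T (n * copies q n) : ℕ) : ℝ)) =O[atTop]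
      fun n : ℕ => (n : ℝ) ^ (2 - 1 / q : ℝ) := by
  have hq0 : (4 : ℝ) ≤ q := by exact_mod_cast hq4
  have hq1 : 1 / (q : ℝ) ≤ 1 / 4 := one_div_le_one_div_of_le (by norm_num) hq0
  have hqpos : 0 < 1 / (q : ℝ) := by positivity
  have hle : ∀ n, 1 ≤ n → n ≤ n * copies q n := fun n hn => by
    have := copies_pos q hn
    nlinarith
  have hNt : Tendsto (fun n => n * copies q n) atTop atTop :=
    tendsto_atTop_mono' _ ((eventually_ge_atTop 1).mono hle) tendsto_id
  obtain ⟨C, hC, hT⟩ := hT.exists_pos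
  have hT := hNt.eventually hT.bound
  refine IsBigO.of_bound (4 + C) ?_
  filter_upwards [hT, eventually_ge_atTop 1] with n hTn hn
  have hx : (1 : ℝ) ≤ n := by exact_mod_cast hn
  have hx0 : (0 : ℝ) < n := by linarith
  have hc1 : (1 : ℝ) ≤ copies q n := by exact_mod_cast copies_pos q hn
  have hcu := copies_le_rpow (n := n) (q := q) (by omega)
  have hcl := rpow_le_two_mul_copies (n := n) (q := q) (by omega) hn
  set c := copies q n
  set x : ℝ := (n : ℝ)
  set α : ℝ := 1 / q
  rw [Real.norm_of_nonneg (by positivity), Real.norm_of_nonneg (by positivity)] at hTn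
  rw [Real.norm_of_nonneg (by positivity), Real.norm_of_nonneg (by positivity)]
  have hmono : ∀ e : ℝ, e ≤ 2 - α → x ^ e ≤ x ^ (2 - α) := fun e he =>
    Real.rpow_le_rpow_of_exponent_le hx he
  have h1 : x * (n / c : ℕ) ≤ 2 * x ^ (2 - α) := by
    have h2 : ((n / c : ℕ) : ℝ) ≤ x / c := Nat.cast_div_le
    have h3 : x / c ≤ 2 * x / x ^ α := by
      rw [div_le_div_iff₀ (by linarith) (by positivity)]
      nlinarith
    calc x * (n / c : ℕ) ≤ x * (2 * x / x ^ α) := by gcongr; exact h2.trans h3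
      _ = 2 * x ^ (2 - α) := by
        rw [Real.rpow_sub hx0, Real.rpow_two]; ring
  have h2 : x ≤ x ^ (2 - α) := by simpa using hmono 1 (by linarith)
  have hN : x * c ≤ x ^ (1 + α) := by
    rw [Real.rpow_add hx0, Real.rpow_one]; gcongr
  have h3 : x * c ≤ x ^ (2 - α) := hN.trans (hmono _ (by linarith))
  have h4 : (T (n * c) : ℝ) ≤ C * x ^ (2 - α) := by
    refine hTn.trans ?_
    gcongr
    push_cast
    calc (x * c) ^ (2 - ε) ≤ (x ^ (1 + α)) ^ (2 - ε) :=
          Real.rpow_le_rpow (by positivity) hN (by linarith)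
      _ = x ^ ((1 + α) * (2 - ε)) := (Real.rpow_mul hx0.le _ _).symm
      _ ≤ _ := hmono _ (by
          have hα : α * q = 1 := by simp [α]; field_simp
          have : 4 * α ≤ ε := by nlinarith
          nlinarith)
  push_cast
  linarith

theorem WordRAM.Prog.Computes.mono {P : Prog} {W T T' : ℕ} {s : State} {good : State → Prop}
    (h : P.Computes W T s good) (hT : T ≤ T') : P.Computes W T' s good := by
  obtain ⟨F, h1, h2⟩ := h
  refine ⟨F, fun o ho => ?_, h2⟩
  obtain ⟨s', rfl, hs⟩ := h1 o ho
  exact ⟨s', rfl, hs.trans hT⟩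

theorem theorem4 (d : ℕ → ℕ) (η : ℕ → ℝ)
    (hd : IsOmegaLog (fun n => (d n : ℝ)))
    (hη_pos : ∀ᶠ n in atTop, 0 < η n)
    (hη : IsOmegaLog (fun n => 1 / η n))
    (hEMD : ∃ ε : ℝ, 0 < ε ∧ AsymEMDMatchingSolvable d η (2 - ε)) :
    ¬ HittingSetConjecture := by
  obtain ⟨ε₀, hε₀, P, w, T, hT, hP⟩ := hEMD
  set ε : ℝ := min ε₀ 1
  have hε : 0 < ε := lt_min hε₀ one_pos
  have hε1 : ε ≤ 1 := min_le_right _ _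
  have hT' : IsBigOPow T (2 - ε) := hT.mono (by linarith [min_le_left ε₀ 1])
  -- `n ^ (1 / q)` copies are so few that `(n ^ (1 + 1 / q)) ^ (2 - ε) ≤ n ^ (2 - 1 / q)`
  obtain ⟨q, hq⟩ := exists_nat_ge (4 / ε)
  rw [div_le_iff₀ hε, mul_comm] at hq
  have hq4 : 4 ≤ q := by
    have : (4 : ℝ) ≤ q := by nlinarith [Nat.cast_nonneg (α := ℝ) q]
    exact_mod_cast this
  have hq0 : (0 : ℝ) < q := by positivity
  set N : ℕ → ℕ := fun n => n * copies q n with hNdef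
  have hN : ∀ n, n ≤ N n := by
    intro n
    rcases Nat.eq_zero_or_pos n with rfl | hn
    · exact Nat.zero_le _
    · exact Nat.le_mul_of_pos_right _ (copies_pos q hn)
  -- `d'` keeps `k` polylogarithmic, the gadgets within `d`, and `8 * k * η ≤ 1`
  set d' : ℕ → ℕ := fun n =>
    min (Nat.log 2 n ^ 2) (min ⌊(d (N n) : ℝ) / 5⌋₊ ⌊1 / η (N n) / 8⌋₊) with hd'
  have hω : IsOmegaLog fun n => (d' n : ℝ) := by
    refine isOmegaLog_log_sq.min (IsOmegaLog.min ?_ ?_)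
    · exact hd.floor_comp (Eventually.of_forall fun n => Nat.cast_nonneg _) hN (by norm_num)
    · exact hη.floor_comp (hη_pos.mono fun n hn => by positivity) hN (by norm_num)
  intro hHSC
  -- the rounds cost `n ^ (2 - 1 / q)` up to the polylogarithmic factor, which is at most
  -- `n ^ (1 / (2 * q))`
  refine hHSC d' hω (1 / (2 * q)) (by positivity) ⟨hittingProg q w P, 2 * w + q + 8,
    fun n => hittingTime q w (T (N n)) n (d' n), ?_, ?_⟩
  · have h1 := (isBigO_polylog (κ := d') (fun n => min_le_left _ _)
      (show 0 < 1 / (2 * q : ℝ) by positivity)).mul (isBigO_matching_time hε1 hq hq4 hT')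
    have h2 : (fun n => (hittingTime q w (T (N n)) n (d' n) : ℝ)) =O[atTop] fun n =>
        (((d' n + 1) ^ 2 : ℕ) : ℝ) *
          ((n * (n / copies q n) + n + n * copies q n + T (n * copies q n) : ℕ) : ℝ) := by
      refine IsBigO.of_bound (4 * q + 10 * w + 2000 : ℕ) ?_
      filter_upwards [eventually_ge_atTop 1] with n hn
      rw [Real.norm_of_nonneg (by positivity), Real.norm_of_nonneg (by positivity)]
      exact_mod_cast hittingTime_le hn
    refine (h2.trans h1).congr' EventuallyEq.rfl ?_
    filter_upwards [eventually_ge_atTop 1] with n hn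
    rw [← Real.rpow_add (by exact_mod_cast hn)]
    congr 1
    field_simp
    ring
  · intro n k hk A B hA hB
    have hk1 : k ≤ ⌊(d (N n) : ℝ) / 5⌋₊ := hk.trans ((min_le_right _ _).trans (min_le_left _ _))
    have hk2 : k ≤ ⌊1 / η (N n) / 8⌋₊ := hk.trans ((min_le_right _ _).trans (min_le_right _ _))
    have hdim : k * 5 ≤ d (N n) := by
      have h1 : (k : ℝ) ≤ (d (N n) : ℝ) / 5 := (Nat.le_floor_iff (by positivity)).1 hk1
      have h2 : (k : ℝ) * 5 ≤ d (N n) := by linarith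
      exact_mod_cast h2
    have hη8 : 8 * k * η (N n) ≤ 1 := by
      rcases le_or_gt (η (N n)) 0 with h0 | h0
      · have : 8 * k * η (N n) ≤ 0 := mul_nonpos_of_nonneg_of_nonpos (by positivity) h0
        linarith
      · have h1 : (k : ℝ) ≤ 1 / η (N n) / 8 := (Nat.le_floor_iff (by positivity)).1 hk2
        rw [le_div_iff₀ (by norm_num), le_div_iff₀ h0] at h1
        linarith
    exact (computes_hittingProg hA hB hη8 fun m A' B' hm hA' hB' =>
      hP (N n) (k * 5) m hdim hm A' B' hA' hB').mono (hittingTime_mono hk)
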